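/- Let $\mathfrak H$ be a complex Hilbert space and let $\mathcal N$ be a nest on $\mathfrak H$, i.e. a chain of closed subspaces of $\mathfrak H$ that contains $\{0\}$ and $\mathfrak H$ and is closed under arbitrary intersections and arbitrary closed linear spans. Let $\tau(\mathcal N)$ be the nest algebra of all $T\in B(\mathfrak H)$ with $TM\subseteq M$ for every $M\in\mathcal N$, and let $\mathfrak B$ be either $\tau(\mathcal N)$ or the quasi-triangular algebra $\tau(\mathcal N)+K=\{T+C : T\in\tau(\mathcal N),\ C \text{ a compact operator on } \mathfrak H\}$, with the operator norm. A flow on $\mathfrak B$ is a group homomorphism $t\mapsto\alpha_t$ from $(\mathbb R,+)$ into the group of bounded algebra automorphisms of $\mathfrak B$ such that $\lim_{t\to t_0}\|\alpha_t(A)-\alpha_{t_0}(A)\|=0$ for all $A\in\mathfrak B$ and $t_0\in\mathbb R$. Then: 1. Every flow $\alpha$ on $\mathfrak B$ is uniformly continuous, i.e. $\lim_{t\to t_0}\|\alpha_t-\alpha_{t_0}\|=0$ (operator norm on $\mathfrak B$) for every $t_0\in\mathbb R$. 2. Any two flows $\alpha,\beta$ on $\mathfrak B$ are cocycle perturbations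 of each other: there is a norm continuous map $t\mapsto u_t$ from $\mathbb R$ into the invertible elements of $\mathfrak B$ such that $u_s\,\alpha_s(u_t)=u_{s+t}$ for all $s,t\in\mathbb R$ and $\beta_t(A)=u_t\,\alpha_t(A)\,u_t^{-1}$ for all $t\in\mathbb R$ and $A\in\mathfrak B$; and likewise with the roles of $\alpha$ and $\beta$ exchanged. -/

import Mathlib

open Filter Topology

/-- A flow on a complex unital normed algebra `A`: a homomorphism `t ↦ α_t` from the additive
group `ℝ` into the group of bounded algebra automorphisms of `A` (bijective, unital, `ℂ`-linear,
multiplicative, continuous with continuous inverse) such that, for every `a`, the orbit map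
`t ↦ α_t(a)` is norm continuous. -/
structure BanachFlow (A : Type*) [NormedRing A] [NormedAlgebra ℂ A] where
  /-- The bounded automorphism `α_t`. -/
  aut : ℝ → (A ≃A[ℂ] A)
  aut_zero : aut 0 = ContinuousAlgEquiv.refl ℂ A
  aut_add : ∀ (s t : ℝ) (a : A), aut (s + t) a = aut s (aut t a)
  tendsto_aut : ∀ (a : A) (t₀ : ℝ), Tendsto (fun t => ‖aut t a - aut t₀ a‖) (𝓝 t₀) (𝓝 0)

namespace BanachFlow

variable {A : Type*} [NormedRing A] [NormedAlgebra ℂ A]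

/-- `α_t` as a bounded linear operator on `A`. -/
def toCLM (α : BanachFlow A) (t : ℝ) : A →L[ℂ] A :=
  ((α.aut t).toContinuousLinearEquiv : A →L[ℂ] A)

/-- The flow is continuous for the operator norm: `‖α_t - α_{t₀}‖ → 0` as `t → t₀`. -/
def IsUniformlyContinuous (α : BanachFlow A) : Prop :=
  ∀ t₀ : ℝ, Tendsto (fun t => ‖α.toCLM t - α.toCLM t₀‖) (𝓝 t₀) (𝓝 0)

/-- `u` is an `α`-cocycle: a norm continuous map from `ℝ` into the invertible elements of `A`
with `u_s α_s(u_t) = u_{s+t}`. -/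
def IsCocycle (α : BanachFlow A) (u : ℝ → Aˣ) : Prop :=
  Continuous (fun t => (u t : A)) ∧
    ∀ s t : ℝ, (u s : A) * α.aut s (u t : A) = (u (s + t) : A)

/-- `β` is a cocycle perturbation of `α`: there is an `α`-cocycle `u` with
`β_t(a) = u_t α_t(a) u_t⁻¹`. -/
def IsCocyclePerturbation (β α : BanachFlow A) : Prop :=
  ∃ u : ℝ → Aˣ, α.IsCocycle u ∧
    ∀ (t : ℝ) (a : A), β.aut t a = (u t : A) * α.aut t a * ((u t)⁻¹ : Aˣ)

end BanachFlow

section NestAlgebras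

variable {H : Type*} [NormedAddCommGroup H] [InnerProductSpace ℂ H]

/-- A nest: a chain of closed subspaces containing `{0}` and the whole space, closed under
arbitrary intersections and arbitrary closed linear spans. -/
structure IsNest (N : Set (Submodule ℂ H)) : Prop where
  isClosed : ∀ M ∈ N, IsClosed (M : Set H)
  isChain : IsChain (· ≤ ·) N
  bot_mem : ⊥ ∈ N
  top_mem : ⊤ ∈ N
  sInf_mem : ∀ S ⊆ N, sInf S ∈ N
  closure_sSup_mem : ∀ S ⊆ N, (sSup S).topologicalClosure ∈ N

/-- The algebra of all bounded operators leaving each member of `N` invariant, with the operator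
norm. -/
def nestAlgebra (N : Set (Submodule ℂ H)) : Subalgebra ℂ (H →L[ℂ] H) where
  carrier := {T | ∀ M ∈ N, ∀ x ∈ M, T x ∈ M}
  mul_mem' := fun {S T} hS hT M hM x hx => hS M hM (T x) (hT M hM x hx)
  add_mem' := fun {S T} hS hT M hM x hx => M.add_mem (hS M hM x hx) (hT M hM x hx)
  algebraMap_mem' := fun c M _ x hx => by
    simpa [Algebra.algebraMap_eq_smul_one] using M.smul_mem c hx

/-- The quasi-triangular algebra: all operators `T + K` with `T` in the nest algebra and `K`
compact, with the operator norm. -/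
def quasiTriangularAlgebra (N : Set (Submodule ℂ H)) : Subalgebra ℂ (H →L[ℂ] H) where
  carrier := {R | ∃ T ∈ nestAlgebra N, ∃ K : H →L[ℂ] H, IsCompactOperator K ∧ R = T + K}
  mul_mem' := by
    rintro _ _ ⟨S, hS, K, hK, rfl⟩ ⟨T, hT, L, hL, rfl⟩
    refine ⟨S * T, mul_mem hS hT, S * L + K * (T + L), ?_, by noncomm_ring⟩
    exact (hL.clm_comp S).add (hK.comp_clm (T + L))
  add_mem' := by
    rintro _ _ ⟨S, hS, K, hK, rfl⟩ ⟨T, hT, L, hL, rfl⟩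
    exact ⟨S + T, add_mem hS hT, K + L, hK.add hL, by abel⟩
  algebraMap_mem' := fun c =>
    ⟨algebraMap ℂ _ c, Subalgebra.algebraMap_mem _ c, 0, isCompactOperator_zero, by simp⟩

end NestAlgebras

/-! Rank one operators x ⊗ e (`rankOne ℂ x e`) carry information between the algebra and the space
through A(x ⊗ e) = (Ax) ⊗ e, and x ⊗ e lies in the nest algebra as soon as some M in the nest has x
∈ M and e ⊥ M.

Uniform continuity. By the group law it is enough to treat γ_n = α_{t_n} with t_n → 0, a bounded
sequence by Banach–Steinhaus. If x ⊗ e ∈ 𝔅 for a fixed unit vector e and all x in a member L, then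
T_n x = γ_n(x ⊗ e)e satisfies T_n A x = γ_n(A) T_n x and tends to x. If T_n did not tend to the
identity uniformly, gliding humps would produce a single operator A in the nest algebra, an
orthogonal sum of rank ones, for which γ_n(A) fails to tend to A. Humps are sought at gaps, at right
limits and at left limits of the nest, and `IsNest.induction` assembles the local estimates
(`Implements.tendsto_uniformly`). This settles the quasi-triangular algebra and nests with a gap
below the whole space. For the remaining nests, L is a proper member, duality gives the adjoint
statement, and a factorisation of rank ones joins the two (`ApproxIdentity.unifOn_nest_rankOne`).

Cocycles. A uniformly continuous flow has a bounded derivation as generator. If that derivation is x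
↦ dx − xd with d ∈ 𝔅, the flow is conjugation by exp(td), and exp(tb)exp(−ta) is a cocycle linking
the flows of a and b. The derivation is implemented by some bounded d, again through rank ones. It
remains to show d ∈ 𝔅, which is easy for the nest algebra.

Quasi-triangular operators. Both d ∈ 𝔅 and the closedness of 𝔅 rest on a local criterion,
`QuasiLocal`: the corners (1 − P)TP are compact, and every family of intervals shrinking strongly to
zero has a member compressing T close to the nest algebra. `QuasiLocal.mem` shows that such T is
quasi-triangular, by a block decomposition along a finite chain. The criterion passes to norm
limits, and `quasiLocal_of_commutators` verifies it for d by a further gliding hump combined with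
averaging over symmetries of the nest. -/

open InnerProductSpace (rankOne rankOne_apply norm_rankOne)

/-! ### Nests, their projections, limits and duality -/

section NestBasics

set_option linter.unusedSectionVars false

variable {H : Type*} [NormedAddCommGroup H] [InnerProductSpace ℂ H] [CompleteSpace H]

/-- The orthogonal projection onto (the closure of) a subspace. -/
noncomputable def nproj (M : Submodule ℂ H) : H →L[ℂ] H := M.topologicalClosure.starProjection

theorem nproj_mem {M : Submodule ℂ H} (hM : IsClosed (M : Set H)) (x : H) : nproj M x ∈ M := by
  have h : nproj M x ∈ M.topologicalClosure := Submodule.starProjection_apply_mem _ x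
  rwa [hM.submodule_topologicalClosure_eq] at h

theorem nproj_of_mem {M : Submodule ℂ H} {x : H} (hx : x ∈ M) : nproj M x = x :=
  Submodule.starProjection_eq_self_iff.2 (M.le_topologicalClosure hx)

theorem sub_nproj_mem (M : Submodule ℂ H) (x : H) : x - nproj M x ∈ Mᗮ := by
  have h := Submodule.sub_starProjection_mem_orthogonal (K := M.topologicalClosure) x
  rwa [Submodule.orthogonal_closure] at h

theorem nproj_of_mem_orthogonal {M : Submodule ℂ H} {x : H} (hx : x ∈ Mᗮ) : nproj M x = 0 := by
  refine (Submodule.starProjection_apply_eq_zero_iff _).2 ?_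
  rwa [Submodule.orthogonal_closure]

theorem nproj_inner (M : Submodule ℂ H) (x y : H) :
    inner ℂ (nproj M x) y = inner ℂ x (nproj M y) :=
  Submodule.inner_starProjection_left_eq_right _ x y

theorem norm_nproj_apply_le (M : Submodule ℂ H) (x : H) : ‖nproj M x‖ ≤ ‖x‖ :=
  Submodule.norm_starProjection_apply_le _ x

theorem norm_nproj_le (M : Submodule ℂ H) : ‖nproj M‖ ≤ 1 := Submodule.starProjection_norm_le _

theorem isStarProjection_nproj (M : Submodule ℂ H) : IsStarProjection (nproj M) :=
  isStarProjection_starProjection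

theorem nproj_mul_of_le {M M' : Submodule ℂ H} (h : M ≤ M') : nproj M * nproj M' = nproj M :=
  Submodule.starProjection_comp_starProjection_of_le (Submodule.topologicalClosure_mono h)

theorem nproj_mul_of_ge {M M' : Submodule ℂ H} (h : M ≤ M') : nproj M' * nproj M = nproj M := by
  have h1 := congrArg star (nproj_mul_of_le h)
  rwa [star_mul, (isStarProjection_nproj M).isSelfAdjoint.star_eq,
    (isStarProjection_nproj M').isSelfAdjoint.star_eq] at h1

theorem nproj_mul_self (M : Submodule ℂ H) : nproj M * nproj M = nproj M := nproj_mul_of_le le_rfl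

theorem nproj_bot : nproj (⊥ : Submodule ℂ H) = 0 := by
  ext x
  exact nproj_of_mem_orthogonal (by simp)

theorem nproj_top : nproj (⊤ : Submodule ℂ H) = 1 := by
  ext x
  exact nproj_of_mem trivial

theorem nproj_orthogonal (M : Submodule ℂ H) : nproj Mᗮ = 1 - nproj M := by
  ext x
  have h : x = nproj M x + (x - nproj M x) := by abel
  have h1 : nproj Mᗮ (nproj M x) = 0 := by
    refine nproj_of_mem_orthogonal ?_
    rw [Submodule.orthogonal_orthogonal_eq_closure]
    exact Submodule.starProjection_apply_mem _ _
  conv_lhs => rw [h, map_add, h1, nproj_of_mem (sub_nproj_mem M x), zero_add]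
  simp

theorem norm_sub_nproj_le (M : Submodule ℂ H) (v : H) {w : H} (hw : w ∈ M) :
    ‖v - nproj M v‖ ≤ ‖v - w‖ := by
  have h : v - nproj M v = (1 - nproj M) (v - w) := by
    simp [nproj_of_mem hw]
  rw [h, ← nproj_orthogonal]
  exact norm_nproj_apply_le _ _

theorem norm_sq_eq_nproj (M : Submodule ℂ H) (v : H) :
    ‖v‖ ^ 2 = ‖nproj M v‖ ^ 2 + ‖v - nproj M v‖ ^ 2 := by
  have := Submodule.norm_sq_eq_add_norm_sq_starProjection v M.topologicalClosure
  rw [this, Submodule.starProjection_orthogonal']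
  rfl

theorem nproj_sub_apply_of_mem {M M' : Submodule ℂ H} {x : H} (hx : x ∈ M') (hx' : x ∈ Mᗮ) :
    (nproj M' - nproj M) x = x := by
  simp [nproj_of_mem hx, nproj_of_mem_orthogonal hx']

variable {N : Set (Submodule ℂ H)}

theorem IsNest.le_total (hN : IsNest N) {M M' : Submodule ℂ H} (hM : M ∈ N) (hM' : M' ∈ N) :
    M ≤ M' ∨ M' ≤ M := hN.isChain.total hM hM'

theorem IsNest.lt_of_not_le (hN : IsNest N) {M M' : Submodule ℂ H} (hM : M ∈ N) (hM' : M' ∈ N)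
    (h : ¬ M ≤ M') : M' < M :=
  lt_of_le_not_ge ((hN.le_total hM hM').resolve_left h) h

theorem IsNest.exists_ge_ge (hN : IsNest N) {P M M' : Submodule ℂ H} (hM : M ∈ N ∧ M < P)
    (hM' : M' ∈ N ∧ M' < P) : ∃ Q, (Q ∈ N ∧ Q < P) ∧ M ≤ Q ∧ M' ≤ Q := by
  rcases hN.le_total hM.1 hM'.1 with h | h
  exacts [⟨M', hM', h, le_rfl⟩, ⟨M, hM, le_rfl, h⟩]

theorem mem_nestAlgebra {T : H →L[ℂ] H} : T ∈ nestAlgebra N ↔ ∀ M ∈ N, ∀ x ∈ M, T x ∈ M := Iff.rfl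

theorem rankOne_mem_nestAlgebra {x e : H} (h : ∀ M ∈ N, x ∈ M ∨ e ∈ Mᗮ) :
    rankOne ℂ x e ∈ nestAlgebra N := by
  intro M hM v hv
  rw [rankOne_apply]
  rcases h M hM with hx | he
  · exact M.smul_mem _ hx
  · rw [Submodule.inner_left_of_mem_orthogonal hv he, zero_smul]
    exact M.zero_mem

theorem rankOne_mem_nestAlgebra_of_mem (hN : IsNest N) {M : Submodule ℂ H} (hM : M ∈ N) {x e : H}
    (hx : x ∈ M) (he : e ∈ Mᗮ) : rankOne ℂ x e ∈ nestAlgebra N := by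
  refine rankOne_mem_nestAlgebra fun Q hQ => ?_
  rcases hN.le_total hM hQ with h | h
  · exact Or.inl (h hx)
  · exact Or.inr (Submodule.orthogonal_le h he)

theorem mem_nestAlgebra_of_commute (hN : IsNest N) {T : H →L[ℂ] H}
    (h : ∀ M ∈ N, Commute T (nproj M)) : T ∈ nestAlgebra N := by
  intro M hM x hx
  have h1 := congrArg (fun S : H →L[ℂ] H => S x) (h M hM).eq
  simp only [mul_apply_eq_comp, nproj_of_mem hx] at h1
  rw [h1]
  exact nproj_mem (hN.isClosed M hM) _

theorem nproj_commute (hN : IsNest N) {M M' : Submodule ℂ H} (hM : M ∈ N) (hM' : M' ∈ N) :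
    Commute (nproj M) (nproj M') := by
  rcases hN.le_total hM hM' with h | h
  · exact (nproj_mul_of_le h).trans (nproj_mul_of_ge h).symm
  · exact (nproj_mul_of_ge h).trans (nproj_mul_of_le h).symm

theorem nproj_mem_nestAlgebra (hN : IsNest N) {M : Submodule ℂ H} (hM : M ∈ N) :
    nproj M ∈ nestAlgebra N :=
  mem_nestAlgebra_of_commute hN fun _ hM' => nproj_commute hN hM hM'

theorem nproj_mul_mul_nproj (hN : IsNest N) {T : H →L[ℂ] H} (hT : T ∈ nestAlgebra N)
    {M : Submodule ℂ H} (hM : M ∈ N) : nproj M * T * nproj M = T * nproj M := by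
  ext x
  exact nproj_of_mem (hT M hM _ (nproj_mem (hN.isClosed M hM) x))

theorem mem_nestAlgebra_of_compl_mul (hN : IsNest N) {T : H →L[ℂ] H}
    (h : ∀ M ∈ N, (1 - nproj M) * T * nproj M = 0) : T ∈ nestAlgebra N := by
  intro M hM x hx
  have h1 := congrArg (fun S : H →L[ℂ] H => S x) (h M hM)
  simp only [mul_apply_eq_comp, nproj_of_mem hx, sub_apply,
    one_apply_eq_self, zero_apply, sub_eq_zero] at h1
  rw [h1]
  exact nproj_mem (hN.isClosed M hM) _

/-- Such a strictly upper triangular block kills the members below `Q`, and its range lies in every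
member above `Q`. -/
theorem nproj_mul_mul_compl_mem (hN : IsNest N) {Q : Submodule ℂ H} (hQ : Q ∈ N) (X : H →L[ℂ] H) :
    nproj Q * X * (1 - nproj Q) ∈ nestAlgebra N := by
  intro M hM x hx
  rcases hN.le_total hM hQ with h | h
  · have : (nproj Q * X * (1 - nproj Q)) x = 0 := by simp [nproj_of_mem (h hx)]
    rw [this]; exact M.zero_mem
  · exact h (nproj_mem (hN.isClosed Q hQ) _)

theorem isClosed_nestAlgebra (hN : IsNest N) : IsClosed (nestAlgebra N : Set (H →L[ℂ] H)) := by
  have : (nestAlgebra N : Set (H →L[ℂ] H)) = ⋂ M ∈ N, ⋂ x ∈ M, {T | T x ∈ M} := by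
    ext T; simp [mem_nestAlgebra]
  rw [this]
  refine isClosed_biInter fun M hM => isClosed_biInter fun x _ => ?_
  exact (hN.isClosed M hM).preimage (ContinuousLinearMap.apply ℂ H x).continuous

/-- The immediate predecessor `P₋` of `P` in the nest (which may be `P` itself). -/
def nestPred (N : Set (Submodule ℂ H)) (P : Submodule ℂ H) : Submodule ℂ H :=
  (sSup {Q | Q ∈ N ∧ Q < P}).topologicalClosure

/-- The immediate successor `P₊` of `P` in the nest (which may be `P` itself). -/
def nestSucc (N : Set (Submodule ℂ H)) (P : Submodule ℂ H) : Submodule ℂ H :=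
  sInf {Q | Q ∈ N ∧ P < Q}

theorem IsNest.pred_mem (hN : IsNest N) (P : Submodule ℂ H) : nestPred N P ∈ N :=
  hN.closure_sSup_mem _ fun _ h => h.1

theorem IsNest.succ_mem (hN : IsNest N) (P : Submodule ℂ H) : nestSucc N P ∈ N :=
  hN.sInf_mem _ fun _ h => h.1

theorem IsNest.pred_le (hN : IsNest N) {P : Submodule ℂ H} (hP : P ∈ N) : nestPred N P ≤ P :=
  Submodule.topologicalClosure_minimal _ (sSup_le fun _ h => h.2.le) (hN.isClosed P hP)

theorem le_nestPred {P Q : Submodule ℂ H} (hQ : Q ∈ N) (h : Q < P) : Q ≤ nestPred N P :=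
  (le_sSup (show Q ∈ {Q | Q ∈ N ∧ Q < P} from ⟨hQ, h⟩)).trans (Submodule.le_topologicalClosure _)

theorem le_nestSucc (P : Submodule ℂ H) : P ≤ nestSucc N P := le_sInf fun _ h => h.2.le

theorem nestSucc_le {P Q : Submodule ℂ H} (hQ : Q ∈ N) (h : P < Q) : nestSucc N P ≤ Q :=
  sInf_le ⟨hQ, h⟩

theorem IsNest.exists_lt_of_pred_eq (hN : IsNest N) {P : Submodule ℂ H} (hP : P ≠ ⊥)
    (h : nestPred N P = P) : ∃ Q, Q ∈ N ∧ Q < P := by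
  by_contra! hne
  refine hP (h ▸ ?_)
  have : {Q | Q ∈ N ∧ Q < P} = ∅ := Set.eq_empty_iff_forall_notMem.2 fun Q hQ => hne Q hQ.1 hQ.2
  rw [nestPred, this, sSup_empty, IsClosed.submodule_topologicalClosure_eq]
  exact hN.isClosed _ hN.bot_mem

theorem IsNest.exists_gt_of_succ_eq {P : Submodule ℂ H} (hP : P ≠ ⊤)
    (h : nestSucc N P = P) : ∃ Q, Q ∈ N ∧ P < Q := by
  by_contra! hne
  refine hP (h ▸ ?_)
  have : {Q | Q ∈ N ∧ P < Q} = ∅ := Set.eq_empty_iff_forall_notMem.2 fun Q hQ => hne Q hQ.1 hQ.2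
  rw [nestSucc, this, sInf_empty]

/-- At a left limit the members strictly below `P` form a chain whose union is dense in `P`, so
their projections increase strongly to that of `P`. -/
theorem IsNest.exists_norm_sub_lt_left (hN : IsNest N) {P : Submodule ℂ H} (hP : P ∈ N)
    (hP0 : P ≠ ⊥) (h : nestPred N P = P) (v : H) {ε : ℝ} (hε : 0 < ε) :
    ∃ Q, (Q ∈ N ∧ Q < P) ∧ ∀ Q' ∈ N, Q ≤ Q' → Q' ≤ P → ‖(nproj P - nproj Q') v‖ < ε := by
  have hv : nproj P v ∈ nestPred N P := by rw [h]; exact nproj_mem (hN.isClosed P hP) v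
  obtain ⟨w, hw, hvw⟩ := Metric.mem_closure_iff.1 hv ε hε
  obtain ⟨Q₀, hQ₀⟩ := hN.exists_lt_of_pred_eq hP0 h
  have hdir : DirectedOn (· ≤ ·) {Q | Q ∈ N ∧ Q < P} := fun M hM M' hM' => by
    obtain ⟨Q, hQ, h1, h2⟩ := hN.exists_ge_ge hM hM'
    exact ⟨Q, hQ, h1, h2⟩
  obtain ⟨Q, hQ, hwQ⟩ := (Submodule.mem_sSup_of_directed ⟨Q₀, hQ₀⟩ hdir).1 hw
  refine ⟨Q, hQ, fun Q' _ hQQ' hQP => ?_⟩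
  have h1 : (nproj P - nproj Q') v = nproj P v - nproj Q' (nproj P v) := by
    rw [sub_apply, ← mul_apply_eq_comp (nproj Q'),
      nproj_mul_of_le hQP]
  rw [h1]
  exact (norm_sub_nproj_le Q' _ (hQQ' hwQ)).trans_lt (by rwa [← dist_eq_norm])

/-- A topological induction principle along a nest. -/
theorem IsNest.induction (hN : IsNest N) (good : Submodule ℂ H → Prop) (h0 : good ⊥)
    (hr : ∀ P ∈ N, good P → P ≠ ⊤ → ∃ R ∈ N, P < R ∧ good R)
    (hl : ∀ P ∈ N, P ≠ ⊥ → nestPred N P = P →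
      (∀ Q ∈ N, Q < P → ∃ Q' ∈ N, Q ≤ Q' ∧ Q' < P ∧ good Q') → good P) : good ⊤ := by
  set s := (sSup {Q | Q ∈ N ∧ good Q}).topologicalClosure with hs
  have hsN : s ∈ N := hN.closure_sSup_mem _ fun _ h => h.1
  have hle : ∀ Q ∈ N, good Q → Q ≤ s := fun Q hQ hg =>
    (le_sSup (show Q ∈ {Q | Q ∈ N ∧ good Q} from ⟨hQ, hg⟩)).trans
      (Submodule.le_topologicalClosure _)
  have hgs : good s := by
    -- If `s` were not good, all good members would lie strictly below it; `s` would then be a left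
    -- limit with good members cofinal below it, which is the situation of `hl`.
    by_contra hng
    have hlt : ∀ Q ∈ N, good Q → Q < s := fun Q hQ hg =>
      lt_of_le_of_ne (hle Q hQ hg) fun h => hng (h ▸ hg)
    refine hng (hl s hsN (fun h => hng (h ▸ h0)) (le_antisymm (hN.pred_le hsN) ?_) ?_)
    · exact Submodule.topologicalClosure_mono (sSup_le_sSup fun Q hQ => ⟨hQ.1, hlt Q hQ.1 hQ.2⟩)
    · intro Q hQ hQs
      by_contra! hne
      refine hQs.not_ge (Submodule.topologicalClosure_minimal _ (sSup_le fun Q' hQ' => ?_)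
        (hN.isClosed Q hQ))
      by_contra hnle
      exact hne Q' hQ'.1 (hN.lt_of_not_le hQ'.1 hQ hnle).le (hlt Q' hQ'.1 hQ'.2) hQ'.2
  by_cases hst : s = ⊤
  · rwa [← hst]
  · obtain ⟨R, hR, hlt, hg⟩ := hr s hsN hgs hst
    exact absurd (hle R hR hg) hlt.not_ge

/-- The nest of orthogonal complements. -/
def dualNest (N : Set (Submodule ℂ H)) : Set (Submodule ℂ H) := Submodule.orthogonal '' N

theorem IsNest.orthogonal_orthogonal (hN : IsNest N) {M : Submodule ℂ H} (hM : M ∈ N) :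
    Mᗮᗮ = M := by
  rw [Submodule.orthogonal_orthogonal_eq_closure, (hN.isClosed M hM).submodule_topologicalClosure_eq]

theorem IsNest.dual (hN : IsNest N) : IsNest (dualNest N) where
  isClosed := by
    rintro _ ⟨M, -, rfl⟩
    exact M.isClosed_orthogonal
  isChain := by
    rintro _ ⟨M, hM, rfl⟩ _ ⟨M', hM', rfl⟩ -
    rcases hN.le_total hM hM' with h | h
    exacts [Or.inr (Submodule.orthogonal_le h), Or.inl (Submodule.orthogonal_le h)]
  bot_mem := ⟨⊤, hN.top_mem, Submodule.top_orthogonal_eq_bot⟩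
  top_mem := ⟨⊥, hN.bot_mem, Submodule.bot_orthogonal_eq_top⟩
  sInf_mem := by
    intro S hS
    refine ⟨(sSup {M | M ∈ N ∧ Mᗮ ∈ S}).topologicalClosure, hN.closure_sSup_mem _ fun _ h => h.1, ?_⟩
    rw [Submodule.orthogonal_closure, ← Submodule.sInf_orthogonal]
    refine le_antisymm (le_sInf fun K hK => ?_) (le_iInf₂ fun K hK => sInf_le hK.2)
    obtain ⟨M, hM, rfl⟩ := hS hK
    exact iInf₂_le M ⟨hM, hK⟩
  closure_sSup_mem := by
    intro S hS
    refine ⟨sInf {M | M ∈ N ∧ Mᗮ ∈ S}, hN.sInf_mem _ fun _ h => h.1, ?_⟩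
    rw [← Submodule.orthogonal_orthogonal_eq_closure, ← Submodule.sInf_orthogonal]
    congr 1
    refine le_antisymm (le_iInf₂ fun K hK => ?_) (le_sInf fun M hM => ?_)
    · obtain ⟨M, hM, rfl⟩ := hS hK
      rw [hN.orthogonal_orthogonal hM]
      exact sInf_le ⟨hM, hK⟩
    · refine (iInf₂_le _ hM.2).trans ?_
      rw [hN.orthogonal_orthogonal hM.1]

theorem IsNest.orthogonal_lt (hN : IsNest N) {M M' : Submodule ℂ H} (hM : M ∈ N) (hM' : M' ∈ N)
    (h : M < M') : M'ᗮ < Mᗮ := by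
  refine lt_of_le_not_ge (Submodule.orthogonal_le h.le) fun hle => h.not_ge ?_
  have := Submodule.orthogonal_le hle
  rwa [hN.orthogonal_orthogonal hM, hN.orthogonal_orthogonal hM'] at this

/-- Orthogonal complementation turns a right limit of the nest into a left limit of the dual nest.
-/
theorem IsNest.exists_norm_sub_lt_right (hN : IsNest N) {P : Submodule ℂ H} (hP : P ∈ N)
    (hP1 : P ≠ ⊤) (h : nestSucc N P = P) (v : H) {ε : ℝ} (hε : 0 < ε) :
    ∃ R, (R ∈ N ∧ P < R) ∧ ∀ R' ∈ N, R' ≤ R → P ≤ R' → ‖(nproj R' - nproj P) v‖ < ε := by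
  have hpred : nestPred (dualNest N) Pᗮ = Pᗮ := by
    rw [nestPred, ← Submodule.orthogonal_orthogonal_eq_closure, ← Submodule.sInf_orthogonal]
    congr 1
    conv_rhs => rw [← h]
    refine le_antisymm (le_sInf fun Q hQ => ?_) (le_iInf₂ ?_)
    · refine (iInf₂_le Qᗮ ⟨⟨Q, hQ.1, rfl⟩, hN.orthogonal_lt hP hQ.1 hQ.2⟩).trans ?_
      rw [hN.orthogonal_orthogonal hQ.1]
    · rintro _ ⟨⟨M, hM, rfl⟩, hlt⟩
      rw [hN.orthogonal_orthogonal hM]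
      refine nestSucc_le hM (hN.lt_of_not_le hM hP fun hle => ?_)
      exact hlt.not_ge (Submodule.orthogonal_le hle)
  have hP0 : Pᗮ ≠ ⊥ := fun h0 => hP1 <| by
    rw [← hN.orthogonal_orthogonal hP, h0, Submodule.bot_orthogonal_eq_top]
  obtain ⟨_, ⟨⟨R, hR, rfl⟩, hlt⟩, hR'⟩ :=
    hN.dual.exists_norm_sub_lt_left ⟨P, hP, rfl⟩ hP0 hpred v hε
  refine ⟨R, ⟨hR, hN.lt_of_not_le hR hP fun hle => hlt.not_ge (Submodule.orthogonal_le hle)⟩,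
    fun R' hRN' hle hge => ?_⟩
  have := hR' R'ᗮ ⟨R', hRN', rfl⟩ (Submodule.orthogonal_le hle) (Submodule.orthogonal_le hge)
  rw [nproj_orthogonal, nproj_orthogonal] at this
  simpa using this

theorem adjoint_mem_nestAlgebra_dual (hN : IsNest N) {T : H →L[ℂ] H} :
    star T ∈ nestAlgebra (dualNest N) ↔ T ∈ nestAlgebra N := by
  constructor
  · intro h M hM x hx
    rw [← hN.orthogonal_orthogonal hM, Submodule.mem_orthogonal]
    intro u hu
    rw [← ContinuousLinearMap.adjoint_inner_left]
    exact Submodule.inner_left_of_mem_orthogonal hx (h Mᗮ ⟨M, hM, rfl⟩ u hu)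
  · rintro h _ ⟨M, hM, rfl⟩ x hx
    rw [Submodule.mem_orthogonal]
    intro u hu
    rw [ContinuousLinearMap.star_eq_adjoint, ContinuousLinearMap.adjoint_inner_right]
    exact Submodule.inner_right_of_mem_orthogonal (h M hM u hu) hx

end NestBasics

/-! ### Weak limits, orthogonal sums and compact operators -/

section OperatorTools

set_option linter.unusedSectionVars false

variable {H : Type*} [NormedAddCommGroup H] [InnerProductSpace ℂ H] [CompleteSpace H]

/-- Convergence in the weak operator topology along a filter. -/
def WeakTendsto {ι : Type*} (T : ι → H →L[ℂ] H) (l : Filter ι) (S : H →L[ℂ] H) : Prop :=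
  ∀ x y : H, Tendsto (fun i => inner ℂ x (T i y)) l (𝓝 (inner ℂ x (S y)))

namespace WeakTendsto

variable {ι : Type*} {l : Filter ι} {T T' : ι → H →L[ℂ] H} {S S' : H →L[ℂ] H}

theorem const (S : H →L[ℂ] H) : WeakTendsto (fun _ : ι => S) l S := fun _ _ => tendsto_const_nhds

theorem sub (h : WeakTendsto T l S) (h' : WeakTendsto T' l S') :
    WeakTendsto (fun i => T i - T' i) l (S - S') := fun x y => by
  simpa only [sub_apply, inner_sub_right] using (h x y).sub (h' x y)

theorem mul_right (h : WeakTendsto T l S) (A : H →L[ℂ] H) :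
    WeakTendsto (fun i => T i * A) l (S * A) := fun x y => h x (A y)

theorem mul_left (h : WeakTendsto T l S) (A : H →L[ℂ] H) :
    WeakTendsto (fun i => A * T i) l (A * S) := fun x y => by
  simpa only [mul_apply_eq_comp, ← ContinuousLinearMap.adjoint_inner_left] using
    h (ContinuousLinearMap.adjoint A x) y

theorem congr' (h : WeakTendsto T l S) (h' : ∀ᶠ i in l, T i = T' i) : WeakTendsto T' l S :=
  fun x y => (h x y).congr' (h'.mono fun i hi => by rw [hi])

theorem unique [l.NeBot] (h : WeakTendsto T l S) (h' : WeakTendsto T l S') : S = S' := by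
  ext y
  refine ext_inner_left ℂ fun x => tendsto_nhds_unique (h x y) (h' x y)

theorem eq_of_eventually [l.NeBot] (h : WeakTendsto T l S) {A : H →L[ℂ] H}
    (h' : ∀ᶠ i in l, T i = A) : S = A :=
  (h.congr' h').unique (const A)

theorem norm_le [l.NeBot] (h : WeakTendsto T l S) {C : ℝ} (hC : 0 ≤ C)
    (hT : ∀ᶠ i in l, ‖T i‖ ≤ C) : ‖S‖ ≤ C := by
  refine S.opNorm_le_bound hC fun y => ?_
  by_cases hy : S y = 0
  · rw [hy, norm_zero]; positivity
  have h1 : ‖inner ℂ (S y) (S y)‖ ≤ ‖S y‖ * (C * ‖y‖) := by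
    refine le_of_tendsto (h (S y) y).norm (hT.mono fun i hi => ?_)
    exact (norm_inner_le_norm _ _).trans
      (mul_le_mul_of_nonneg_left ((T i).le_of_opNorm_le hi y) (norm_nonneg _))
  rw [inner_self_eq_norm_sq_to_K, norm_pow, RCLike.norm_ofReal, abs_norm, sq] at h1
  exact le_of_mul_le_mul_left h1 (norm_pos_iff.2 hy)

/-- Invariance of `M` is the vanishing of the pairings of `T x` with vectors of `Mᗮ` for `x ∈ M`, a
weakly closed condition. -/
theorem mem_nestAlgebra {N : Set (Submodule ℂ H)} [l.NeBot] (hN : IsNest N)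
    (h : WeakTendsto T l S) (hT : ∀ i, T i ∈ nestAlgebra N) : S ∈ nestAlgebra N := by
  intro M hM x hx
  rw [← hN.orthogonal_orthogonal hM, Submodule.mem_orthogonal]
  intro u hu
  refine tendsto_nhds_unique (h u x) (tendsto_const_nhds.congr fun i => ?_)
  exact (Submodule.inner_left_of_mem_orthogonal (hT i M hM x hx) hu).symm

end WeakTendsto

theorem weakTendsto_of_tendsto {ι : Type*} {l : Filter ι} {T : ι → H →L[ℂ] H} {S : H →L[ℂ] H}
    (h : ∀ y, Tendsto (fun i => T i y) l (𝓝 (S y))) : WeakTendsto T l S :=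
  fun _ y => tendsto_const_nhds.inner (h y)

/-- Bounded families of operators converge weakly along every ultrafilter. -/
theorem exists_weakTendsto_ultrafilter {ι : Type*} (U : Ultrafilter ι) {T : ι → H →L[ℂ] H} {C : ℝ}
    (hT : ∀ i, ‖T i‖ ≤ C) : ∃ S : H →L[ℂ] H, ‖S‖ ≤ C ∧ WeakTendsto T U S := by
  have hC : 0 ≤ C := by
    obtain ⟨i⟩ := Filter.nonempty_of_neBot (U : Filter ι)
    exact (norm_nonneg _).trans (hT i)
  -- Each matrix coefficient stays in a compact disc, hence has a limit along `U`. The limit form is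
  -- bounded, and Riesz representation turns it into an operator.
  have hlim : ∀ y x : H, ∃ b : ℂ, ‖b‖ ≤ C * ‖y‖ * ‖x‖ ∧
      Tendsto (fun i => inner ℂ (T i y) x) U (𝓝 b) := by
    intro y x
    obtain ⟨b, hb, hbt⟩ := (isCompact_closedBall (0 : ℂ) (C * ‖y‖ * ‖x‖)).ultrafilter_le_nhds
      (U.map fun i => inner ℂ (T i y) x) (by
        rw [le_principal_iff]
        refine mem_map.2 (univ_mem' fun i => ?_)
        simp only [Set.mem_preimage, mem_closedBall_zero_iff]
        exact (norm_inner_le_norm _ _).trans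
          (mul_le_mul_of_nonneg_right ((T i).le_of_opNorm_le (hT i) y) (norm_nonneg _)))
    exact ⟨b, by simpa using hb, hbt⟩
  choose b hb hbt using hlim
  let φ : H → (H →L[ℂ] ℂ) := fun y => LinearMap.mkContinuous
    { toFun := b y
      map_add' := fun x x' => tendsto_nhds_unique (hbt y (x + x')) <| by
        simpa only [inner_add_right] using (hbt y x).add (hbt y x')
      map_smul' := fun c x => tendsto_nhds_unique (hbt y (c • x)) <| by
        simpa only [inner_smul_right, RingHom.id_apply, smul_eq_mul] using (hbt y x).const_mul c } (C * ‖y‖) (hb y)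
  let s : H → H := fun y => (InnerProductSpace.toDual ℂ H).symm (φ y)
  have hs : ∀ y x, inner ℂ (s y) x = b y x := fun y x =>
    InnerProductSpace.toDual_symm_apply
  have hsn : ∀ y, ‖s y‖ ≤ C * ‖y‖ := fun y => by
    rw [LinearIsometryEquiv.norm_map]
    exact LinearMap.mkContinuous_norm_le _ (by positivity) _
  let S : H →L[ℂ] H := LinearMap.mkContinuous
    { toFun := s
      map_add' := fun y y' => ext_inner_right ℂ fun x => by
        rw [inner_add_left, hs, hs, hs]
        refine tendsto_nhds_unique (hbt (y + y') x) ?_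
        simpa only [map_add, inner_add_left] using (hbt y x).add (hbt y' x)
      map_smul' := fun c y => ext_inner_right ℂ fun x => by
        rw [RingHom.id_apply, inner_smul_left, hs, hs]
        refine tendsto_nhds_unique (hbt (c • y) x) ?_
        simpa only [map_smul, inner_smul_left] using (hbt y x).const_mul (starRingEnd ℂ c) } C hsn
  refine ⟨S, LinearMap.mkContinuous_norm_le _ hC _, fun x y => ?_⟩
  have h1 : inner ℂ x (S y) = starRingEnd ℂ (b y x) := by
    rw [← hs y x, inner_conj_symm]; rfl
  rw [h1]
  refine ((Complex.continuous_conj.tendsto _).comp (hbt y x)).congr fun i => ?_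
  simp [inner_conj_symm]

/-! ### Orthogonal sums -/

/-- A sequence of mutually orthogonal projections. -/
structure OrthoProjs (E : ℕ → H →L[ℂ] H) : Prop where
  isStarProjection : ∀ k, IsStarProjection (E k)
  mul_eq_zero : ∀ j k, j ≠ k → E j * E k = 0

theorem IsStarProjection.inner_apply {E : H →L[ℂ] H} (hE : IsStarProjection E) (x y : H) :
    inner ℂ (E x) y = inner ℂ x (E y) := by
  rw [← ContinuousLinearMap.adjoint_inner_left, ← ContinuousLinearMap.star_eq_adjoint,
    hE.isSelfAdjoint.star_eq]

theorem IsStarProjection.norm_sq_apply {E : H →L[ℂ] H} (hE : IsStarProjection E) (x : H) :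
    ‖E x‖ ^ 2 = RCLike.re (inner ℂ x (E x)) := by
  have h : E (E x) = E x := congrArg (fun S : H →L[ℂ] H => S x) hE.isIdempotentElem.eq
  rw [← inner_self_eq_norm_sq (𝕜 := ℂ), hE.inner_apply, h]

theorem IsStarProjection.norm_apply_le {E : H →L[ℂ] H} (hE : IsStarProjection E) (x : H) :
    ‖E x‖ ≤ ‖x‖ := by
  by_cases h : ‖E x‖ = 0
  · rw [h]; exact norm_nonneg _
  have h1 := (RCLike.re_le_norm _).trans (norm_inner_le_norm (𝕜 := ℂ) x (E x))
  rw [← hE.norm_sq_apply, sq] at h1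
  exact le_of_mul_le_mul_right h1 (lt_of_le_of_ne (norm_nonneg _) (Ne.symm h))

theorem IsStarProjection.opNorm_le_one {E : H →L[ℂ] H} (hE : IsStarProjection E) : ‖E‖ ≤ 1 :=
  E.opNorm_le_bound zero_le_one fun x => by simpa using hE.norm_apply_le x

namespace OrthoProjs

variable {E F : ℕ → H →L[ℂ] H}

theorem inner_eq_zero (hE : OrthoProjs E) {j k : ℕ} (h : j ≠ k) (x y : H) :
    inner ℂ (E j x) (E k y) = 0 := by
  rw [(hE.isStarProjection j).inner_apply, ← mul_apply_eq_comp, hE.mul_eq_zero j k h]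
  simp

theorem norm_sq_sum (hE : OrthoProjs E) (n : ℕ) (v : ℕ → H) :
    ‖∑ k ∈ Finset.range n, E k (v k)‖ ^ 2 = ∑ k ∈ Finset.range n, ‖E k (v k)‖ ^ 2 := by
  induction n with
  | zero => simp
  | succ n ih =>
    rw [Finset.sum_range_succ, Finset.sum_range_succ, ← ih, sq, sq, sq]
    refine norm_add_sq_eq_norm_sq_add_norm_sq_of_inner_eq_zero (𝕜 := ℂ) _ _ ?_
    rw [sum_inner]
    exact Finset.sum_eq_zero fun k hk =>
      hE.inner_eq_zero (Finset.mem_range.1 hk).ne _ _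

theorem sum_norm_sq_le (hE : OrthoProjs E) (n : ℕ) (v : H) :
    ∑ k ∈ Finset.range n, ‖E k v‖ ^ 2 ≤ ‖v‖ ^ 2 := by
  have h1 := hE.norm_sq_sum n fun _ => v
  have h2 : ∑ k ∈ Finset.range n, ‖E k v‖ ^ 2 =
      RCLike.re (inner ℂ v (∑ k ∈ Finset.range n, E k v)) := by
    rw [inner_sum, map_sum]
    exact Finset.sum_congr rfl fun k _ => (hE.isStarProjection k).norm_sq_apply v
  have h3 := (RCLike.re_le_norm _).trans
    (norm_inner_le_norm (𝕜 := ℂ) v (∑ k ∈ Finset.range n, E k v))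
  rw [← h2, ← h1] at h3
  rw [← h1]
  have h4 : ‖∑ k ∈ Finset.range n, E k v‖ ≤ ‖v‖ := by
    by_contra! hlt
    nlinarith [norm_nonneg v]
  gcongr

/-- Bessel's inequality makes the squared norms summable. -/
theorem tendsto_zero (hE : OrthoProjs E) (v : H) : Tendsto (fun k => E k v) atTop (𝓝 0) := by
  have h : Summable fun k => ‖E k v‖ ^ 2 :=
    summable_of_sum_range_le (fun _ => by positivity) fun n => hE.sum_norm_sq_le n v
  have h2 := h.tendsto_atTop_zero.sqrt
  simp only [Real.sqrt_sq (norm_nonneg _), Real.sqrt_zero] at h2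
  exact tendsto_zero_iff_norm_tendsto_zero.2 h2

/-- Bounded block operators between orthogonal blocks can be summed. -/
theorem exists_sum (hE : OrthoProjs E) (hF : OrthoProjs F) {G : ℕ → H →L[ℂ] H}
    (hEG : ∀ k, E k * G k = G k) (hGF : ∀ k, G k * F k = G k) (hG : ∀ k, ‖G k‖ ≤ 1) :
    ∃ A : H →L[ℂ] H, ‖A‖ ≤ 1 ∧ (∀ k, E k * A = G k) ∧ (∀ k, A * F k = G k) ∧
      ∀ N : Set (Submodule ℂ H), IsNest N → (∀ k, G k ∈ nestAlgebra N) → A ∈ nestAlgebra N := by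
  set S : ℕ → H →L[ℂ] H := fun n => ∑ k ∈ Finset.range n, G k with hS
  -- The orthogonal ranges make the squared norms of the terms add up, and the orthogonal supports
  -- bound the total by ‖v‖².
  have hSn : ∀ n, ‖S n‖ ≤ 1 := by
    intro n
    refine (S n).opNorm_le_bound zero_le_one fun v => ?_
    have h1 : S n v = ∑ k ∈ Finset.range n, E k (G k v) := by
      simp only [hS, sum_apply]
      refine Finset.sum_congr rfl fun k _ => ?_
      rw [← mul_apply_eq_comp, hEG]
    have h2 : ‖S n v‖ ^ 2 ≤ ‖v‖ ^ 2 := by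
      rw [h1, hE.norm_sq_sum n fun k => G k v]
      refine le_trans (Finset.sum_le_sum fun k _ => ?_) (hF.sum_norm_sq_le n v)
      rw [← mul_apply_eq_comp, hEG]
      conv_lhs => rw [← hGF, mul_apply_eq_comp]
      gcongr
      simpa using (G k).le_of_opNorm_le (hG k) (F k v)
    rw [one_mul]
    exact le_of_sq_le_sq h2 (norm_nonneg _)
  obtain ⟨A, hA1, hA⟩ := exists_weakTendsto_ultrafilter (hyperfilter ℕ) hSn
  -- A free ultrafilter sees only large `n`, for which the `k`-th block of the partial sum is
  -- already constant.
  have hev : ∀ k, ∀ᶠ n in (hyperfilter ℕ : Filter ℕ), k < n := fun k =>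
    (Nat.hyperfilter_le_atTop : (hyperfilter ℕ : Filter ℕ) ≤ atTop) (eventually_gt_atTop k)
  refine ⟨A, hA1, fun k => ?_, fun k => ?_, fun N hN hGN => hA.mem_nestAlgebra hN fun n =>
    sum_mem fun k _ => hGN k⟩
  · refine (hA.mul_left (E k)).eq_of_eventually ((hev k).mono fun n hn => ?_)
    simp only [hS, Finset.mul_sum]
    rw [Finset.sum_eq_single_of_mem k (Finset.mem_range.2 hn), hEG]
    intro j _ hjk
    rw [← hEG j, ← mul_assoc, hE.mul_eq_zero k j hjk.symm, zero_mul]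
  · refine (hA.mul_right (F k)).eq_of_eventually ((hev k).mono fun n hn => ?_)
    simp only [hS, Finset.sum_mul]
    rw [Finset.sum_eq_single_of_mem k (Finset.mem_range.2 hn), hGF]
    intro j _ hjk
    rw [← hGF j, mul_assoc, hF.mul_eq_zero j k hjk, mul_zero]

end OrthoProjs

theorem isStarProjection_rankOne_self {x : H} (hx : ‖x‖ = 1) :
    IsStarProjection (rankOne ℂ x x) where
  isIdempotentElem := InnerProductSpace.isIdempotentElem_rankOne_self hx
  isSelfAdjoint := by
    rw [ContinuousLinearMap.isSelfAdjoint_iff_isSymmetric]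
    intro u v
    simp [inner_smul_left, inner_smul_right, mul_comm]

theorem orthoProjs_rankOne {x : ℕ → H} (hx : Orthonormal ℂ x) :
    OrthoProjs fun k => rankOne ℂ (x k) (x k) where
  isStarProjection k := isStarProjection_rankOne_self (hx.1 k)
  mul_eq_zero j k hjk := by
    ext v
    simp [hx.2 hjk]

/-! ### Compact operators -/

theorem opNorm_le_of_forall_unit {T : H →L[ℂ] H} {C : ℝ} (hC : 0 ≤ C)
    (h : ∀ x, ‖x‖ ≤ 1 → ‖T x‖ ≤ C) : ‖T‖ ≤ C := by
  refine T.opNorm_le_of_unit_norm hC fun x hx => h x hx.le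

/-- The set `t` is a finite ε-net of a compact set containing the image of the unit ball: one ε pays
for `E` on the net, the other for the distance to the net. -/
theorem IsCompactOperator.exists_finset {κ : H →L[ℂ] H} (hκ : IsCompactOperator κ) {ε : ℝ}
    (hε : 0 < ε) : ∃ t : Finset H, ∀ E : H →L[ℂ] H, ‖E‖ ≤ 1 → (∀ y ∈ t, ‖E y‖ ≤ ε) →
      ‖E * κ‖ ≤ 2 * ε := by
  obtain ⟨K, hK, hsub⟩ := hκ.image_closedBall_subset_compact (𝕜₁ := ℂ) (f := (κ : H →ₗ[ℂ] H)) 1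
  obtain ⟨t, ht, hcov⟩ := Metric.totallyBounded_iff.1 hK.totallyBounded ε hε
  refine ⟨ht.toFinset, fun E hE hEt => opNorm_le_of_forall_unit (by positivity) fun x hx => ?_⟩
  have hx' : κ x ∈ K := hsub ⟨x, by simpa using hx, rfl⟩
  obtain ⟨y, hy, hxy⟩ := Set.mem_iUnion₂.1 (hcov hx')
  have h1 : E (κ x) = E y + E (κ x - y) := by simp
  rw [mul_apply_eq_comp, h1]
  have h2 : ‖E (κ x - y)‖ ≤ 1 * ‖κ x - y‖ := E.le_of_opNorm_le hE _
  rw [Metric.mem_ball, dist_eq_norm] at hxy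
  linarith [norm_add_le (E y) (E (κ x - y)), hEt y (ht.mem_toFinset.2 hy)]

theorem OrthoProjs.tendsto_mul_compact {E : ℕ → H →L[ℂ] H} (hE : OrthoProjs E) {κ : H →L[ℂ] H}
    (hκ : IsCompactOperator κ) {ε : ℝ} (hε : 0 < ε) : ∀ᶠ k in atTop, ‖E k * κ‖ ≤ ε := by
  obtain ⟨t, ht⟩ := hκ.exists_finset (half_pos hε)
  have : ∀ᶠ k in atTop, ∀ y ∈ t, ‖E k y‖ ≤ ε / 2 := by
    rw [Filter.eventually_all_finset]
    intro y _
    have := (tendsto_zero_iff_norm_tendsto_zero.1 (hE.tendsto_zero y))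
    exact this.eventually_le_const (half_pos hε)
  filter_upwards [this] with k hk
  have := ht (E k) (hE.isStarProjection k).opNorm_le_one hk
  linarith

theorem IsCompactOperator.exists_finDim {κ : H →L[ℂ] H} (hκ : IsCompactOperator κ) {ε : ℝ}
    (hε : 0 < ε) : ∃ V : Submodule ℂ H, FiniteDimensional ℂ V ∧ ‖(1 - nproj V) * κ‖ ≤ ε := by
  obtain ⟨t, ht⟩ := hκ.exists_finset (half_pos hε)
  refine ⟨Submodule.span ℂ t, inferInstance, ?_⟩
  have := ht (1 - nproj (Submodule.span ℂ (t : Set H)))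
    (by rw [← nproj_orthogonal]; exact norm_nproj_le _) fun y hy => by
      simp [nproj_of_mem (Submodule.subset_span (s := (t : Set H)) hy), (half_pos hε).le]
  linarith

end OperatorTools

/-! ### Gliding humps at gaps and at right limits -/

section Gliding

set_option linter.unusedSectionVars false

variable {H : Type*} [NormedAddCommGroup H] [InnerProductSpace ℂ H] [CompleteSpace H]

theorem isStarProjection_nproj_sub {M M' : Submodule ℂ H} (h : M ≤ M') :
    IsStarProjection (nproj M' - nproj M) where
  isIdempotentElem := by
    rw [IsIdempotentElem, sub_mul, mul_sub, mul_sub, nproj_mul_self, nproj_mul_self,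
      nproj_mul_of_le h, nproj_mul_of_ge h, sub_self, sub_zero]
  isSelfAdjoint := (isStarProjection_nproj M').isSelfAdjoint.sub (isStarProjection_nproj M).isSelfAdjoint

theorem nproj_sub_mul_nproj_sub {M M' Q Q' : Submodule ℂ H} (h : M ≤ M') (h' : M' ≤ Q)
    (h'' : Q ≤ Q') : (nproj M' - nproj M) * (nproj Q' - nproj Q) = 0 ∧
      (nproj Q' - nproj Q) * (nproj M' - nproj M) = 0 := by
  constructor
  · rw [sub_mul, mul_sub, mul_sub, nproj_mul_of_le (h'.trans h''), nproj_mul_of_le h',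
      nproj_mul_of_le (h.trans (h'.trans h'')), nproj_mul_of_le (h.trans h')]
    abel
  · rw [sub_mul, mul_sub, mul_sub, nproj_mul_of_ge (h'.trans h''), nproj_mul_of_ge h',
      nproj_mul_of_ge (h.trans (h'.trans h'')), nproj_mul_of_ge (h.trans h')]
    abel

theorem orthonormal_of_lt {x : ℕ → H} (h1 : ∀ k, ‖x k‖ = 1)
    (h : ∀ j k, j < k → inner ℂ (x j) (x k) = 0) : Orthonormal ℂ x := by
  refine ⟨h1, fun j k hjk => ?_⟩
  rcases lt_or_gt_of_ne hjk with hlt | hlt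
  · exact h j k hlt
  · exact inner_eq_zero_symm.1 (h k j hlt)

theorem orthoProjs_of_lt {E : ℕ → H →L[ℂ] H} (h1 : ∀ k, IsStarProjection (E k))
    (h : ∀ j k, j < k → E j * E k = 0 ∧ E k * E j = 0) : OrthoProjs E := by
  refine ⟨h1, fun j k hjk => ?_⟩
  rcases lt_or_gt_of_ne hjk with hlt | hlt
  · exact (h j k hlt).1
  · exact (h k j hlt).2

theorem exists_unit_of_lt {M M' : Submodule ℂ H} (hM : IsClosed (M : Set H)) (h : M < M') :
    ∃ x, x ∈ M' ∧ x ∈ Mᗮ ∧ ‖x‖ = 1 := by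
  obtain ⟨v, hv, hvM⟩ := SetLike.exists_of_lt h
  have h1 : v - nproj M v ∈ M' := M'.sub_mem hv (h.le (nproj_mem hM v))
  have h2 : v - nproj M v ≠ 0 := fun h0 => hvM <| by
    rw [sub_eq_zero.1 h0]; exact nproj_mem hM v
  refine ⟨((‖v - nproj M v‖ : ℂ)⁻¹) • (v - nproj M v), M'.smul_mem _ h1,
    Submodule.smul_mem _ _ (sub_nproj_mem M v), ?_⟩
  exact norm_smul_inv_norm h2

/-- A sequence of uniformly bounded homomorphisms on `B` converging pointwise to the identity. -/
structure ApproxIdentity (B : Subalgebra ℂ (H →L[ℂ] H)) (γ : ℕ → (H →L[ℂ] H) → (H →L[ℂ] H))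
    (C : ℝ) : Prop where
  nonneg : 0 ≤ C
  map_mul : ∀ n, ∀ A ∈ B, ∀ A' ∈ B, γ n (A * A') = γ n A * γ n A'
  map_add : ∀ n, ∀ A ∈ B, ∀ A' ∈ B, γ n (A + A') = γ n A + γ n A'
  map_smul : ∀ n, ∀ (c : ℂ), ∀ A ∈ B, γ n (c • A) = c • γ n A
  bound : ∀ n, ∀ A ∈ B, ‖γ n A‖ ≤ C * ‖A‖
  tendsto : ∀ A ∈ B, Tendsto (fun n => γ n A) atTop (𝓝 A)

theorem ApproxIdentity.eventually {B : Subalgebra ℂ (H →L[ℂ] H)}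
    {γ : ℕ → (H →L[ℂ] H) → (H →L[ℂ] H)} {C : ℝ} (hγ : ApproxIdentity B γ C) {A : H →L[ℂ] H}
    (hA : A ∈ B) {ε : ℝ} (hε : 0 < ε) : ∀ᶠ n in atTop, ‖γ n A - A‖ ≤ ε :=
  (tendsto_iff_norm_sub_tendsto_zero.1 (hγ.tendsto A hA)).eventually_le_const hε

/-- Bounded operators `T n`, converging to the identity pointwise on `L`, that intertwine the
operators of the nest algebra with their images under `γ n`. -/
structure Implements (N : Set (Submodule ℂ H)) (γ : ℕ → (H →L[ℂ] H) → (H →L[ℂ] H))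
    (L : Submodule ℂ H) (T : ℕ → H →L[ℂ] H) (C : ℝ) : Prop where
  norm_le : ∀ n, ‖T n‖ ≤ C
  map : ∀ n, ∀ A ∈ nestAlgebra N, ∀ x ∈ L, T n (A x) = γ n A (T n x)
  tendsto : ∀ x ∈ L, Tendsto (fun n => T n x) atTop (𝓝 x)

namespace Implements

variable {N : Set (Submodule ℂ H)} {B : Subalgebra ℂ (H →L[ℂ] H)}
  {γ : ℕ → (H →L[ℂ] H) → (H →L[ℂ] H)} {L : Submodule ℂ H} {T : ℕ → H →L[ℂ] H} {C : ℝ}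

theorem eventually (hT : Implements N γ L T C) {x : H} (hx : x ∈ L) {ε : ℝ} (hε : 0 < ε) :
    ∀ᶠ n in atTop, ‖T n x - x‖ ≤ ε :=
  (tendsto_iff_norm_sub_tendsto_zero.1 (hT.tendsto x hx)).eventually_le_const hε

/-- On a finite-dimensional subspace pointwise convergence is uniform. Removing from a bad vector
its component in the span of finitely many directions therefore costs at most half of the constant,
once `n` is large. -/
theorem frequently_orthogonal (hT : Implements N γ L T C) {W : Submodule ℂ H}
    (hW : IsClosed (W : Set H)) (hWL : W ≤ L) {c : ℝ} (hc : 0 < c)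
    (hbad : ∃ᶠ n in atTop, ∃ x ∈ W, c * ‖x‖ < ‖T n x - x‖) (s : Finset H) :
    ∃ᶠ n in atTop, ∃ x ∈ W, ‖x‖ = 1 ∧ (∀ y ∈ s, inner ℂ y x = 0) ∧ c / 2 < ‖T n x - x‖ := by
  classical
  -- Projecting `s` into `W` first keeps the corrected vector inside `W`; a vector of `W` orthogonal
  -- to the projection of `y` is orthogonal to `y`.
  set V : Submodule ℂ H := Submodule.span ℂ (s.image (nproj W) : Finset H) with hV
  have hVW : V ≤ W := by
    rw [hV, Submodule.span_le]
    intro v hv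
    simp only [Finset.coe_image, Set.mem_image] at hv
    obtain ⟨y, -, rfl⟩ := hv
    exact nproj_mem hW y
  have hVc : IsClosed (V : Set H) := Submodule.closed_of_finiteDimensional V
  let b := stdOrthonormalBasis ℂ V
  have hproj : ∀ x, nproj V x = ∑ i, inner ℂ (b i : H) x • (b i : H) := by
    intro x
    have h1 : nproj V x = V.starProjection x := by
      refine Submodule.eq_starProjection_of_mem_orthogonal (nproj_mem hVc x) (sub_nproj_mem V x)
        |>.symm
    rw [h1, b.starProjection_eq_sum_rankOne]
    simp
  have hsmall : ∀ᶠ n in atTop, ∑ i, ‖T n (b i : H) - (b i : H)‖ ≤ c / 2 := by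
    have : Tendsto (fun n => ∑ i, ‖T n (b i : H) - (b i : H)‖) atTop (𝓝 (∑ _i, 0)) :=
      tendsto_finsetSum _ fun i _ =>
        tendsto_iff_norm_sub_tendsto_zero.1 (hT.tendsto _ (hWL (hVW (b i).2)))
    rw [Finset.sum_const_zero] at this
    exact this.eventually_le_const (half_pos hc)
  refine (hbad.and_eventually hsmall).mono ?_
  rintro n ⟨⟨x, hx, hlt⟩, hn⟩
  set x' := x - nproj V x with hx'
  have hVx : ‖T n (nproj V x) - nproj V x‖ ≤ c / 2 * ‖x‖ := by
    have h1 : T n (nproj V x) - nproj V x =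
        ∑ i, inner ℂ (b i : H) x • (T n (b i : H) - (b i : H)) := by
      rw [hproj, map_sum, ← Finset.sum_sub_distrib]
      exact Finset.sum_congr rfl fun i _ => by rw [map_smul, smul_sub]
    rw [h1]
    refine (norm_sum_le _ _).trans ?_
    refine le_trans (Finset.sum_le_sum fun i _ => ?_)
      ((Finset.sum_mul _ _ _).symm.le.trans (mul_le_mul_of_nonneg_right hn (norm_nonneg x)))
    rw [norm_smul, mul_comm]
    refine mul_le_mul_of_nonneg_left ?_ (norm_nonneg _)
    have hb : ‖(b i : H)‖ = 1 := b.orthonormal.1 i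
    simpa [hb] using norm_inner_le_norm (𝕜 := ℂ) (b i : H) x
  have hx'n : ‖x'‖ ≤ ‖x‖ := by
    rw [hx', show x - nproj V x = nproj Vᗮ x by rw [nproj_orthogonal]; simp]
    exact norm_nproj_apply_le _ _
  have hlt' : c / 2 * ‖x'‖ < ‖T n x' - x'‖ := by
    have h1 : T n x - x = (T n x' - x') + (T n (nproj V x) - nproj V x) := by
      rw [hx', map_sub]; abel
    have h2 := norm_add_le (T n x' - x') (T n (nproj V x) - nproj V x)
    rw [← h1] at h2
    nlinarith [norm_nonneg x]
  have hx'0 : x' ≠ 0 := by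
    intro h0
    simp [h0] at hlt'
  have hpos : 0 < ‖x'‖ := norm_pos_iff.2 hx'0
  refine ⟨((‖x'‖ : ℂ)⁻¹) • x', W.smul_mem _ (W.sub_mem hx (hVW (nproj_mem hVc x))),
    norm_smul_inv_norm hx'0, fun y hy => ?_, ?_⟩
  · have h1 : x' = nproj W x' := (nproj_of_mem (W.sub_mem hx (hVW (nproj_mem hVc x)))).symm
    rw [inner_smul_right, h1, ← nproj_inner]
    rw [Submodule.inner_right_of_mem_orthogonal (K := V) (Submodule.subset_span ?_)
      (sub_nproj_mem V x), mul_zero]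
    exact Finset.mem_coe.2 (Finset.mem_image_of_mem _ hy)
  · rw [map_smul, ← smul_sub, norm_smul, norm_inv, Complex.norm_real, norm_norm,
      ← div_eq_inv_mul, lt_div_iff₀ hpos]
    exact hlt'

/-- The gliding hump. Choose increasing k_j and n_j and orthonormal bad vectors x_j ∈ W_{k_j}, and
let A be the sum of the x_j ⊗ f_{k_j}, so that A f_{k_j} = x_j. With n = n_j, x = x_j and f =
f_{k_j}, T_n x − x = (γ_n(A) − A) T_n f + A(T_n f − f). Both terms are at most c/8 for suitable j,
although the left side exceeds c/2. -/
theorem not_frequently_orthonormal (hN : IsNest N) (hB : nestAlgebra N ≤ B)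
    (hγ : ApproxIdentity B γ C) (hT : Implements N γ L T C) {f : ℕ → H} (hf : Orthonormal ℂ f)
    (hfL : ∀ k, f k ∈ L) {W : ℕ → Submodule ℂ H} (hW : ∀ k, IsClosed (W k : Set H))
    (hWL : ∀ k, W k ≤ L) (hWf : ∀ k, ∀ x ∈ W k, rankOne ℂ x (f k) ∈ nestAlgebra N) {c : ℝ}
    (hc : 0 < c) (hbad : ∀ k, ∃ᶠ n in atTop, ∃ x ∈ W k, c * ‖x‖ < ‖T n x - x‖) : False := by
  classical
  obtain ⟨a, ha, har⟩ := exists_seq_of_forall_finset_exists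
    (fun a : ℕ × ℕ × H => a.2.2 ∈ W a.1 ∧ ‖a.2.2‖ = 1 ∧
      ‖T a.2.1 (f a.1) - f a.1‖ ≤ c / 8 ∧ c / 2 < ‖T a.2.1 a.2.2 - a.2.2‖)
    (fun a b => a.1 < b.1 ∧ a.2.1 < b.2.1 ∧ inner ℂ a.2.2 b.2.2 = 0) (by
      intro s _
      obtain ⟨k, hk⟩ : ∃ k, ∀ a ∈ s, a.1 < k := by
        refine ⟨s.sup (fun a => a.1) + 1, fun a ha => Nat.lt_succ_of_le ?_⟩
        exact Finset.le_sup (f := fun a : ℕ × ℕ × H => a.1) ha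
      obtain ⟨m, hm⟩ : ∃ m, ∀ a ∈ s, a.2.1 < m := by
        refine ⟨s.sup (fun a => a.2.1) + 1, fun a ha => Nat.lt_succ_of_le ?_⟩
        exact Finset.le_sup (f := fun a : ℕ × ℕ × H => a.2.1) ha
      obtain ⟨n, ⟨⟨x, hx, hx1, hxs, hxc⟩, hn⟩, hmn⟩ :=
        (((hT.frequently_orthogonal (hW k) (hWL k) hc (hbad k)
          (s.image fun a => a.2.2)).and_eventually
            (hT.eventually (hfL k) (show 0 < c / 8 by linarith))).and_eventually
              (eventually_ge_atTop m)).exists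
      exact ⟨(k, n, x), ⟨hx, hx1, hn, hxc⟩, fun a ha =>
        ⟨hk a ha, (hm a ha).trans_le hmn, hxs _ (Finset.mem_image_of_mem _ ha)⟩⟩)
  have hx : Orthonormal ℂ fun k => (a k).2.2 :=
    orthonormal_of_lt (fun k => (ha k).2.1) fun j k hjk => (har j k hjk).2.2
  have hinj : Function.Injective fun k => (a k).1 :=
    (strictMono_nat_of_lt_succ fun k => (har k _ k.lt_succ_self).1).injective
  have hmono : StrictMono fun k => (a k).2.1 :=
    strictMono_nat_of_lt_succ fun k => (har k _ k.lt_succ_self).2.1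
  have hf' : Orthonormal ℂ fun k => f (a k).1 := hf.comp _ hinj
  obtain ⟨A, hA1, -, hAF, hAN⟩ := (orthoProjs_rankOne hx).exists_sum (orthoProjs_rankOne hf')
    (G := fun k => rankOne ℂ (a k).2.2 (f (a k).1))
    (fun k => by ext v; simp [hx.1 k]) (fun k => by ext v; simp [hf'.1 k])
    (fun k => by simp [hx.1 k, hf'.1 k])
  have hAN := hAN N hN fun k => hWf _ _ (ha k).1
  have hAf : ∀ k, A (f (a k).1) = (a k).2.2 := by
    intro k
    have h1 := congrArg (fun S : H →L[ℂ] H => S (f (a k).1)) (hAF k)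
    have h2 : ‖f (a k).1‖ = 1 := hf'.1 k
    simpa [h2] using h1
  have hCpos : 0 < c / (8 * (C + 1)) := by have := hγ.nonneg; positivity
  obtain ⟨k, hk⟩ := (hmono.tendsto_atTop.eventually (hγ.eventually (hB hAN) hCpos)).exists
  set n := (a k).2.1
  set x := (a k).2.2
  set g := f (a k).1 with hg
  have hg1 : ‖g‖ = 1 := hf'.1 k
  have h1 : T n x - x = (γ n A - A) (T n g) + A (T n g - g) := by
    rw [sub_apply, map_sub, hAf, ← hT.map n A hAN g (hfL _), hAf]; abel
  have h2 : ‖(γ n A - A) (T n g)‖ ≤ c / 8 := by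
    refine ((γ n A - A).le_of_opNorm_le hk _).trans ?_
    have h3 := (T n).le_of_opNorm_le (hT.norm_le n) g
    rw [hg1, mul_one] at h3
    rw [div_mul_eq_mul_div, div_le_div_iff₀ (by linarith [hγ.nonneg]) (by norm_num)]
    nlinarith [hγ.nonneg]
  have h3 : ‖A (T n g - g)‖ ≤ c / 8 := by
    refine (A.le_of_opNorm_le hA1 _).trans ?_
    rw [one_mul]
    exact (ha k).2.2.1
  have h4 := norm_add_le ((γ n A - A) (T n g)) (A (T n g - g))
  rw [← h1] at h4
  linarith [(ha k).2.2.2]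

/-- No member lies strictly between `P` and `R`, so x ⊗ f belongs to the nest algebra for all x, f
in the gap R ⊖ P. A failure supplies bad vectors orthogonal to any finite set, and an orthonormal
sequence of such vectors also serves as the sources f. -/
theorem eventually_jump (hN : IsNest N) (hB : nestAlgebra N ≤ B)
    (hγ : ApproxIdentity B γ C) (hT : Implements N γ L T C) {P R : Submodule ℂ H} (hR : R ∈ N)
    (hRL : R ≤ L) (hPR : ∀ Q ∈ N, Q ≤ P ∨ R ≤ Q) {c : ℝ} (hc : 0 < c) :
    ∀ᶠ n in atTop, ∀ x ∈ R, x ∈ Pᗮ → ‖T n x - x‖ ≤ c * ‖x‖ := by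
  by_contra hne
  have hW : IsClosed ((R ⊓ Pᗮ : Submodule ℂ H) : Set H) :=
    (hN.isClosed R hR).inter P.isClosed_orthogonal
  have hWL : R ⊓ Pᗮ ≤ L := inf_le_left.trans hRL
  have hbad : ∃ᶠ n in atTop, ∃ x ∈ R ⊓ Pᗮ, c * ‖x‖ < ‖T n x - x‖ := by
    refine (Filter.not_eventually.1 hne).mono fun n hn => ?_
    push Not at hn
    obtain ⟨x, hx, hx', hlt⟩ := hn
    exact ⟨x, ⟨hx, hx'⟩, hlt⟩
  obtain ⟨f, hf, hfr⟩ := exists_seq_of_forall_finset_exists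
    (fun x : H => x ∈ R ⊓ Pᗮ ∧ ‖x‖ = 1) (fun x y => inner ℂ x y = 0) (by
      intro s _
      obtain ⟨n, x, hx, hx1, hxs, -⟩ := (hT.frequently_orthogonal hW hWL hc hbad s).exists
      exact ⟨x, ⟨hx, hx1⟩, hxs⟩)
  refine not_frequently_orthonormal hN hB hγ hT (orthonormal_of_lt (fun k => (hf k).2) hfr)
    (fun k => hWL (hf k).1) (W := fun _ => R ⊓ Pᗮ) (fun _ => hW) (fun _ => hWL) (fun k x hx => ?_)
    hc fun _ => hbad
  refine rankOne_mem_nestAlgebra fun Q hQ => ?_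
  rcases hPR Q hQ with h | h
  · exact Or.inr (Submodule.orthogonal_le h (hf k).1.2)
  · exact Or.inl (h hx.1)

/-- If every interval to the right of `P` were bad, one could descend towards `P` through members
R_k, choosing unit vectors f_k just outside R_k. The bad vectors in R_k ⊖ P lie below f_k in the
nest, so they are admissible targets of rank ones with source f_k. -/
theorem exists_right (hN : IsNest N) (hB : nestAlgebra N ≤ B) (hγ : ApproxIdentity B γ C)
    (hT : Implements N γ L T C) (hL : L ∈ N) {P : Submodule ℂ H} (hPL : P < L)
    (hsucc : nestSucc N P = P) {c : ℝ} (hc : 0 < c) :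
    ∃ R ∈ N, P < R ∧ R ≤ L ∧ ∀ᶠ n in atTop, ∀ x ∈ R, x ∈ Pᗮ → ‖T n x - x‖ ≤ c * ‖x‖ := by
  classical
  by_contra! hne
  obtain ⟨a, ha, har⟩ := exists_seq_of_forall_finset_exists
    (fun a : Submodule ℂ H × Submodule ℂ H × H => (a.2.1 ∈ N ∧ P < a.2.1 ∧ a.2.1 ≤ L) ∧
      a.1 ≤ L ∧ a.2.2 ∈ a.1 ∧ a.2.2 ∈ a.2.1ᗮ ∧ ‖a.2.2‖ = 1)
    (fun a b => b.1 ≤ a.2.1) (by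
      intro s hs
      obtain ⟨R, ⟨hR, hPR, hRL⟩, hRs⟩ : ∃ R, (R ∈ N ∧ P < R ∧ R ≤ L) ∧ ∀ a ∈ s, R ≤ a.2.1 := by
        induction s using Finset.induction_on with
        | empty => exact ⟨L, ⟨hL, hPL, le_rfl⟩, by simp⟩
        | insert b s _ ih =>
          obtain ⟨R, hR, hRs⟩ := ih fun x hx => hs x (Finset.mem_insert_of_mem hx)
          have hb := (hs b (Finset.mem_insert_self b s)).1
          rcases hN.le_total hR.1 hb.1 with h | h
          · exact ⟨R, hR, fun x hx => (Finset.mem_insert.1 hx).elim (fun h' => h' ▸ h) (hRs x)⟩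
          · exact ⟨b.2.1, hb, fun x hx =>
              (Finset.mem_insert.1 hx).elim (fun h' => h' ▸ le_rfl) fun h' => h.trans (hRs x h')⟩
      obtain ⟨R', hR', hPR', hlt⟩ : ∃ R' ∈ N, P < R' ∧ R' < R := by
        by_contra! hno
        refine hPR.not_ge (hsucc ▸ le_sInf fun Q hQ => ?_)
        by_contra hnle
        exact hno Q hQ.1 hQ.2 (hN.lt_of_not_le hR hQ.1 hnle)
      obtain ⟨f, hf, hf', hf1⟩ := exists_unit_of_lt (hN.isClosed R' hR') hlt
      exact ⟨(R, R', f), ⟨⟨hR', hPR', hlt.le.trans hRL⟩, hRL, hf, hf', hf1⟩, hRs⟩)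
  have hf : Orthonormal ℂ fun k => (a k).2.2 :=
    orthonormal_of_lt (fun k => (ha k).2.2.2.2) fun j k hjk =>
      Submodule.inner_left_of_mem_orthogonal (har j k hjk (ha k).2.2.1) (ha j).2.2.2.1
  refine not_frequently_orthonormal hN hB hγ hT hf (fun k => (ha k).2.1 (ha k).2.2.1)
    (W := fun k => (a k).2.1 ⊓ Pᗮ)
    (fun k => (hN.isClosed _ (ha k).1.1).inter P.isClosed_orthogonal)
    (fun k => inf_le_left.trans (ha k).1.2.2)
    (fun k x hx => rankOne_mem_nestAlgebra_of_mem hN (ha k).1.1 hx.1 (ha k).2.2.2.1) hc fun k => ?_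
  refine (hne _ (ha k).1.1 (ha k).1.2.1 (ha k).1.2.2).mono fun n hn => ?_
  obtain ⟨x, hx, hx', hlt⟩ := hn
  exact ⟨x, ⟨hx, hx'⟩, hlt⟩

end Implements

end Gliding

/-! ### Gliding humps at left limits, and uniformity over the nest -/

section GlidingLeft

set_option linter.unusedSectionVars false

variable {H : Type*} [NormedAddCommGroup H] [InnerProductSpace ℂ H] [CompleteSpace H]

namespace Implements

variable {N : Set (Submodule ℂ H)} {B : Subalgebra ℂ (H →L[ℂ] H)}
  {γ : ℕ → (H →L[ℂ] H) → (H →L[ℂ] H)} {L : Submodule ℂ H} {T : ℕ → H →L[ℂ] H} {C : ℝ}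

/-- One step of the gliding hump to the left of `P`. -/
structure LeftHump (N : Set (Submodule ℂ H)) (T : ℕ → H →L[ℂ] H) (P : Submodule ℂ H) (c : ℝ) where
  idx : ℕ
  Q₀ : Submodule ℂ H
  Q₁ : Submodule ℂ H
  Q₂ : Submodule ℂ H
  x : H
  y : H
  z : H
  mem₁ : Q₁ ∈ N
  mem₂ : Q₂ ∈ N
  le₀₁ : Q₀ ≤ Q₁
  le₁₂ : Q₁ ≤ Q₂
  lt : Q₂ < P
  y_mem : y ∈ Q₁
  y_orth : y ∈ Q₀ᗮ
  y_norm : ‖y‖ = 1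
  z_mem : z ∈ Q₂
  z_orth : z ∈ Q₁ᗮ
  z_norm : ‖z‖ = 1
  x_mem : x ∈ Q₂
  x_orth : x ∈ Q₁ᗮ
  x_norm : ‖x‖ ≤ 1
  y_small : ‖T idx y - y‖ ≤ c / 8
  x_large : c / 2 ≤ ‖inner ℂ z (T idx x - x)‖

/-- A bad vector u ⊥ Q₁ in `P` has an error w = T_n u − u that also lies nearly in P ⊖ Q₁, since Eu
= u gives w − Ew = (γ_n(E) − E)T_n u. By strong continuity at the left limit both u and w can be cut
off at some Q₂ < P. The vector y below Q₁ is chosen before the index, so that T_n y is already close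
to y. -/
theorem exists_leftHump (hN : IsNest N) (hB : nestAlgebra N ≤ B) (hγ : ApproxIdentity B γ C)
    (hT : Implements N γ L T C) {P : Submodule ℂ H} (hP : P ∈ N) (hP0 : P ≠ ⊥) (hPL : P ≤ L)
    (hpred : nestPred N P = P) {c : ℝ} (hc : 0 < c)
    (hbad : ∀ Q ∈ N, Q < P → ∃ᶠ n in atTop, ∃ x ∈ P, x ∈ Qᗮ ∧ c * ‖x‖ < ‖T n x - x‖)
    {Q₀ : Submodule ℂ H} (hQ₀ : Q₀ ∈ N) (hQ₀P : Q₀ < P) (m : ℕ) :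
    ∃ a : LeftHump N T P c, m < a.idx ∧ a.Q₀ = Q₀ := by
  have hC := hγ.nonneg
  obtain ⟨Q₁, hQ₁, hQ₀₁, hQ₁P⟩ : ∃ Q₁ ∈ N, Q₀ < Q₁ ∧ Q₁ < P := by
    by_contra! hno
    refine hQ₀P.not_ge (hpred ▸ Submodule.topologicalClosure_minimal _ (sSup_le fun Q hQ => ?_)
      (hN.isClosed _ hQ₀))
    by_contra hnle
    exact hno Q hQ.1 (hN.lt_of_not_le hQ.1 hQ₀ hnle) hQ.2
  obtain ⟨y, hy, hy', hy1⟩ := exists_unit_of_lt (hN.isClosed Q₀ hQ₀) hQ₀₁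
  set E := nproj P - nproj Q₁ with hE
  have hEN : E ∈ nestAlgebra N :=
    sub_mem (nproj_mem_nestAlgebra hN hP) (nproj_mem_nestAlgebra hN hQ₁)
  obtain ⟨n, ⟨⟨⟨x, hx, hx', hlt⟩, hny⟩, hnE⟩, hmn⟩ :=
    ((((hbad Q₁ hQ₁ hQ₁P).and_eventually
      (hT.eventually (hPL (hQ₁P.le hy)) (show 0 < c / 8 by linarith))).and_eventually
      (hγ.eventually (hB hEN) (show 0 < c / (8 * (C + 1)) by positivity))).and_eventually
      (eventually_gt_atTop m)).exists
  have hx0 : x ≠ 0 := by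
    rintro rfl
    simp at hlt
  -- normalise `x`
  set u := ((‖x‖ : ℂ)⁻¹) • x with hu
  have hu1 : ‖u‖ = 1 := norm_smul_inv_norm hx0
  have huP : u ∈ P := P.smul_mem _ hx
  have huQ : u ∈ Q₁ᗮ := Submodule.smul_mem _ _ hx'
  set w := T n u - u with hw
  have hwc : c < ‖w‖ := by
    rw [hw, hu, map_smul, ← smul_sub, norm_smul, norm_inv, Complex.norm_real, norm_norm,
      ← div_eq_inv_mul, lt_div_iff₀ (norm_pos_iff.2 hx0)]
    exact hlt
  have hEu : E u = u := nproj_sub_apply_of_mem huP huQ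
  have hEw : ‖w - E w‖ ≤ c / 8 := by
    have h1 : w - E w = (γ n E - E) (T n u) := by
      rw [sub_apply (γ n E), ← hT.map n E hEN u (hPL huP), hEu, hw, map_sub E, hEu]; abel
    rw [h1]
    refine ((γ n E - E).le_of_opNorm_le hnE _).trans ?_
    have h3 := (T n).le_of_opNorm_le (hT.norm_le n) u
    rw [hu1, mul_one] at h3
    rw [div_mul_eq_mul_div, div_le_div_iff₀ (by linarith) (by norm_num)]
    nlinarith
  -- Cutting off costs ε for w and (C + 1)ε for u; this choice makes the sum c/8. With the c/8 from
  -- `hEw`, at least c/2 of the error survives.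
  have hε : 0 < c / (8 * (C + 2)) := by positivity
  obtain ⟨R, hR, hRu⟩ := hN.exists_norm_sub_lt_left hP hP0 hpred u hε
  obtain ⟨R', hR', hRw⟩ := hN.exists_norm_sub_lt_left hP hP0 hpred w hε
  obtain ⟨R'', hR'', h1, h2⟩ := hN.exists_ge_ge hR hR'
  obtain ⟨Q₂, hQ₂, h3, hQ₁₂⟩ := hN.exists_ge_ge hR'' ⟨hQ₁, hQ₁P⟩
  have hRu := hRu Q₂ hQ₂.1 (h1.trans h3) hQ₂.2.le
  have hRw := hRw Q₂ hQ₂.1 (h2.trans h3) hQ₂.2.le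
  set F := nproj Q₂ - nproj Q₁ with hF
  set G := nproj P - nproj Q₂ with hG
  have hFG : ∀ v, F v = E v - G v := fun v => by simp [hF, hE, hG]
  have hFp : IsStarProjection F := isStarProjection_nproj_sub hQ₁₂
  have hFF : ∀ v, F (F v) = F v := fun v =>
    congrArg (fun S : H →L[ℂ] H => S v) hFp.isIdempotentElem.eq
  have hFmem : ∀ v, F v ∈ Q₂ ∧ F v ∈ Q₁ᗮ := by
    intro v
    refine ⟨Q₂.sub_mem (nproj_mem (hN.isClosed _ hQ₂.1) v)
      (hQ₁₂ (nproj_mem (hN.isClosed _ hQ₁) v)), ?_⟩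
    have h4 : F v = nproj Q₂ v - nproj Q₁ (nproj Q₂ v) := by
      rw [← mul_apply_eq_comp, nproj_mul_of_le hQ₁₂]; rfl
    rw [h4]
    exact sub_nproj_mem _ _
  set x' := F u with hx'def
  have hxu : x' = u - G u := by rw [hx'def, hFG, hEu]
  have hGu' : ‖T n (G u) - G u‖ ≤ (C + 1) * (c / (8 * (C + 2))) := by
    have h4 := (T n).le_of_opNorm_le (hT.norm_le n) (G u)
    have h5 := norm_sub_le (T n (G u)) (G u)
    nlinarith
  have hFw : ‖w - F (T n x' - x')‖ ≤ c / 8 + c / 8 := by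
    have h4 : w - F (T n x' - x') = (w - E w) + (G w + F (T n (G u) - G u)) := by
      have : T n x' - x' = w - (T n (G u) - G u) := by rw [hxu, map_sub, hw]; abel
      rw [this, map_sub, hFG w]; abel
    rw [h4]
    refine (norm_add_le _ _).trans (add_le_add hEw ((norm_add_le _ _).trans ?_))
    have h5 := (hFp.norm_apply_le (T n (G u) - G u)).trans hGu'
    have h6 : c / (8 * (C + 2)) + (C + 1) * (c / (8 * (C + 2))) = c / 8 := by
      field_simp; ring
    linarith
  set q := F (T n x' - x') with hq
  have hqc : c / 2 ≤ ‖q‖ := by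
    have := norm_sub_norm_le w (w - q)
    rw [sub_sub_cancel] at this
    linarith
  have hq0 : q ≠ 0 := fun h0 => by rw [h0, norm_zero] at hqc; linarith
  have hqF : F q = q := hFF _
  refine ⟨{ idx := n, Q₀ := Q₀, Q₁ := Q₁, Q₂ := Q₂, x := x', y := y, z := ((‖q‖ : ℂ)⁻¹) • q,
            mem₁ := hQ₁, mem₂ := hQ₂.1, le₀₁ := hQ₀₁.le, le₁₂ := hQ₁₂, lt := hQ₂.2,
            y_mem := hy, y_orth := hy', y_norm := hy1,
            z_mem := Submodule.smul_mem _ _ (hFmem _).1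
            z_orth := Submodule.smul_mem _ _ (hFmem _).2
            z_norm := norm_smul_inv_norm hq0
            x_mem := (hFmem u).1, x_orth := (hFmem u).2
            x_norm := (hFp.norm_apply_le u).trans hu1.le
            y_small := hny, x_large := ?_ }, hmn, rfl⟩
  have h7 : inner ℂ q (T n x' - x') = (‖q‖ : ℂ) ^ 2 := by
    rw [← hqF, hFp.inner_apply, ← hq, hqF, inner_self_eq_norm_sq_to_K]; rfl
  rw [inner_smul_left, h7, norm_mul, norm_pow, RCLike.norm_conj, norm_inv, Complex.norm_real,
    norm_norm, sq, inv_mul_cancel_left₀ (norm_ne_zero_iff.2 hq0)]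
  exact hqc

/-- Members of the nest now increase towards `P`, so sources of rank ones below the bad vectors are
not available; the humps are detected by testing instead. Let A be the sum of the y_k ⊗ z_k, where
y_k lies below z_k. In one hump ⟨y, Av⟩ = ⟨z, v⟩ and Ax = ⟨z, x⟩y, whence ⟨z, T_n x − x⟩ = ⟨y, (A −
γ_n(A))T_n x⟩ + ⟨z, x⟩⟨y, T_n y − y⟩. Both terms are at most c/8, against a left side of modulus at
least c/2. -/
theorem exists_left (hN : IsNest N) (hB : nestAlgebra N ≤ B) (hγ : ApproxIdentity B γ C)
    (hT : Implements N γ L T C) {P : Submodule ℂ H} (hP : P ∈ N) (hP0 : P ≠ ⊥) (hPL : P ≤ L)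
    (hpred : nestPred N P = P) {c : ℝ} (hc : 0 < c) :
    ∃ Q ∈ N, Q < P ∧ ∀ᶠ n in atTop, ∀ x ∈ P, x ∈ Qᗮ → ‖T n x - x‖ ≤ c * ‖x‖ := by
  classical
  by_contra! hne
  obtain ⟨a, -, har⟩ := exists_seq_of_forall_finset_exists
    (fun _ : LeftHump N T P c => True) (fun a b => a.idx < b.idx ∧ a.Q₂ ≤ b.Q₀) (by
      intro s _
      obtain ⟨m, hm⟩ : ∃ m, ∀ a ∈ s, a.idx ≤ m :=
        ⟨s.sup (fun a => a.idx), fun a ha => Finset.le_sup (f := fun a : LeftHump N T P c => a.idx) ha⟩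
      obtain ⟨Q, ⟨hQ, hQP⟩, hQs⟩ : ∃ Q, (Q ∈ N ∧ Q < P) ∧ ∀ a ∈ s, a.Q₂ ≤ Q := by
        induction s using Finset.induction_on with
        | empty => exact ⟨⊥, ⟨hN.bot_mem, bot_lt_iff_ne_bot.2 hP0⟩, by simp⟩
        | insert b s _ ih =>
          obtain ⟨Q, hQ, hQs⟩ := ih (fun _ _ => trivial)
            fun a ha => hm a (Finset.mem_insert_of_mem ha)
          obtain ⟨Q', hQ', h1, h2⟩ := hN.exists_ge_ge hQ ⟨b.mem₂, b.lt⟩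
          exact ⟨Q', hQ', fun x hx => (Finset.mem_insert.1 hx).elim (fun h' => h' ▸ h2)
            fun h' => (hQs x h').trans h1⟩
      obtain ⟨b, hb, hbQ⟩ := hT.exists_leftHump hN hB hγ hP hP0 hPL hpred hc hne hQ hQP m
      exact ⟨b, trivial, fun a ha => ⟨(hm a ha).trans_lt hb, hbQ ▸ hQs a ha⟩⟩)
  have hy : Orthonormal ℂ fun k => (a k).y := orthonormal_of_lt (fun k => (a k).y_norm)
    fun j k hjk => Submodule.inner_right_of_mem_orthogonal
      ((((a j).le₁₂).trans (har j k hjk).2) (a j).y_mem) (a k).y_orth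
  have hF : OrthoProjs fun k => nproj (a k).Q₂ - nproj (a k).Q₁ :=
    orthoProjs_of_lt (fun k => isStarProjection_nproj_sub (a k).le₁₂) fun j k hjk =>
      nproj_sub_mul_nproj_sub (a j).le₁₂ ((har j k hjk).2.trans (a k).le₀₁) (a k).le₁₂
  have hFz : ∀ k, (nproj (a k).Q₂ - nproj (a k).Q₁) (a k).z = (a k).z := fun k =>
    nproj_sub_apply_of_mem (a k).z_mem (a k).z_orth
  have hmono : StrictMono fun k => (a k).idx :=
    strictMono_nat_of_lt_succ fun k => (har k _ k.lt_succ_self).1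
  obtain ⟨A, -, hEA, hAF, hAN⟩ := (orthoProjs_rankOne hy).exists_sum hF
    (G := fun k => rankOne ℂ (a k).y (a k).z)
    (fun k => by ext v; simp [(a k).y_norm])
    (fun k => by
      ext v
      rw [mul_apply_eq_comp, rankOne_apply, rankOne_apply, ← (hF.isStarProjection k).inner_apply,
        hFz])
    (fun k => by simp [(a k).y_norm, (a k).z_norm])
  have hAN := hAN N hN fun k => rankOne_mem_nestAlgebra_of_mem hN (a k).mem₁ (a k).y_mem (a k).z_orth
  have hCpos : 0 < c / (8 * (C + 1)) := by have := hγ.nonneg; positivity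
  obtain ⟨k, hk⟩ := (hmono.tendsto_atTop.eventually (hγ.eventually (hB hAN) hCpos)).exists
  have hC := hγ.nonneg
  have hEA := hEA k
  have hAF := hAF k
  generalize a k = b at hk hEA hAF
  have hAx : A b.x = inner ℂ b.z b.x • b.y := by
    have h1 := congrArg (fun S : H →L[ℂ] H => S b.x) hAF
    simpa [nproj_sub_apply_of_mem b.x_mem b.x_orth, nproj_of_mem b.x_mem,
      nproj_of_mem_orthogonal b.x_orth] using h1
  have hAy : ∀ v, inner ℂ b.y (A v) = inner ℂ b.z v := by
    intro v
    have h1 := congrArg (fun S : H →L[ℂ] H => inner ℂ b.y (S v)) hEA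
    simpa [inner_smul_right, b.y_norm] using h1
  have h1 : inner ℂ b.z (T b.idx b.x - b.x) =
      inner ℂ b.y (-((γ b.idx A - A) (T b.idx b.x))) +
        inner ℂ b.z b.x * inner ℂ b.y (T b.idx b.y - b.y) := by
    rw [sub_apply, ← hT.map b.idx A hAN b.x (hPL (b.lt.le b.x_mem)), hAx, map_smul, neg_sub,
      inner_sub_right, inner_sub_right, inner_sub_right, hAy, inner_smul_right,
      inner_self_eq_norm_sq_to_K, b.y_norm]
    simp
    ring
  have h2 : ‖(γ b.idx A - A) (T b.idx b.x)‖ ≤ c / 8 := by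
    refine ((γ b.idx A - A).le_of_opNorm_le hk _).trans ?_
    have h3 := (T b.idx).le_of_opNorm_le (hT.norm_le b.idx) b.x
    have h4 : C * ‖b.x‖ ≤ C := by nlinarith [b.x_norm]
    rw [div_mul_eq_mul_div, div_le_div_iff₀ (by linarith) (by norm_num)]
    nlinarith
  have h3 : ‖inner ℂ b.y (-((γ b.idx A - A) (T b.idx b.x)))‖ ≤ c / 8 := by
    refine (norm_inner_le_norm _ _).trans ?_
    rwa [b.y_norm, one_mul, norm_neg]
  have h4 : ‖inner ℂ b.z b.x * inner ℂ b.y (T b.idx b.y - b.y)‖ ≤ c / 8 := by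
    rw [norm_mul]
    have h5 := norm_inner_le_norm (𝕜 := ℂ) b.z b.x
    have h6 := norm_inner_le_norm (𝕜 := ℂ) b.y (T b.idx b.y - b.y)
    rw [b.z_norm, one_mul] at h5
    rw [b.y_norm, one_mul] at h6
    have := mul_le_mul (h5.trans b.x_norm) (h6.trans b.y_small) (norm_nonneg _) zero_le_one
    linarith
  have h5 := norm_add_le (inner ℂ b.y (-((γ b.idx A - A) (T b.idx b.x))))
    (inner ℂ b.z b.x * inner ℂ b.y (T b.idx b.y - b.y))
  rw [← h1] at h5
  linarith [b.x_large]

/-- Splitting estimate: uniform closeness passes from `Q` and `P ⊖ Q` to `P`. -/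
theorem eventually_split (hN : IsNest N) (hB : nestAlgebra N ≤ B) (hγ : ApproxIdentity B γ C)
    (hT : Implements N γ L T C) {P Q : Submodule ℂ H} (hQ : Q ∈ N) (hQP : Q ≤ P)
    (hPL : P ≤ L) {c c' : ℝ} (hc : 0 ≤ c) (hcc' : c < c')
    (h1 : ∀ᶠ n in atTop, ∀ x ∈ Q, ‖T n x - x‖ ≤ c * ‖x‖)
    (h2 : ∀ᶠ n in atTop, ∀ x ∈ P, x ∈ Qᗮ → ‖T n x - x‖ ≤ c * ‖x‖) :
    ∀ᶠ n in atTop, ∀ x ∈ P, ‖T n x - x‖ ≤ c' * ‖x‖ := by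
  have hC := hγ.nonneg
  have hQN := nproj_mem_nestAlgebra hN hQ
  have hQN' : 1 - nproj Q ∈ nestAlgebra N := sub_mem (one_mem _) hQN
  have hε : 0 < (c' - c) / (2 * (C + 1)) := by
    have : 0 < c' - c := by linarith
    positivity
  filter_upwards [h1, h2, hγ.eventually (hB hQN) hε, hγ.eventually (hB hQN') hε] with n h1 h2 h3 h4
    x hx
  set x₁ := nproj Q x with hx₁
  set x₂ := x - x₁ with hx₂
  have hx₁Q : x₁ ∈ Q := nproj_mem (hN.isClosed Q hQ) x
  have hx₂Q : x₂ ∈ Qᗮ := sub_nproj_mem Q x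
  have hx₂P : x₂ ∈ P := P.sub_mem hx (hQP hx₁Q)
  have hpyth : ‖x‖ ^ 2 = ‖x₁‖ ^ 2 + ‖x₂‖ ^ 2 := norm_sq_eq_nproj Q x
  have hx₁n : ‖x₁‖ ≤ ‖x‖ := norm_nproj_apply_le Q x
  have hx₂n : ‖x₂‖ ≤ ‖x‖ := by nlinarith [norm_nonneg x₁, norm_nonneg x, norm_nonneg x₂]
  have hTb : ∀ v, ‖v‖ ≤ ‖x‖ → ∀ S : H →L[ℂ] H, ‖S‖ ≤ (c' - c) / (2 * (C + 1)) →
      ‖S (T n v)‖ ≤ (c' - c) / 2 * ‖x‖ := by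
    intro v hv S hS
    refine (S.le_of_opNorm_le hS _).trans ?_
    have h5 := (T n).le_of_opNorm_le (hT.norm_le n) v
    have h6 : ‖T n v‖ ≤ (C + 1) * ‖x‖ := by nlinarith [norm_nonneg v]
    calc (c' - c) / (2 * (C + 1)) * ‖T n v‖ ≤ (c' - c) / (2 * (C + 1)) * ((C + 1) * ‖x‖) := by
          gcongr
      _ = (c' - c) / 2 * ‖x‖ := by field_simp
  set d₁ := nproj Q (T n x₁ - x₁) with hd₁
  set d₂ := (1 - nproj Q) (T n x₂ - x₂) with hd₂
  have hQx₁ : nproj Q x₁ = x₁ := nproj_of_mem hx₁Q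
  have hQx₂ : (1 - nproj Q) x₂ = x₂ := by simp [nproj_of_mem_orthogonal hx₂Q]
  -- As `γ n` of a projection fixes `T n` of its range, T_n x₁ − x₁ lies almost in Q and T_n x₂ − x₂
  -- almost in its complement. The main parts d₁ and d₂ are thus orthogonal, so the constant c is
  -- not doubled.
  have he : T n x - x = (d₁ + d₂) + ((γ n (nproj Q) - nproj Q) (T n x₁) +
      (γ n (1 - nproj Q) - (1 - nproj Q)) (T n x₂)) := by
    have h5 : γ n (nproj Q) (T n x₁) = T n x₁ := by
      rw [← hT.map n _ hQN x₁ (hPL (hQP hx₁Q)), hQx₁]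
    have h6 : γ n (1 - nproj Q) (T n x₂) = T n x₂ := by
      rw [← hT.map n _ hQN' x₂ (hPL hx₂P), hQx₂]
    have h7 : T n x - x = (T n x₁ - x₁) + (T n x₂ - x₂) := by rw [hx₂, map_sub]; abel
    rw [h7, sub_apply (γ n (nproj Q)), sub_apply (γ n (1 - nproj Q)), h5, h6, hd₁, hd₂,
      map_sub (nproj Q) (T n x₁) x₁, map_sub (1 - nproj Q) (T n x₂) x₂, hQx₁, hQx₂]
    abel
  have hd : ‖d₁ + d₂‖ ≤ c * ‖x‖ := by
    have h5 : ‖d₁‖ ≤ c * ‖x₁‖ := (norm_nproj_apply_le _ _).trans (h1 x₁ hx₁Q)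
    have h6 : ‖d₂‖ ≤ c * ‖x₂‖ := by
      refine le_trans ?_ (h2 x₂ hx₂P hx₂Q)
      rw [hd₂, ← nproj_orthogonal]
      exact norm_nproj_apply_le _ _
    have h7 : inner ℂ d₁ d₂ = 0 := Submodule.inner_right_of_mem_orthogonal
      (nproj_mem (hN.isClosed Q hQ) _) (sub_nproj_mem Q _)
    have h8 := norm_add_sq_eq_norm_sq_add_norm_sq_of_inner_eq_zero (𝕜 := ℂ) d₁ d₂ h7
    have h9 : ‖d₁ + d₂‖ ^ 2 ≤ (c * ‖x‖) ^ 2 := by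
      rw [mul_pow, hpyth]
      nlinarith [norm_nonneg d₁, norm_nonneg d₂]
    exact le_of_sq_le_sq h9 (by positivity)
  rw [he]
  refine (norm_add_le _ _).trans ?_
  refine (add_le_add hd ((norm_add_le _ _).trans
    (add_le_add (hTb x₁ hx₁n _ h3) (hTb x₂ hx₂n _ h4)))).trans ?_
  apply le_of_eq
  ring

/-- The implementing operators converge to the identity uniformly. -/
theorem tendsto_uniformly (hN : IsNest N) (hB : nestAlgebra N ≤ B) (hγ : ApproxIdentity B γ C)
    (hT : Implements N γ L T C) (hL : L ∈ N) {c : ℝ} (hc : 0 < c) :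
    ∀ᶠ n in atTop, ∀ x ∈ L, ‖T n x - x‖ ≤ c * ‖x‖ := by
  -- Quantifying over all c' > c/2 prevents constants from growing along the induction: each
  -- splitting loses an arbitrarily small amount, to be absorbed between c/2 and c'.
  have key := hN.induction (fun P => ∀ c' > c / 2, ∀ᶠ n in atTop, ∀ x ∈ P, x ∈ L →
    ‖T n x - x‖ ≤ c' * ‖x‖) ?_ ?_ ?_
  · exact (key c (by linarith)).mono fun n hn x hx => hn x trivial hx
  · intro c' _
    refine Eventually.of_forall fun n x hx _ => ?_
    rw [(Submodule.mem_bot ℂ).1 hx]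
    simp
  · intro P hP hg hPt
    by_cases hLP : L ≤ P
    · exact ⟨⊤, hN.top_mem, lt_top_iff_ne_top.2 hPt, fun c' hc' =>
        (hg c' hc').mono fun n hn x _ hx => hn x (hLP hx) hx⟩
    have hPL : P < L := hN.lt_of_not_le hL hP hLP
    obtain ⟨R, hR, hPR, hRL, hRe⟩ : ∃ R ∈ N, P < R ∧ R ≤ L ∧
        ∀ᶠ n in atTop, ∀ x ∈ R, x ∈ Pᗮ → ‖T n x - x‖ ≤ c / 2 * ‖x‖ := by
      by_cases hs : nestSucc N P = P
      · exact hT.exists_right hN hB hγ hL hPL hs (half_pos hc)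
      · have hRL := nestSucc_le hL hPL
        refine ⟨nestSucc N P, hN.succ_mem P, lt_of_le_of_ne (le_nestSucc P) (Ne.symm hs), hRL,
          hT.eventually_jump hN hB hγ (hN.succ_mem P) hRL (fun Q hQ => ?_) (half_pos hc)⟩
        by_cases h : Q ≤ P
        · exact Or.inl h
        · exact Or.inr (nestSucc_le hQ (hN.lt_of_not_le hQ hP h))
    refine ⟨R, hR, hPR, fun c' hc' => ?_⟩
    have h1 := hT.eventually_split hN hB hγ hP hPR.le hRL
      (c := (c / 2 + c') / 2) (c' := c') (by linarith) (by linarith)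
      ((hg _ (by linarith)).mono fun n hn x hx => hn x hx (hPL.le hx))
      (hRe.mono fun n hn x hx hx' => (hn x hx hx').trans
        (mul_le_mul_of_nonneg_right (by linarith) (norm_nonneg x)))
    exact h1.mono fun n hn x hx _ => hn x hx
  · intro P hP hP0 hpred hg c' hc'
    by_cases hPL : P ≤ L
    · obtain ⟨Q, hQ, hQP, hQe⟩ := hT.exists_left hN hB hγ hP hP0 hPL hpred (half_pos hc)
      obtain ⟨Q', hQ', hQQ', hQ'P, hg'⟩ := hg Q hQ hQP
      have h1 := hT.eventually_split hN hB hγ hQ' hQ'P.le hPL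
        (c := (c / 2 + c') / 2) (c' := c') (by linarith) (by linarith)
        ((hg' _ (by linarith)).mono fun n hn x hx => hn x hx (hPL (hQ'P.le hx)))
        (hQe.mono fun n hn x hx hx' => (hn x hx (Submodule.orthogonal_le hQQ' hx')).trans
          (mul_le_mul_of_nonneg_right (by linarith) (norm_nonneg x)))
      exact h1.mono fun n hn x hx _ => hn x hx
    · obtain ⟨Q', hQ', hLQ', -, hg'⟩ := hg L hL (hN.lt_of_not_le hP hL hPL)
      exact (hg' c' hc').mono fun n hn x _ hx => hn x (hLQ' hx) hx

end Implements

end GlidingLeft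

/-! ### Pointwise convergence to the identity is uniform -/

section UniformConvergence

set_option linter.unusedSectionVars false

variable {H : Type*} [NormedAddCommGroup H] [InnerProductSpace ℂ H] [CompleteSpace H]

variable {N : Set (Submodule ℂ H)} {B : Subalgebra ℂ (H →L[ℂ] H)}
  {γ : ℕ → (H →L[ℂ] H) → (H →L[ℂ] H)} {C : ℝ}

/-- `γ n` converges to the identity uniformly on the unit ball of `S`. -/
def UnifOn (γ : ℕ → (H →L[ℂ] H) → (H →L[ℂ] H)) (S : Set (H →L[ℂ] H)) : Prop :=
  ∀ c : ℝ, 0 < c → ∀ᶠ n in atTop, ∀ A ∈ S, ‖γ n A - A‖ ≤ c * ‖A‖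

theorem mul_rankOne (A : H →L[ℂ] H) (x e : H) : A * rankOne ℂ x e = rankOne ℂ (A x) e := by
  ext v; simp

theorem rankOne_add (x y e : H) : rankOne ℂ (x + y) e = rankOne ℂ x e + rankOne ℂ y e := by
  ext v; simp

theorem rankOne_smul (c : ℂ) (x e : H) : rankOne ℂ (c • x) e = c • rankOne ℂ x e := by
  ext v; simp

/-- On `L` the operators are T_n x = γ_n(x ⊗ e)e; multiplicativity of γ_n applied to A(x ⊗ e) = (Ax)
⊗ e gives the intertwining relation. -/
theorem exists_implements (hB : nestAlgebra N ≤ B)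
    (hγ : ApproxIdentity B γ C) {L : Submodule ℂ H} (hLc : IsClosed (L : Set H)) (hL : L ∈ N)
    {e : H} (he : ‖e‖ = 1) (heB : ∀ x ∈ L, rankOne ℂ x e ∈ B) :
    ∃ T, Implements N γ L T C ∧ ∀ n, ∀ A ∈ B, ∀ x ∈ L, A x ∈ L → T n (A x) = γ n A (T n x) := by
  let T : ℕ → H →L[ℂ] H := fun n => LinearMap.mkContinuous
    { toFun := fun x => γ n (rankOne ℂ (nproj L x) e) e
      map_add' := fun x y => by
        rw [map_add, rankOne_add, hγ.map_add n _ (heB _ (nproj_mem hLc x)) _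
          (heB _ (nproj_mem hLc y)), add_apply]
      map_smul' := fun c x => by
        rw [map_smul, rankOne_smul, hγ.map_smul n c _ (heB _ (nproj_mem hLc x)), smul_apply,
          RingHom.id_apply] } C (fun x => by
        refine ((γ n _).le_of_opNorm_le (hγ.bound n _ (heB _ (nproj_mem hLc x))) e).trans ?_
        rw [norm_rankOne, he, mul_one, mul_one]
        exact mul_le_mul_of_nonneg_left (norm_nproj_apply_le L x) hγ.nonneg)
  have hT : ∀ n, ∀ x ∈ L, T n x = γ n (rankOne ℂ x e) e := by
    intro n x hx
    change γ n (rankOne ℂ (nproj L x) e) e = _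
    rw [nproj_of_mem hx]
  have hmap : ∀ n, ∀ A ∈ B, ∀ x ∈ L, A x ∈ L → T n (A x) = γ n A (T n x) := by
    intro n A hA x hx hAx
    rw [hT n _ hAx, hT n x hx, ← mul_rankOne, hγ.map_mul n A hA _ (heB x hx)]
    rfl
  refine ⟨T, ⟨fun n => LinearMap.mkContinuous_norm_le _ hγ.nonneg _,
    fun n A hA x hx => hmap n A (hB hA) x hx (hA L hL x hx), fun x hx => ?_⟩, hmap⟩
  have h1 := ((ContinuousLinearMap.apply ℂ H e).continuous.tendsto _).comp
    (hγ.tendsto _ (heB x hx))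
  have h2 : (ContinuousLinearMap.apply ℂ H e) (rankOne ℂ x e) = x := by simp [he]
  rw [h2] at h1
  exact h1.congr fun n => (hT n x hx).symm

/-- With P the projection onto `L` and x = Pv, (γ_n(A) − A)v is the sum of γ_n(A)(γ_n(P) − P)v,
γ_n(A)(x − T_n x) and T_n Ax − Ax. Each is controlled by ‖A‖‖v‖, since T_n tends to the identity
uniformly on `L`. -/
theorem unifOn_of_rankOne_mem (hN : IsNest N) (hB : nestAlgebra N ≤ B)
    (hγ : ApproxIdentity B γ C) {L : Submodule ℂ H} (hL : L ∈ N) {e : H} (he : ‖e‖ = 1)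
    (heB : ∀ x ∈ L, rankOne ℂ x e ∈ B) :
    UnifOn γ {A | A ∈ B ∧ (∀ x ∈ L, A x ∈ L) ∧ A * nproj L = A} := by
  intro c hc
  have hC := hγ.nonneg
  obtain ⟨T, hT, hmap⟩ := exists_implements hB hγ (hN.isClosed L hL) hL he heB
  have hε : 0 < c / (3 * (C + 1)) := by positivity
  have hLB := hB (nproj_mem_nestAlgebra hN hL)
  filter_upwards [hT.tendsto_uniformly hN hB hγ hL hε, hγ.eventually hLB hε] with n h1 h2
  rintro A ⟨hA, hAL, hAe⟩
  refine ContinuousLinearMap.opNorm_le_bound _ (by positivity) fun v => ?_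
  set x := nproj L v with hx
  have hxL : x ∈ L := nproj_mem (hN.isClosed L hL) v
  have hxv : ‖x‖ ≤ ‖v‖ := norm_nproj_apply_le L v
  have hAv : A v = A x := by conv_lhs => rw [← hAe, mul_apply_eq_comp]
  have hγA : γ n A v = γ n A (γ n (nproj L) v) := by
    conv_lhs => rw [← hAe, hγ.map_mul n A hA _ hLB, mul_apply_eq_comp]
  have h3 : (γ n A - A) v = γ n A ((γ n (nproj L) - nproj L) v) + γ n A (x - T n x) +
      (T n (A x) - A x) := by
    rw [sub_apply, hAv, hγA, sub_apply, map_sub, map_sub, hmap n A hA x hxL (hAL x hxL), ← hx]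
    abel
  have hb := hγ.bound n A hA
  have h4 : ‖γ n A ((γ n (nproj L) - nproj L) v)‖ ≤ C * ‖A‖ * (c / (3 * (C + 1)) * ‖v‖) :=
    ((γ n A).le_of_opNorm_le hb _).trans
      (mul_le_mul_of_nonneg_left (ContinuousLinearMap.le_of_opNorm_le _ h2 _) (by positivity))
  have h5 : ‖γ n A (x - T n x)‖ ≤ C * ‖A‖ * (c / (3 * (C + 1)) * ‖v‖) := by
    refine ((γ n A).le_of_opNorm_le hb _).trans (mul_le_mul_of_nonneg_left ?_ (by positivity))
    rw [norm_sub_rev]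
    exact (h1 x hxL).trans (by gcongr)
  have h6 : ‖T n (A x) - A x‖ ≤ c / (3 * (C + 1)) * (‖A‖ * ‖v‖) := by
    refine (h1 _ (hAL x hxL)).trans (mul_le_mul_of_nonneg_left ?_ hε.le)
    exact (A.le_opNorm x).trans (by gcongr)
  rw [h3]
  refine (norm_add₃_le).trans ((add_le_add (add_le_add h4 h5) h6).trans ?_)
  have h7 : C * ‖A‖ * (c / (3 * (C + 1)) * ‖v‖) + C * ‖A‖ * (c / (3 * (C + 1)) * ‖v‖) +
      c / (3 * (C + 1)) * (‖A‖ * ‖v‖) = (2 * C + 1) / (3 * (C + 1)) * (c * ‖A‖ * ‖v‖) := by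
    field_simp
    ring
  rw [h7]
  refine mul_le_of_le_one_left (by positivity) ?_
  rw [div_le_one (by positivity)]
  linarith

theorem ApproxIdentity.unifOn_of_rankOne (hN : IsNest N) (hB : nestAlgebra N ≤ B)
    (hγ : ApproxIdentity B γ C) {e : H} (he : ‖e‖ = 1) (heB : ∀ x, rankOne ℂ x e ∈ B) :
    UnifOn γ B := fun c hc =>
  (unifOn_of_rankOne_mem hN hB hγ hN.top_mem he (fun x _ => heB x) c hc).mono fun _ hn A hA =>
    hn A ⟨hA, fun _ _ => trivial, by rw [nproj_top, mul_one]⟩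

theorem unifOn_mul_nproj (hN : IsNest N) (hγ : ApproxIdentity (nestAlgebra N) γ C)
    {M : Submodule ℂ H} (hM : M ∈ N) (hMt : M ≠ ⊤) :
    UnifOn γ {A | A ∈ nestAlgebra N ∧ A * nproj M = A} := by
  obtain ⟨e, -, he, he1⟩ := exists_unit_of_lt (hN.isClosed M hM) (lt_top_iff_ne_top.2 hMt)
  intro c hc
  exact (unifOn_of_rankOne_mem hN le_rfl hγ hM he1
    (fun x hx => rankOne_mem_nestAlgebra_of_mem hN hM hx he) c hc).mono fun n hn A hA =>
      hn A ⟨hA.1, fun x hx => hA.1 M hM x hx, hA.2⟩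

theorem ApproxIdentity.dual (hN : IsNest N) (hγ : ApproxIdentity (nestAlgebra N) γ C) :
    ApproxIdentity (nestAlgebra (dualNest N)) (fun n A => star (γ n (star A))) C := by
  have hs : ∀ A ∈ nestAlgebra (dualNest N), star A ∈ nestAlgebra N := fun A hA => by
    rwa [← adjoint_mem_nestAlgebra_dual hN, star_star]
  refine ⟨hγ.nonneg, fun n A hA A' hA' => ?_, fun n A hA A' hA' => ?_, fun n c A hA => ?_,
    fun n A hA => ?_, fun A hA => ?_⟩
  · rw [star_mul, hγ.map_mul n _ (hs A' hA') _ (hs A hA), star_mul]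
  · rw [star_add, hγ.map_add n _ (hs A hA) _ (hs A' hA'), star_add]
  · rw [star_smul, hγ.map_smul n _ _ (hs A hA), star_smul, star_star]
  · rw [norm_star]
    simpa using hγ.bound n _ (hs A hA)
  · simpa using (hγ.tendsto _ (hs A hA)).star

/-- This is `unifOn_mul_nproj` for the dual nest, read through adjoints. -/
theorem unifOn_compl_mul (hN : IsNest N) (hγ : ApproxIdentity (nestAlgebra N) γ C)
    {Q : Submodule ℂ H} (hQ : Q ∈ N) (hQ0 : Q ≠ ⊥) :
    UnifOn γ {A | A ∈ nestAlgebra N ∧ (1 - nproj Q) * A = A} := by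
  intro c hc
  have hQt : Qᗮ ≠ ⊤ := fun h => hQ0 ((Submodule.orthogonal_eq_top_iff _).1 h)
  refine (unifOn_mul_nproj hN.dual (hγ.dual hN) ⟨Q, hQ, rfl⟩ hQt c hc).mono fun n hn A hA => ?_
  have h1 := hn (star A) ⟨(adjoint_mem_nestAlgebra_dual hN).2 hA.1, by
    rw [nproj_orthogonal]
    conv_rhs => rw [← hA.2]
    rw [star_mul, star_sub, star_one, (isStarProjection_nproj Q).isSelfAdjoint.star_eq]⟩
  rw [star_star, ← star_sub, norm_star, norm_star] at h1
  exact h1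

theorem norm_mul_nproj_le (A : H →L[ℂ] H) (M : Submodule ℂ H) : ‖A * nproj M‖ ≤ ‖A‖ :=
  (norm_mul_le _ _).trans (mul_le_of_le_one_right (norm_nonneg _) (norm_nproj_le M))

theorem norm_compl_nproj_le (M : Submodule ℂ H) : ‖1 - nproj M‖ ≤ 1 := by
  rw [← nproj_orthogonal]; exact norm_nproj_le _

theorem nproj_compl_apply (M : Submodule ℂ H) (x : H) : (1 - nproj M) x = x - nproj M x := by
  simp

/-- Split A = AM + QA(1 − M) + (1 − Q)A(1 − M), writing members for their projections. The outer
terms fall under the two one-sided results. The middle one factors as UV through a unit vector x₁ ∈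
M ⊖ Q, with UM = U and (1 − Q)V = V, so each factor is covered by one of them. -/
theorem ApproxIdentity.unifOn_nest_rankOne (hN : IsNest N)
    (hγ : ApproxIdentity (nestAlgebra N) γ C) {Q M : Submodule ℂ H} (hQ : Q ∈ N) (hM : M ∈ N)
    (hQ0 : Q ≠ ⊥) (hQM : Q < M) (hMt : M ≠ ⊤) :
    UnifOn γ {A | ∃ L ∈ N, ∃ x ∈ L, ∃ e ∈ Lᗮ, A = rankOne ℂ x e} := by
  intro c hc
  have hC := hγ.nonneg
  have hε : 0 < c / (C + 4) := by positivity
  obtain ⟨x₁, hx₁, hx₁', hx₁1⟩ := exists_unit_of_lt (hN.isClosed Q hQ) hQM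
  have hQN := nproj_mem_nestAlgebra hN hQ
  have hMN := nproj_mem_nestAlgebra hN hM
  filter_upwards [unifOn_mul_nproj hN hγ hM hMt _ hε, unifOn_compl_mul hN hγ hQ hQ0 _ hε]
    with n h1 h2
  rintro A ⟨L, hL, x, hx, e, he, rfl⟩
  set A := rankOne ℂ x e with hAdef
  have hA : A ∈ nestAlgebra N := rankOne_mem_nestAlgebra_of_mem hN hL hx he
  have hAn : ‖A‖ = ‖x‖ * ‖e‖ := norm_rankOne _ _
  set e' := (1 - nproj M) e with he'
  have he'n : ‖e'‖ ≤ ‖e‖ := by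
    rw [he', ← nproj_orthogonal]; exact norm_nproj_apply_le _ _
  have hxn : ‖nproj Q x‖ ≤ ‖x‖ := norm_nproj_apply_le _ _
  have he'M : e' ∈ Mᗮ := by rw [he', nproj_compl_apply]; exact sub_nproj_mem M e
  have hQx : nproj Q x ∈ Q := nproj_mem (hN.isClosed Q hQ) x
  set U := rankOne ℂ (nproj Q x) x₁ with hU
  set V := rankOne ℂ x₁ e' with hV
  have hUN : U ∈ nestAlgebra N := rankOne_mem_nestAlgebra_of_mem hN hQ hQx hx₁'
  have hVN : V ∈ nestAlgebra N := rankOne_mem_nestAlgebra_of_mem hN hM hx₁ he'M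
  have hrank : ∀ (S : H →L[ℂ] H), IsSelfAdjoint S → ∀ y z : H,
      rankOne ℂ y z * S = rankOne ℂ y (S z) := by
    intro S hS y z
    ext v
    simp only [mul_apply_eq_comp, rankOne_apply]
    rw [← ContinuousLinearMap.adjoint_inner_left, ← ContinuousLinearMap.star_eq_adjoint, hS.star_eq]
  have hMsa := (isStarProjection_nproj M).isSelfAdjoint
  have hMsa' : IsSelfAdjoint (1 - nproj M) := (IsSelfAdjoint.one _).sub hMsa
  have hUc : U * nproj M = U := by rw [hU, hrank _ hMsa, nproj_of_mem hx₁]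
  have hVc : (1 - nproj Q) * V = V := by
    rw [hV, mul_rankOne, nproj_compl_apply, nproj_of_mem_orthogonal hx₁', sub_zero]
  have hUV : U * V = nproj Q * A * (1 - nproj M) := by
    rw [mul_assoc, hAdef, hrank _ hMsa', mul_rankOne, mul_rankOne, hU, rankOne_apply,
      inner_self_eq_norm_sq_to_K, hx₁1]
    simp [he']
  have h3 := h1 (A * nproj M) ⟨mul_mem hA hMN, by rw [mul_assoc, nproj_mul_self]⟩
  have h4 := h2 ((1 - nproj Q) * A * (1 - nproj M))
    ⟨mul_mem (mul_mem (sub_mem (one_mem _) hQN) hA) (sub_mem (one_mem _) hMN), by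
      rw [← mul_assoc, ← mul_assoc, ← nproj_orthogonal Q, nproj_mul_self]⟩
  have h5 := h1 U ⟨hUN, hUc⟩
  have h6 := h2 V ⟨hVN, hVc⟩
  have hdec : A = A * nproj M + (U * V + (1 - nproj Q) * A * (1 - nproj M)) := by
    rw [hUV]; noncomm_ring
  have hWmem : (1 - nproj Q) * A * (1 - nproj M) ∈ nestAlgebra N :=
    mul_mem (mul_mem (sub_mem (one_mem _) hQN) hA) (sub_mem (one_mem _) hMN)
  have hWn : ‖(1 - nproj Q) * A * (1 - nproj M)‖ ≤ ‖A‖ := by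
    refine (norm_mul_le _ _).trans ?_
    have := (norm_mul_le (1 - nproj Q) A)
    nlinarith [norm_compl_nproj_le Q, norm_compl_nproj_le M, norm_nonneg A,
      norm_nonneg (1 - nproj M), norm_nonneg ((1 - nproj Q) * A), norm_nonneg (1 - nproj Q)]
  have hUn : ‖U‖ ≤ ‖x‖ := by rw [hU, norm_rankOne, hx₁1, mul_one]; exact hxn
  have hVn : ‖V‖ ≤ ‖e‖ := by rw [hV, norm_rankOne, hx₁1, one_mul]; exact he'n
  have h7 : γ n A - A = (γ n (A * nproj M) - A * nproj M) +
      ((γ n U * (γ n V - V) + (γ n U - U) * V) +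
        (γ n ((1 - nproj Q) * A * (1 - nproj M)) - (1 - nproj Q) * A * (1 - nproj M))) := by
    conv_lhs => rw [hdec]
    rw [hγ.map_add n _ (mul_mem hA hMN) _ (add_mem (mul_mem hUN hVN) hWmem),
      hγ.map_add n _ (mul_mem hUN hVN) _ hWmem, hγ.map_mul n _ hUN _ hVN]
    noncomm_ring
  have h8 : ‖γ n U * (γ n V - V)‖ ≤ C * (c / (C + 4)) * ‖A‖ := by
    refine (norm_mul_le _ _).trans ((mul_le_mul (hγ.bound n U hUN) h6 (norm_nonneg _)
      (by positivity)).trans ?_)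
    calc C * ‖U‖ * (c / (C + 4) * ‖V‖) ≤ C * ‖x‖ * (c / (C + 4) * ‖e‖) := by gcongr
      _ = _ := by rw [hAn]; ring
  have h9 : ‖(γ n U - U) * V‖ ≤ c / (C + 4) * ‖A‖ := by
    refine (norm_mul_le _ _).trans ((mul_le_mul_of_nonneg_right h5 (norm_nonneg _)).trans ?_)
    calc c / (C + 4) * ‖U‖ * ‖V‖ ≤ c / (C + 4) * ‖x‖ * ‖e‖ := by gcongr
      _ = _ := by rw [hAn]; ring
  have h10 : ‖γ n (A * nproj M) - A * nproj M‖ ≤ c / (C + 4) * ‖A‖ :=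
    h3.trans (mul_le_mul_of_nonneg_left (norm_mul_nproj_le A M) hε.le)
  have h11 := h4.trans (mul_le_mul_of_nonneg_left hWn hε.le)
  rw [h7]
  refine (norm_add_le _ _).trans ((add_le_add h10 ((norm_add_le _ _).trans
    (add_le_add ((norm_add_le _ _).trans (add_le_add h8 h9)) h11))).trans ?_)
  have h12 : c / (C + 4) * ‖A‖ + (C * (c / (C + 4)) * ‖A‖ + c / (C + 4) * ‖A‖ +
      c / (C + 4) * ‖A‖) = (C + 3) / (C + 4) * (c * ‖A‖) := by ring
  rw [h12]
  refine mul_le_of_le_one_left (by positivity) ?_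
  rw [div_le_one (by positivity)]
  linarith

/-- Pointwise convergence of homomorphisms of a nest algebra to the identity is uniform. -/
theorem ApproxIdentity.unifOn_nestAlgebra [Nontrivial H] (hN : IsNest N)
    (hγ : ApproxIdentity (nestAlgebra N) γ C) : UnifOn γ (nestAlgebra N) := by
  have htb : (⊤ : Submodule ℂ H) ≠ ⊥ := top_ne_bot
  -- With a gap below the whole space, a unit vector e in the gap makes every x ⊗ e a member of the
  -- nest algebra, and `L = ⊤` is allowed.
  by_cases hpred : nestPred N ⊤ = ⊤
  swap
  · obtain ⟨e, -, he, he1⟩ := exists_unit_of_lt (hN.isClosed _ (hN.pred_mem ⊤))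
      (lt_top_iff_ne_top.2 hpred)
    refine hγ.unifOn_of_rankOne hN le_rfl he1 fun x => rankOne_mem_nestAlgebra fun M hM => ?_
    by_cases hMt : M = ⊤
    · exact Or.inl (hMt ▸ trivial)
    · exact Or.inr (Submodule.orthogonal_le (le_nestPred hM (lt_top_iff_ne_top.2 hMt)) he)
  have hbetween : ∀ Q₀ ∈ N, Q₀ < ⊤ → ∃ Q ∈ N, Q₀ < Q ∧ Q < ⊤ := by
    intro Q₀ hQ₀ hlt
    by_contra! hno
    refine hlt.not_ge (hpred ▸ Submodule.topologicalClosure_minimal _ (sSup_le fun Q hQ => ?_)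
      (hN.isClosed _ hQ₀))
    by_contra hnle
    exact hno Q hQ.1 (hN.lt_of_not_le hQ.1 hQ₀ hnle) hQ.2
  obtain ⟨Q, hQ, hQ0, hQt⟩ := hbetween ⊥ hN.bot_mem (bot_lt_iff_ne_bot.2 htb)
  obtain ⟨M, hM, hQM, hMt⟩ := hbetween Q hQ hQt
  intro c hc
  have hC := hγ.nonneg
  have hε : 0 < c / (C + 1) := by positivity
  filter_upwards [hγ.unifOn_nest_rankOne hN hQ hM hQ0.ne' hQM hMt.ne _ hε] with n hn A hA
  have hL : ∀ L ∈ N, L < ⊤ → ∀ x ∈ L, ‖(γ n A - A) x‖ ≤ c * ‖A‖ * ‖x‖ := by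
    intro L hL hLt x hx
    obtain ⟨e, -, he, he1⟩ := exists_unit_of_lt (hN.isClosed L hL) hLt
    have hR : rankOne ℂ x e ∈ nestAlgebra N := rankOne_mem_nestAlgebra_of_mem hN hL hx he
    have h1 := hn _ ⟨L, hL, x, hx, e, he, rfl⟩
    have h2 := hn _ ⟨L, hL, A x, hA L hL x hx, e, he, rfl⟩
    rw [norm_rankOne, he1, mul_one] at h1 h2
    -- For x ∈ L < ⊤ the difference γ_n(A) − A is tested on x by tensoring with a unit vector e ⊥ L.
    -- Since such L increase strongly to the whole space, this determines the norm.
    have h3 : rankOne ℂ ((γ n A - A) x) e = (γ n (rankOne ℂ (A x) e) - rankOne ℂ (A x) e) -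
        γ n A * (γ n (rankOne ℂ x e) - rankOne ℂ x e) := by
      rw [← mul_rankOne A, hγ.map_mul n A hA _ hR, ← mul_rankOne]
      noncomm_ring
    have h4 : ‖(γ n A - A) x‖ = ‖rankOne ℂ ((γ n A - A) x) e‖ := by
      rw [norm_rankOne, he1, mul_one]
    rw [h4, h3]
    refine (norm_sub_le _ _).trans ((add_le_add (h2.trans (mul_le_mul_of_nonneg_left
      (A.le_opNorm x) hε.le)) ((norm_mul_le _ _).trans (mul_le_mul (hγ.bound n A hA) h1
        (norm_nonneg _) (by positivity)))).trans (le_of_eq ?_))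
    field_simp
    ring
  refine ContinuousLinearMap.opNorm_le_bound _ (by positivity) fun v => ?_
  refine le_of_forall_pos_le_add fun δ hδ => ?_
  set K := ‖γ n A - A‖ with hK
  obtain ⟨L, hL', hLv⟩ := hN.exists_norm_sub_lt_left hN.top_mem htb hpred v
    (show 0 < δ / (K + 1) by positivity)
  have h1 := hLv L hL'.1 le_rfl le_top
  rw [nproj_top, nproj_compl_apply] at h1
  have h2 : (γ n A - A) v = (γ n A - A) (nproj L v) + (γ n A - A) (v - nproj L v) := by
    rw [← _root_.map_add]; congr 1; abel
  rw [h2]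
  refine (norm_add_le _ _).trans (add_le_add ?_ ?_)
  · refine (hL L hL'.1 hL'.2 _ (nproj_mem (hN.isClosed L hL'.1) v)).trans ?_
    exact mul_le_mul_of_nonneg_left (norm_nproj_apply_le L v) (by positivity)
  · refine ((γ n A - A).le_opNorm _).trans ?_
    rw [← hK]
    calc K * ‖v - nproj L v‖ ≤ (K + 1) * (δ / (K + 1)) := by gcongr; linarith
      _ = δ := mul_div_cancel₀ δ (by positivity)

end UniformConvergence

/-! ### A local criterion for quasi-triangularity, and closedness -/

section QuasiTriangular

set_option linter.unusedSectionVars false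

variable {H : Type*} [NormedAddCommGroup H] [InnerProductSpace ℂ H] [CompleteSpace H]

theorem IsCompactOperator.mul_left {κ : H →L[ℂ] H} (hκ : IsCompactOperator κ) (A : H →L[ℂ] H) :
    IsCompactOperator (A * κ : H →L[ℂ] H) := hκ.clm_comp A

theorem IsCompactOperator.mul_right {κ : H →L[ℂ] H} (hκ : IsCompactOperator κ) (A : H →L[ℂ] H) :
    IsCompactOperator (κ * A : H →L[ℂ] H) := hκ.comp_clm A

theorem nproj_eq_starProjection {V : Submodule ℂ H} [V.HasOrthogonalProjection]
    (hV : IsClosed (V : Set H)) : nproj V = V.starProjection := by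
  ext x
  exact (Submodule.eq_starProjection_of_mem_orthogonal (nproj_mem hV x) (sub_nproj_mem V x)).symm

theorem isCompactOperator_nproj (V : Submodule ℂ H) [FiniteDimensional ℂ V] :
    IsCompactOperator (nproj V) := by
  rw [nproj_eq_starProjection (Submodule.closed_of_finiteDimensional V)]
  have : ProperSpace V := FiniteDimensional.proper ℂ V
  exact ((isCompactOperator_id (E := V)).comp_clm V.orthogonalProjectionOnto).clm_comp V.subtypeL

theorem isCompactOperator_rankOne (x e : H) : IsCompactOperator (rankOne ℂ x e) :=
  ((isCompactOperator_id (E := ℂ)).comp_clm (innerSL ℂ e)).clm_comp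
    (ContinuousLinearMap.toSpanSingleton ℂ x)

/-- A family of interval projections of the nest that decreases strongly to zero. -/
structure ShrinkingFamily (N : Set (Submodule ℂ H)) (𝓕 : Set (H →L[ℂ] H)) : Prop where
  nonempty : 𝓕.Nonempty
  interval : ∀ F ∈ 𝓕, ∃ Q ∈ N, ∃ P ∈ N, Q ≤ P ∧ F = nproj P - nproj Q
  small : ∀ F ∈ 𝓕, ∀ (s : Finset H) (ε : ℝ), 0 < ε →
    ∃ F' ∈ 𝓕, F * F' = F' ∧ F' * F = F' ∧ ∀ v ∈ s, ‖F' v‖ ≤ ε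

variable {N : Set (Submodule ℂ H)}

theorem ShrinkingFamily.isStarProjection {𝓕 : Set (H →L[ℂ] H)} (h𝓕 : ShrinkingFamily N 𝓕)
    {F : H →L[ℂ] H} (hF : F ∈ 𝓕) : IsStarProjection F := by
  obtain ⟨Q, -, P, -, hQP, rfl⟩ := h𝓕.interval F hF
  exact isStarProjection_nproj_sub hQP

theorem ShrinkingFamily.mem {𝓕 : Set (H →L[ℂ] H)} (hN : IsNest N) (h𝓕 : ShrinkingFamily N 𝓕)
    {F : H →L[ℂ] H} (hF : F ∈ 𝓕) : F ∈ nestAlgebra N := by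
  obtain ⟨Q, hQ, P, hP, -, rfl⟩ := h𝓕.interval F hF
  exact sub_mem (nproj_mem_nestAlgebra hN hP) (nproj_mem_nestAlgebra hN hQ)

theorem nproj_sub_mul_of_le {Q Q' P : Submodule ℂ H} (h : Q ≤ Q') (h' : Q' ≤ P) :
    (nproj P - nproj Q) * (nproj P - nproj Q') = nproj P - nproj Q' ∧
      (nproj P - nproj Q') * (nproj P - nproj Q) = nproj P - nproj Q' := by
  constructor
  · rw [sub_mul, mul_sub, mul_sub, nproj_mul_self, nproj_mul_of_le h, nproj_mul_of_ge h',
      nproj_mul_of_le (h.trans h')]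
    abel
  · rw [sub_mul, mul_sub, mul_sub, nproj_mul_self, nproj_mul_of_ge h, nproj_mul_of_le h',
      nproj_mul_of_ge (h.trans h')]
    abel

theorem nproj_sub_mul_of_ge {Q R' R : Submodule ℂ H} (h : Q ≤ R') (h' : R' ≤ R) :
    (nproj R - nproj Q) * (nproj R' - nproj Q) = nproj R' - nproj Q ∧
      (nproj R' - nproj Q) * (nproj R - nproj Q) = nproj R' - nproj Q := by
  constructor
  · rw [sub_mul, mul_sub, mul_sub, nproj_mul_self, nproj_mul_of_le h, nproj_mul_of_ge h',
      nproj_mul_of_ge (h.trans h')]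
    abel
  · rw [sub_mul, mul_sub, mul_sub, nproj_mul_self, nproj_mul_of_ge h, nproj_mul_of_le h',
      nproj_mul_of_le (h.trans h')]
    abel

theorem IsNest.shrinkingFamily_left (hN : IsNest N) {P : Submodule ℂ H} (hP : P ∈ N)
    (hP0 : P ≠ ⊥) (hpred : nestPred N P = P) :
    ShrinkingFamily N {F | ∃ Q ∈ N, Q < P ∧ F = nproj P - nproj Q} where
  nonempty := by
    obtain ⟨Q, hQ, hlt⟩ := hN.exists_lt_of_pred_eq hP0 hpred
    exact ⟨_, Q, hQ, hlt, rfl⟩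
  interval := by
    rintro _ ⟨Q, hQ, hlt, rfl⟩
    exact ⟨Q, hQ, P, hP, hlt.le, rfl⟩
  small := by
    classical
    rintro _ ⟨Q, hQ, hlt, rfl⟩ s ε hε
    obtain ⟨Q', ⟨hQ', hlt'⟩, hQQ', hs⟩ : ∃ Q', (Q' ∈ N ∧ Q' < P) ∧ Q ≤ Q' ∧
        ∀ v ∈ s, ∀ R ∈ N, Q' ≤ R → R ≤ P → ‖(nproj P - nproj R) v‖ ≤ ε := by
      induction s using Finset.induction_on with
      | empty => exact ⟨Q, ⟨hQ, hlt⟩, le_rfl, by simp⟩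
      | insert v s _ ih =>
        obtain ⟨Q', hQ', hQQ', hs⟩ := ih
        obtain ⟨R, hR, hv⟩ := hN.exists_norm_sub_lt_left hP hP0 hpred v hε
        obtain ⟨R', hR', h1, h2⟩ := hN.exists_ge_ge hQ' hR
        refine ⟨R', hR', hQQ'.trans h1, fun w hw S hS hle hSP => ?_⟩
        rcases Finset.mem_insert.1 hw with rfl | hw
        · exact (hv S hS (h2.trans hle) hSP).le
        · exact hs w hw S hS (h1.trans hle) hSP
    have h1 := nproj_sub_mul_of_le hQQ' hlt'.le
    exact ⟨_, ⟨Q', hQ', hlt', rfl⟩, h1.1, h1.2, fun v hv => hs v hv Q' hQ' le_rfl hlt'.le⟩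

theorem IsNest.shrinkingFamily_right (hN : IsNest N) {P : Submodule ℂ H} (hP : P ∈ N)
    (hP1 : P ≠ ⊤) (hsucc : nestSucc N P = P) :
    ShrinkingFamily N {F | ∃ R ∈ N, P < R ∧ F = nproj R - nproj P} where
  nonempty := by
    obtain ⟨R, hR, hlt⟩ := IsNest.exists_gt_of_succ_eq hP1 hsucc
    exact ⟨_, R, hR, hlt, rfl⟩
  interval := by
    rintro _ ⟨R, hR, hlt, rfl⟩
    exact ⟨P, hP, R, hR, hlt.le, rfl⟩
  small := by
    classical
    rintro _ ⟨R, hR, hlt, rfl⟩ s ε hε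
    obtain ⟨R', ⟨hR', hlt'⟩, hRR', hs⟩ : ∃ R', (R' ∈ N ∧ P < R') ∧ R' ≤ R ∧
        ∀ v ∈ s, ∀ S ∈ N, S ≤ R' → P ≤ S → ‖(nproj S - nproj P) v‖ ≤ ε := by
      induction s using Finset.induction_on with
      | empty => exact ⟨R, ⟨hR, hlt⟩, le_rfl, by simp⟩
      | insert v s _ ih =>
        obtain ⟨R', hR', hRR', hs⟩ := ih
        obtain ⟨S, hS, hv⟩ := hN.exists_norm_sub_lt_right hP hP1 hsucc v hε
        obtain ⟨S', hS', h1, h2⟩ : ∃ S', (S' ∈ N ∧ P < S') ∧ S' ≤ R' ∧ S' ≤ S := by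
          rcases hN.le_total hR'.1 hS.1 with h | h
          exacts [⟨R', hR', le_rfl, h⟩, ⟨S, hS, h, le_rfl⟩]
        refine ⟨S', hS', h1.trans hRR', fun w hw Z hZ hle hZP => ?_⟩
        rcases Finset.mem_insert.1 hw with rfl | hw
        · exact (hv Z hZ (hle.trans h2) hZP).le
        · exact hs w hw Z hZ (hle.trans h1) hZP
    have h1 := nproj_sub_mul_of_ge hlt'.le hRR'
    exact ⟨_, ⟨R', hR', hlt', rfl⟩, h1.1, h1.2, fun v hv => hs v hv R' hR' le_rfl hlt'.le⟩

/-- The compression of `T` by `F` is within `η` of the nest algebra. -/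
def NearNest (N : Set (Submodule ℂ H)) (T : H →L[ℂ] H) (η : ℝ) (F : H →L[ℂ] H) : Prop :=
  ∃ a ∈ nestAlgebra N, ‖F * T * F - a‖ ≤ η

theorem norm_conj_le {F : H →L[ℂ] H} (hF : ‖F‖ ≤ 1) (X : H →L[ℂ] H) : ‖F * X * F‖ ≤ ‖X‖ := by
  have h1 := norm_mul_le (F * X) F
  have h2 := norm_mul_le F X
  have h3 : ‖F * X‖ * ‖F‖ ≤ ‖F * X‖ := mul_le_of_le_one_right (norm_nonneg _) hF
  have h4 : ‖F‖ * ‖X‖ ≤ ‖X‖ := mul_le_of_le_one_left (norm_nonneg _) hF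
  linarith

theorem NearNest.mono {T F F' : H →L[ℂ] H} {η : ℝ} (h : NearNest N T η F)
    (hF' : F' ∈ nestAlgebra N) (hF'1 : ‖F'‖ ≤ 1) (h1 : F * F' = F') (h2 : F' * F = F') :
    NearNest N T η F' := by
  obtain ⟨a, ha, hη⟩ := h
  refine ⟨F' * a * F', mul_mem (mul_mem hF' ha) hF', ?_⟩
  have : F' * T * F' - F' * a * F' = F' * (F * T * F - a) * F' := by
    calc F' * T * F' - F' * a * F' = (F' * F) * T * (F * F') - F' * a * F' := by rw [h1, h2]
      _ = _ := by noncomm_ring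
  rw [this]
  exact (norm_conj_le hF'1 _).trans hη

/-- Operators with compact lower-triangular corners that are locally close to the nest algebra. -/
structure QuasiLocal (N : Set (Submodule ℂ H)) (T : H →L[ℂ] H) : Prop where
  corner : ∀ P ∈ N, IsCompactOperator ((1 - nproj P) * T * nproj P : H →L[ℂ] H)
  near : ∀ η : ℝ, 0 < η → ∀ 𝓕, ShrinkingFamily N 𝓕 → ∃ F ∈ 𝓕, NearNest N T η F

/-- Compact perturbations are harmless because F k F is small in norm once F is small on a finite
net for k; elements of the nest algebra stay there under compression. -/
theorem QuasiLocal.sub (hN : IsNest N) {T k a : H →L[ℂ] H} (hT : QuasiLocal N T)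
    (hk : IsCompactOperator k) (ha : a ∈ nestAlgebra N) : QuasiLocal N (T - k - a) where
  corner P hP := by
    have h1 : (1 - nproj P) * (T - k - a) * nproj P =
        (1 - nproj P) * T * nproj P - (1 - nproj P) * k * nproj P := by
      have : (1 - nproj P) * a * nproj P = 0 := by
        rw [sub_mul, sub_mul, nproj_mul_mul_nproj hN ha hP, one_mul, sub_self]
      rw [mul_sub, mul_sub, sub_mul, sub_mul, this, sub_zero]
    rw [h1]
    exact (hT.corner P hP).sub ((hk.mul_left _).mul_right _)
  near η hη 𝓕 h𝓕 := by
    obtain ⟨F, hF, hFT⟩ := hT.near (η / 2) (half_pos hη) 𝓕 h𝓕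
    obtain ⟨t, ht⟩ := hk.exists_finset (show 0 < η / 4 by linarith)
    obtain ⟨F', hF', h1, h2, h3⟩ := h𝓕.small F hF t (η / 4) (by linarith)
    have hF'1 := (h𝓕.isStarProjection hF').opNorm_le_one
    have hF'N := h𝓕.mem hN hF'
    obtain ⟨b, hb, hbη⟩ := hFT.mono hF'N hF'1 h1 h2
    refine ⟨F', hF', b - F' * a * F', sub_mem hb (mul_mem (mul_mem hF'N ha) hF'N), ?_⟩
    have h4 : F' * (T - k - a) * F' - (b - F' * a * F') = (F' * T * F' - b) - F' * k * F' := by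
      noncomm_ring
    have h5 : ‖F' * k * F'‖ ≤ η / 2 := by
      refine (norm_mul_le _ _).trans ((mul_le_of_le_one_right (norm_nonneg _) hF'1).trans ?_)
      exact (ht F' hF'1 h3).trans (by linarith)
    rw [h4]
    exact (norm_sub_le _ _).trans (by linarith)

theorem norm_add_le_of_blocks {Q : Submodule ℂ H} {A B : H →L[ℂ] H} {c : ℝ} (hc : 0 ≤ c)
    (hA1 : nproj Q * A = A) (hA2 : A * nproj Q = A) (hB1 : (1 - nproj Q) * B = B)
    (hB2 : B * (1 - nproj Q) = B) (hA : ‖A‖ ≤ c) (hB : ‖B‖ ≤ c) : ‖A + B‖ ≤ c := by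
  refine ContinuousLinearMap.opNorm_le_bound _ hc fun v => ?_
  have h1 : ‖A v‖ ≤ c * ‖nproj Q v‖ := by
    conv_lhs => rw [← hA2, mul_apply_eq_comp]
    exact A.le_of_opNorm_le hA _
  have h2 : ‖B v‖ ≤ c * ‖v - nproj Q v‖ := by
    conv_lhs => rw [← hB2, mul_apply_eq_comp, nproj_compl_apply]
    exact B.le_of_opNorm_le hB _
  have h3 : inner ℂ (A v) (B v) = 0 := by
    rw [← hA1, ← hB1, mul_apply_eq_comp, mul_apply_eq_comp, nproj_inner, ← mul_apply_eq_comp,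
      mul_sub, mul_one, nproj_mul_self, sub_self, zero_apply, inner_zero_right]
  have h4 := norm_add_sq_eq_norm_sq_add_norm_sq_of_inner_eq_zero (𝕜 := ℂ) (A v) (B v) h3
  have h5 := norm_sq_eq_nproj Q v
  have h6 : ‖(A + B) v‖ ^ 2 ≤ (c * ‖v‖) ^ 2 := by
    rw [add_apply, mul_pow, h5]
    nlinarith [norm_nonneg (A v), norm_nonneg (B v)]
  exact le_of_sq_le_sq h6 (by positivity)

/-- Block decomposition of `P T P` along a finite chain of the nest. -/
structure BlockDecomp (N : Set (Submodule ℂ H)) (T : H →L[ℂ] H) (η : ℝ) (P : Submodule ℂ H) where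
  diag : H →L[ℂ] H
  approx : H →L[ℂ] H
  upper : H →L[ℂ] H
  lower : H →L[ℂ] H
  eq : nproj P * T * nproj P = diag + upper + lower
  diag_left : nproj P * diag = diag
  diag_right : diag * nproj P = diag
  approx_left : nproj P * approx = approx
  approx_right : approx * nproj P = approx
  upper_left : nproj P * upper = upper
  upper_right : upper * nproj P = upper
  norm_diag : ‖diag‖ ≤ ‖T‖
  approx_mem : approx ∈ nestAlgebra N
  norm_sub : ‖diag - approx‖ ≤ η
  upper_mem : upper ∈ nestAlgebra N
  lower_compact : IsCompactOperator lower
  cutoff : ∀ V : Submodule ℂ H, FiniteDimensional ℂ V → ∃ R : H →L[ℂ] H, IsCompactOperator R ∧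
    IsSelfAdjoint R ∧ ‖R‖ ≤ 1 ∧ nproj P * R = R ∧ R * nproj P = R ∧
      R * upper * R ∈ nestAlgebra N ∧ ∀ v ∈ V, R v = nproj P v

theorem BlockDecomp.bot (N : Set (Submodule ℂ H)) (T : H →L[ℂ] H) {η : ℝ} (hη : 0 ≤ η) :
    Nonempty (BlockDecomp N T η ⊥) := by
  refine ⟨⟨0, 0, 0, 0, ?_, ?_, ?_, ?_, ?_, ?_, ?_, ?_, ?_, ?_, ?_, ?_, ?_⟩⟩ <;>
    simp [nproj_bot, hη, zero_mem]
  · exact isCompactOperator_zero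
  · exact fun V _ => isCompactOperator_zero

/-- The interval E = P − Q becomes one more block: ETE is near the nest algebra by `hnear`, QTE is
strictly upper triangular, and ETQ is compact because the corner of T at Q is. -/
theorem BlockDecomp.step (hN : IsNest N) {T : H →L[ℂ] H} (hT : QuasiLocal N T) {η : ℝ}
    {Q P : Submodule ℂ H} (hQ : Q ∈ N) (hP : P ∈ N) (hQP : Q ≤ P)
    (hnear : NearNest N T η (nproj P - nproj Q)) (D : BlockDecomp N T η Q) :
    Nonempty (BlockDecomp N T η P) := by
  obtain ⟨b, hb, hbη⟩ := hnear
  set q := nproj Q with hq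
  set E := nproj P - q with hE
  have hPq : nproj P * q = q := nproj_mul_of_ge hQP
  have hqP : q * nproj P = q := nproj_mul_of_le hQP
  have hqq : q * q = q := nproj_mul_self Q
  have hqE : q * E = 0 := by rw [hE, mul_sub q (nproj P) q, hqP, hqq, sub_self]
  have hEq : E * q = 0 := by rw [hE, sub_mul (nproj P) q q, hPq, hqq, sub_self]
  have hE1 : (1 - q) * E = E := by rw [sub_mul 1 q E, hqE, one_mul, sub_zero]
  have hE2 : E * (1 - q) = E := by rw [mul_sub E 1 q, hEq, mul_one, sub_zero]
  have hEP1 : nproj P * E = E := by rw [hE, mul_sub, nproj_mul_self, nproj_mul_of_ge hQP]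
  have hEP2 : E * nproj P = E := by rw [hE, sub_mul, nproj_mul_self, nproj_mul_of_le hQP]
  have hEstar : IsStarProjection E := isStarProjection_nproj_sub hQP
  have hEn : ‖E‖ ≤ 1 := hEstar.opNorm_le_one
  have hEE : E * E = E := hEstar.isIdempotentElem
  have hEN : E ∈ nestAlgebra N :=
    sub_mem (nproj_mem_nestAlgebra hN hP) (nproj_mem_nestAlgebra hN hQ)
  have hP_of_q1 : ∀ X, q * X = X → nproj P * X = X := fun X hX => by
    rw [← hX, ← mul_assoc, hPq]
  have hP_of_q2 : ∀ X, X * q = X → X * nproj P = X := fun X hX => by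
    rw [← hX, mul_assoc, hqP]
  have hPE1 : ∀ X, nproj P * (E * X) = E * X := fun X => by rw [← mul_assoc, hEP1]
  have hPE2 : ∀ X, X * E * nproj P = X * E := fun X => by rw [mul_assoc, hEP2]
  have hUeq : q * T * E = q * (T * nproj P) * (1 - q) := by
    have : nproj P * (1 - q) = E := by rw [mul_sub, mul_one, hPq]
    rw [← this]; noncomm_ring
  have hblock : ∀ X Y, q * X = X → X * q = X → ∀ c : ℝ, 0 ≤ c → ‖X‖ ≤ c → ‖E * Y * E‖ ≤ c →
      ‖X + E * Y * E‖ ≤ c := fun X Y h1 h2 c hc h3 h4 =>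
    norm_add_le_of_blocks hc h1 h2 (by rw [← mul_assoc, ← mul_assoc, hE1])
      (by rw [mul_assoc, hE2]) h3 h4
  refine ⟨{
    diag := D.diag + E * T * E
    approx := D.approx + E * b * E
    upper := D.upper + q * T * E
    lower := D.lower + E * T * q
    eq := ?_
    diag_left := ?_
    diag_right := ?_
    approx_left := ?_
    approx_right := ?_
    upper_left := ?_
    upper_right := ?_
    norm_diag := ?_
    approx_mem := add_mem D.approx_mem (mul_mem (mul_mem hEN hb) hEN)
    norm_sub := ?_
    upper_mem := ?_
    lower_compact := ?_
    cutoff := ?_ }⟩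
  · have h1 : nproj P = q + E := by rw [hE]; abel
    have h2 : nproj P * T * nproj P = q * T * q + E * T * E + q * T * E + E * T * q := by
      rw [h1]; noncomm_ring
    rw [h2, hq, D.eq]; abel
  · rw [mul_add, hP_of_q1 _ D.diag_left, mul_assoc, hPE1]
  · rw [add_mul, hP_of_q2 _ D.diag_right, hPE2]
  · rw [mul_add, hP_of_q1 _ D.approx_left, mul_assoc, hPE1]
  · rw [add_mul, hP_of_q2 _ D.approx_right, hPE2]
  · rw [mul_add, hP_of_q1 _ D.upper_left, ← mul_assoc, ← mul_assoc, hPq]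
  · rw [add_mul, hP_of_q2 _ D.upper_right, hPE2]
  · exact hblock _ _ D.diag_left D.diag_right _ (norm_nonneg _) D.norm_diag (norm_conj_le hEn T)
  · have h1 : D.diag + E * T * E - (D.approx + E * b * E) =
        (D.diag - D.approx) + E * (E * T * E - b) * E := by
      have : E * (E * T * E - b) * E = (E * E) * T * (E * E) - E * b * E := by noncomm_ring
      rw [this, hEE]; abel
    rw [h1]
    exact hblock _ _ (by rw [mul_sub, D.diag_left, D.approx_left])
      (by rw [sub_mul, D.diag_right, D.approx_right]) _ ((norm_nonneg _).trans D.norm_sub)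
      D.norm_sub ((norm_conj_le hEn _).trans hbη)
  · rw [hUeq]
    exact add_mem D.upper_mem (nproj_mul_mul_compl_mem hN hQ _)
  · have h1 : E * T * q = E * ((1 - q) * T * q) := by
      rw [← mul_assoc, ← mul_assoc, hE2]
    rw [h1]
    exact D.lower_compact.add ((hT.corner Q hQ).mul_left E)
  · intro V hV
    obtain ⟨R, hRc, hRs, hR1, hqR, hRq, hRU, hRV⟩ := D.cutoff V hV
    -- Adding the projection onto E V keeps the cut-off block diagonal and makes it agree with the
    -- projection of `P` on all of `V`.
    set W := V.map (E : H →ₗ[ℂ] H) with hW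
    have hWc : IsClosed (W : Set H) := Submodule.closed_of_finiteDimensional W
    set S := nproj W with hS
    have hES : E * S = S := by
      ext v
      obtain ⟨w, -, hw⟩ := Submodule.mem_map.1 (nproj_mem hWc v)
      change E (S v) = S v
      rw [hS, ← hw]
      exact congrArg (fun A : H →L[ℂ] H => A w) hEE
    have hSs : IsSelfAdjoint S := (isStarProjection_nproj W).isSelfAdjoint
    have hSE : S * E = S := by
      have := congrArg star hES
      rwa [star_mul, hSs.star_eq, hEstar.isSelfAdjoint.star_eq] at this
    have hSblock : S = E * S * E := by rw [hES, hSE]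
    have hSq : S * q = 0 := by rw [← hSE, mul_assoc, hEq, mul_zero]
    have hqS : q * S = 0 := by rw [← hES, ← mul_assoc, hqE, zero_mul]
    have hRE : R * E = 0 := by rw [← hRq, mul_assoc, hqE, mul_zero]
    have hER : E * R = 0 := by rw [← hqR, ← mul_assoc, hEq, zero_mul]
    refine ⟨R + S, hRc.add (isCompactOperator_nproj W), hRs.add hSs, ?_, ?_, ?_, ?_, ?_⟩
    · rw [hSblock]
      exact hblock R S hqR hRq 1 zero_le_one hR1 (by rw [← hSblock]; exact norm_nproj_le W)
    · rw [mul_add, hP_of_q1 _ hqR, ← hES, hPE1]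
    · rw [add_mul, hP_of_q2 _ hRq, ← hSE, hPE2]
    -- Block diagonality kills all cross terms but R T S, which maps the new block into Q and is
    -- therefore upper triangular.
    · have h1 : (R + S) * (D.upper + q * T * E) * (R + S) =
          R * D.upper * R + q * (R * T * S) * (1 - q) := by
        have e1 : S * D.upper = 0 := by
          rw [← D.upper_left, ← mul_assoc, ← hq, hSq, zero_mul]
        have e2 : D.upper * S = 0 := by
          rw [← D.upper_right, mul_assoc, ← hq, hqS, mul_zero]
        have e3 : (R + S) * (D.upper + q * T * E) * (R + S) =
            R * D.upper * R + R * (D.upper * S) + (S * D.upper) * (R + S) +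
              (R * q) * T * (E * R) + (R * q) * T * (E * S) + (S * q) * T * E * (R + S) := by
          noncomm_ring
        have e4 : q * (R * T * S) * (1 - q) = (q * R) * T * (S - S * q) := by noncomm_ring
        rw [e3, e4, e1, e2, hRq, hER, hES, hSq, hqR]
        simp
      rw [h1]
      exact add_mem hRU (nproj_mul_mul_compl_mem hN hQ _)
    · intro v hv
      have h1 : S v = E v := by
        conv_lhs => rw [← hSE, mul_apply_eq_comp]
        exact nproj_of_mem (Submodule.mem_map_of_mem hv)
      rw [add_apply, hRV v hv, h1, hE, sub_apply, ← hq]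
      abel

theorem QuasiLocal.blockDecomp (hN : IsNest N) {T : H →L[ℂ] H} (hT : QuasiLocal N T) {η : ℝ}
    (hη : 0 < η) : Nonempty (BlockDecomp N T η ⊤) := by
  refine hN.induction (fun P => Nonempty (BlockDecomp N T η P)) (BlockDecomp.bot N T hη.le) ?_ ?_
  · rintro P hP ⟨D⟩ hPt
    by_cases hs : nestSucc N P = P
    · obtain ⟨_, ⟨R, hR, hlt, rfl⟩, hnear⟩ :=
        hT.near η hη _ (hN.shrinkingFamily_right hP hPt hs)
      exact ⟨R, hR, hlt, D.step hN hT hP hR hlt.le hnear⟩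
    · have hR := hN.succ_mem P
      refine ⟨_, hR, lt_of_le_of_ne (le_nestSucc P) (Ne.symm hs),
        D.step hN hT hP hR (le_nestSucc P) ⟨_, ?_, by rw [sub_self, norm_zero]; exact hη.le⟩⟩
      -- At a gap the diagonal block belongs to the nest algebra: it kills the members below `P`,
      -- and its range lies in every larger member.
      intro M hM x hx
      by_cases hMP : M ≤ P
      · have : (nproj (nestSucc N P) - nproj P) x = 0 := by
          rw [sub_apply, nproj_of_mem (hMP hx), nproj_of_mem (le_nestSucc P (hMP hx)), sub_self]
        rw [mul_apply_eq_comp, this, map_zero]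
        exact M.zero_mem
      · have hlt := hN.lt_of_not_le hM hP hMP
        refine nestSucc_le hM hlt ?_
        exact Submodule.sub_mem _ (nproj_mem (hN.isClosed _ hR) _)
          (le_nestSucc P (nproj_mem (hN.isClosed _ hP) _))
  · intro P hP hP0 hpred hg
    obtain ⟨_, ⟨Q, hQ, hlt, rfl⟩, hnear⟩ := hT.near η hη _ (hN.shrinkingFamily_left hP hP0 hpred)
    obtain ⟨Q', hQ', hQQ', hlt', ⟨D⟩⟩ := hg Q hQ hlt
    have h1 := nproj_sub_mul_of_le hQQ' hlt'.le
    exact D.step hN hT hQ' hP hlt'.le (hnear.mono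
      (sub_mem (nproj_mem_nestAlgebra hN hP) (nproj_mem_nestAlgebra hN hQ'))
      (isStarProjection_nproj_sub hlt'.le).opNorm_le_one h1.1 h1.2)

/-- Taking the lower part itself as k would leave its norm uncontrolled. Instead k = R(T − diag)R,
which is at most 2‖T‖ in norm; its upper contribution R·upper·R stays in the nest algebra, and R
nearly reproduces the compact lower part from both sides. -/
theorem QuasiLocal.exists_approx (hN : IsNest N) {T : H →L[ℂ] H} (hT : QuasiLocal N T) {η : ℝ}
    (hη : 0 < η) : ∃ k a : H →L[ℂ] H, IsCompactOperator k ∧ a ∈ nestAlgebra N ∧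
      ‖k‖ ≤ 2 * ‖T‖ ∧ ‖T - k - a‖ ≤ η := by
  obtain ⟨D⟩ := hT.blockDecomp hN (half_pos hη)
  obtain ⟨V₁, hV₁, hV₁L⟩ := D.lower_compact.exists_finDim (show 0 < η / 8 by linarith)
  set L := D.lower with hL
  -- Fixing V₁ makes (1 − R)L small, and fixing L*V₁ makes L(1 − R) small. The bound η/8 for (1 −
  -- p)L allows for ‖1 − R‖ ≤ 2.
  obtain ⟨R, hRc, hRs, hR1, -, -, hRU, hRV⟩ :=
    D.cutoff (V₁ ⊔ V₁.map (ContinuousLinearMap.adjoint L : H →ₗ[ℂ] H)) inferInstance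
  have hTeq : T = D.diag + D.upper + L := by simpa [nproj_top] using D.eq
  set p := nproj V₁ with hp
  have hV₁c : IsClosed (V₁ : Set H) := Submodule.closed_of_finiteDimensional V₁
  have hRp : (1 - R) * p = 0 := by
    ext v
    have := hRV _ (Submodule.mem_sup_left (nproj_mem hV₁c v))
    simp [this, nproj_top, hp]
  have hpLR : p * L * (1 - R) = 0 := by
    have h1 : (1 - R) * (star L * p) = 0 := by
      ext v
      have := hRV _ (Submodule.mem_sup_right (Submodule.mem_map_of_mem
        (f := (ContinuousLinearMap.adjoint L : H →ₗ[ℂ] H)) (nproj_mem hV₁c v)))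
      rw [nproj_top] at this
      change (1 - R) (star L (p v)) = 0
      rw [sub_apply, one_apply_eq_self, sub_eq_zero]
      exact this.symm
    have h2 := congrArg star h1
    rwa [star_mul, star_mul, star_star, (isStarProjection_nproj V₁).isSelfAdjoint.star_eq,
      star_sub, star_one, hRs.star_eq, star_zero] at h2
  have h1R : ‖1 - R‖ ≤ 2 := by
    have := norm_sub_le (1 : H →L[ℂ] H) R
    have h1 : ‖(1 : H →L[ℂ] H)‖ ≤ 1 := ContinuousLinearMap.norm_id_le
    linarith
  have hle : ‖(1 - R) * L‖ ≤ η / 4 := by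
    have h1 : (1 - R) * L = (1 - R) * ((1 - p) * L) := by
      have : (1 - R) * ((1 - p) * L) = (1 - R) * L - ((1 - R) * p) * L := by noncomm_ring
      rw [this, hRp, zero_mul, sub_zero]
    rw [h1]
    refine (norm_mul_le _ _).trans ?_
    have := mul_le_mul h1R hV₁L (norm_nonneg _) zero_le_two
    linarith
  have hle' : ‖L * (1 - R)‖ ≤ η / 4 := by
    have h1 : L * (1 - R) = ((1 - p) * L) * (1 - R) := by
      have : ((1 - p) * L) * (1 - R) = L * (1 - R) - p * L * (1 - R) := by noncomm_ring
      rw [this, hpLR, sub_zero]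
    rw [h1]
    refine (norm_mul_le _ _).trans ?_
    have := mul_le_mul hV₁L h1R (norm_nonneg _) (by linarith)
    linarith
  refine ⟨R * (T - D.diag) * R, D.approx + D.upper - R * D.upper * R,
    (hRc.mul_right _).mul_right _, sub_mem (add_mem D.approx_mem D.upper_mem) hRU, ?_, ?_⟩
  · refine (norm_conj_le hR1 _).trans ((norm_sub_le _ _).trans ?_)
    linarith [D.norm_diag]
  · have h1 : T - R * (T - D.diag) * R - (D.approx + D.upper - R * D.upper * R) =
        (D.diag - D.approx) + ((1 - R) * L + R * (L * (1 - R))) := by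
      have h2 : T - D.diag = D.upper + L := sub_eq_iff_eq_add.2 (hTeq.trans (by abel))
      rw [h2]
      refine (congrArg (fun X => X - R * (D.upper + L) * R -
        (D.approx + D.upper - R * D.upper * R)) hTeq).trans ?_
      noncomm_ring
    have h3 : ‖R * (L * (1 - R))‖ ≤ η / 4 :=
      (norm_mul_le _ _).trans ((mul_le_of_le_one_left (norm_nonneg _) hR1).trans hle')
    rw [h1]
    refine (norm_add_le _ _).trans ((add_le_add D.norm_sub
      ((norm_add_le _ _).trans (add_le_add hle h3))).trans ?_)
    linarith

/-- Apply `QuasiLocal.exists_approx` repeatedly to the remainder. The compact corrections are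
bounded by twice the previous remainder, so they converge in norm, and hence so do the nest parts.
-/
theorem QuasiLocal.mem (hN : IsNest N) {T : H →L[ℂ] H} (hT : QuasiLocal N T) :
    T ∈ quasiTriangularAlgebra N := by
  have hstep : ∀ (n : ℕ) (p : {p : (H →L[ℂ] H) × (H →L[ℂ] H) //
      IsCompactOperator p.1 ∧ p.2 ∈ nestAlgebra N}),
      ∃ q : {p : (H →L[ℂ] H) × (H →L[ℂ] H) // IsCompactOperator p.1 ∧ p.2 ∈ nestAlgebra N},
        ‖T - q.1.1 - q.1.2‖ ≤ (1 / 2) ^ n ∧ ‖q.1.1 - p.1.1‖ ≤ 2 * ‖T - p.1.1 - p.1.2‖ := by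
    rintro n ⟨⟨K, A⟩, hK, hA⟩
    obtain ⟨k, a, hk, ha, hkn, hn⟩ := (hT.sub hN hK hA).exists_approx hN
      (show (0 : ℝ) < (1 / 2) ^ n by positivity)
    refine ⟨⟨(K + k, A + a), hK.add hk, add_mem hA ha⟩, ?_, ?_⟩
    · convert hn using 2
      simp only
      abel
    · simpa using hkn
  choose f hf1 hf2 using hstep
  let s : ℕ → {p : (H →L[ℂ] H) × (H →L[ℂ] H) // IsCompactOperator p.1 ∧ p.2 ∈ nestAlgebra N} :=
    fun n => Nat.rec ⟨(0, 0), isCompactOperator_zero, zero_mem _⟩ (fun n p => f n p) n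
  have hs1 : ∀ n, ‖T - (s (n + 1)).1.1 - (s (n + 1)).1.2‖ ≤ (1 / 2) ^ n := fun n => hf1 n (s n)
  have hs2 : ∀ n, ‖(s (n + 2)).1.1 - (s (n + 1)).1.1‖ ≤ 2 * (1 / 2) ^ n := fun n =>
    (hf2 (n + 1) (s (n + 1))).trans (by linarith [hs1 n])
  -- The index is shifted because the remainder of the initial pair (0, 0) is T itself, with no
  -- geometric bound.
  have hcau : CauchySeq fun n => (s (n + 1)).1.1 :=
    cauchySeq_of_le_geometric (1 / 2) 2 (by norm_num) fun n => by
      rw [dist_eq_norm, norm_sub_rev]; exact hs2 n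
  obtain ⟨K, hK⟩ := cauchySeq_tendsto_of_complete hcau
  have hKc : IsCompactOperator K :=
    isClosed_setOfPred_isCompactOperator.mem_of_tendsto hK
      (Eventually.of_forall fun n => (s (n + 1)).2.1)
  have h0 : Tendsto (fun n => T - (s (n + 1)).1.1 - (s (n + 1)).1.2) atTop (𝓝 0) :=
    squeeze_zero_norm hs1 (tendsto_pow_atTop_nhds_zero_of_lt_one (by norm_num) (by norm_num))
  have hA : Tendsto (fun n => (s (n + 1)).1.2) atTop (𝓝 (T - K)) := by
    have := ((tendsto_const_nhds (x := T)).sub hK).sub h0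
    simpa using this
  refine ⟨T - K, (isClosed_nestAlgebra hN).mem_of_tendsto hA
    (Eventually.of_forall fun n => (s (n + 1)).2.2), K, hKc, by abel⟩

theorem quasiLocal_of_mem_nestAlgebra (hN : IsNest N) {a : H →L[ℂ] H} (ha : a ∈ nestAlgebra N) :
    QuasiLocal N a where
  corner P hP := by
    rw [sub_mul, sub_mul, nproj_mul_mul_nproj hN ha hP, one_mul, sub_self]
    exact isCompactOperator_zero
  near η hη 𝓕 h𝓕 := by
    obtain ⟨F, hF⟩ := h𝓕.nonempty
    have hFN := h𝓕.mem hN hF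
    exact ⟨F, hF, _, mul_mem (mul_mem hFN ha) hFN, by rw [sub_self, norm_zero]; exact hη.le⟩

theorem quasiLocal_of_mem (hN : IsNest N) {T : H →L[ℂ] H} (hT : T ∈ quasiTriangularAlgebra N) :
    QuasiLocal N T := by
  obtain ⟨a, ha, k, hk, rfl⟩ := hT
  have := (quasiLocal_of_mem_nestAlgebra hN ha).sub hN (k := -k) (a := 0) hk.neg (zero_mem _)
  simpa using this

/-- Both conditions of `QuasiLocal` pass to norm limits: compact operators are norm closed, and
compressions by `F` are contractive. -/
theorem isClosed_quasiTriangularAlgebra (hN : IsNest N) :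
    IsClosed (quasiTriangularAlgebra N : Set (H →L[ℂ] H)) := by
  refine isClosed_of_closure_subset fun T hT => QuasiLocal.mem hN ⟨fun P hP => ?_, ?_⟩
  · have hcl : IsClosed {S : H →L[ℂ] H |
        IsCompactOperator ((1 - nproj P) * S * nproj P : H →L[ℂ] H)} :=
      isClosed_setOfPred_isCompactOperator.preimage
        (f := fun S : H →L[ℂ] H => (1 - nproj P) * S * nproj P) (by fun_prop)
    exact closure_minimal (fun S hS => (quasiLocal_of_mem hN hS).corner P hP) hcl hT
  · intro η hη 𝓕 h𝓕
    obtain ⟨S, hS, hTS⟩ := Metric.mem_closure_iff.1 hT (η / 2) (half_pos hη)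
    obtain ⟨F, hF, a, ha, hFa⟩ := (quasiLocal_of_mem hN hS).near (η / 2) (half_pos hη) 𝓕 h𝓕
    refine ⟨F, hF, a, ha, ?_⟩
    have h1 : F * T * F - a = F * (T - S) * F + (F * S * F - a) := by noncomm_ring
    rw [dist_eq_norm] at hTS
    have h2 := norm_conj_le (h𝓕.isStarProjection hF).opNorm_le_one (T - S)
    rw [h1]
    exact (norm_add_le _ _).trans (by linarith)

end QuasiTriangular

/-! ### Commutators and distance to the nest algebra -/

section Commutators

set_option linter.unusedSectionVars false

variable {H : Type*} [NormedAddCommGroup H] [InnerProductSpace ℂ H] [CompleteSpace H]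

variable {N : Set (Submodule ℂ H)}

/-- `g` is a unitary operator with inverse `g'`, both commuting with the projections of `N`. -/
structure NestUnitary (N : Set (Submodule ℂ H)) (g g' : H →L[ℂ] H) : Prop where
  mul_inv : g * g' = 1
  norm_le : ‖g‖ ≤ 1
  norm_inv_le : ‖g'‖ ≤ 1
  commute : ∀ M ∈ N, Commute g (nproj M)
  commute_inv : ∀ M ∈ N, Commute g' (nproj M)

theorem norm_mul_mul_le {A B C : H →L[ℂ] H} (hA : ‖A‖ ≤ 1) (hC : ‖C‖ ≤ 1) :
    ‖A * B * C‖ ≤ ‖B‖ := by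
  have h1 := norm_mul_le (A * B) C
  have h2 := norm_mul_le A B
  have h3 : ‖A * B‖ * ‖C‖ ≤ ‖A * B‖ := mul_le_of_le_one_right (norm_nonneg _) hC
  have h4 : ‖A‖ * ‖B‖ ≤ ‖B‖ := mul_le_of_le_one_left (norm_nonneg _) hA
  linarith

theorem NestUnitary.one : NestUnitary N (1 : H →L[ℂ] H) 1 where
  mul_inv := one_mul 1
  norm_le := ContinuousLinearMap.norm_id_le
  norm_inv_le := ContinuousLinearMap.norm_id_le
  commute _ _ := Commute.one_left _
  commute_inv _ _ := Commute.one_left _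

theorem NestUnitary.mul {g g' h h' : H →L[ℂ] H} (hg : NestUnitary N g g')
    (hh : NestUnitary N h h') : NestUnitary N (g * h) (h' * g') where
  mul_inv := by
    rw [mul_assoc, ← mul_assoc h, hh.mul_inv, one_mul, hg.mul_inv]
  norm_le := (norm_mul_le _ _).trans (mul_le_one₀ hg.norm_le (norm_nonneg _) hh.norm_le)
  norm_inv_le := (norm_mul_le _ _).trans (mul_le_one₀ hh.norm_inv_le (norm_nonneg _) hg.norm_inv_le)
  commute M hM := (hg.commute M hM).mul_left (hh.commute M hM)
  commute_inv M hM := (hh.commute_inv M hM).mul_left (hg.commute_inv M hM)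

theorem NestUnitary.reflection (hN : IsNest N) {M : Submodule ℂ H} (hM : M ∈ N) :
    NestUnitary N (2 * nproj M - 1) (2 * nproj M - 1) := by
  have h1 : (2 * nproj M - 1) * (2 * nproj M - 1) = 1 := by
    have : (2 * nproj M - 1) * (2 * nproj M - 1) =
      4 * (nproj M * nproj M) - 4 * nproj M + 1 := by noncomm_ring
    rw [this, nproj_mul_self, sub_self, zero_add]
  have h2 : star (2 * nproj M - 1) = 2 * nproj M - 1 := by
    have : (2 : H →L[ℂ] H) * nproj M = nproj M + nproj M := two_mul _
    rw [this, star_sub, star_add, star_one, (isStarProjection_nproj M).isSelfAdjoint.star_eq]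
  have h3 : ‖2 * nproj M - 1‖ ≤ 1 := by
    have h4 := CStarRing.norm_star_mul_self (x := 2 * nproj M - 1)
    rw [h2, h1] at h4
    have h5 : ‖(1 : H →L[ℂ] H)‖ ≤ 1 := ContinuousLinearMap.norm_id_le
    nlinarith [norm_nonneg (2 * nproj M - 1)]
  have h4 : ∀ M' ∈ N, Commute (2 * nproj M - 1) (nproj M') := fun M' hM' => by
    have : (2 : H →L[ℂ] H) * nproj M = nproj M + nproj M := two_mul _
    rw [this]
    exact ((nproj_commute hN hM hM').add_left (nproj_commute hN hM hM')).sub_left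
      (Commute.one_left _)
  exact ⟨h1, h3, h3, h4, h4⟩

theorem NestUnitary.mem (hN : IsNest N) {g g' : H →L[ℂ] H} (hg : NestUnitary N g g') :
    g ∈ nestAlgebra N := mem_nestAlgebra_of_commute hN fun M hM => (hg.commute M hM)

theorem NestUnitary.inv_mem (hN : IsNest N) {g g' : H →L[ℂ] H} (hg : NestUnitary N g g') :
    g' ∈ nestAlgebra N := mem_nestAlgebra_of_commute hN fun M hM => (hg.commute_inv M hM)

/-- To make Y commute with one more projection P, replace it by the mean of Y and its conjugate by
2P − 1, that is, by PYP + (1 − P)Y(1 − P). Keeping the estimate for all conjugates gYg' lets the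
induction average the estimates for g and g(2P − 1). -/
theorem exists_average (hN : IsNest N) {X : H →L[ℂ] H} {η : ℝ}
    (h : ∀ g g', NestUnitary N g g' → ∃ a ∈ nestAlgebra N, ‖X * g - g * X - a‖ ≤ η)
    (s : Finset N) : ∃ Y : H →L[ℂ] H, ‖Y‖ ≤ ‖X‖ ∧ (∀ M ∈ s, Commute Y (nproj M.1)) ∧
      ∀ g g', NestUnitary N g g' → ∃ a ∈ nestAlgebra N, ‖X - g * Y * g' - a‖ ≤ η := by
  classical
  induction s using Finset.induction_on with
  | empty =>
    refine ⟨X, le_rfl, by simp, fun g g' hg => ?_⟩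
    obtain ⟨a, ha, hη⟩ := h g g' hg
    refine ⟨a * g', mul_mem ha (hg.inv_mem hN), ?_⟩
    have h1 : X - g * X * g' - a * g' = 1 * (X * g - g * X - a) * g' := by
      have : 1 * (X * g - g * X - a) * g' = X * (g * g') - g * X * g' - a * g' := by noncomm_ring
      rw [this, hg.mul_inv, mul_one]
    rw [h1]
    exact (norm_mul_mul_le ContinuousLinearMap.norm_id_le hg.norm_inv_le).trans hη
  | insert M s _ ih =>
    obtain ⟨Y, hYX, hYs, hY⟩ := ih
    set P := nproj M.1 with hP
    have hPP : P * P = P := nproj_mul_self M.1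
    have hh := NestUnitary.reflection hN M.2
    rw [← hP] at hh
    set Z := P * Y * P + (1 - P) * Y * (1 - P) with hZ
    have hZ2 : Z = (1 / 2 : ℂ) • (Y + (2 * P - 1) * Y * (2 * P - 1)) := by
      have : Y + (2 * P - 1) * Y * (2 * P - 1) = (2 : ℂ) • Z := by
        rw [hZ, two_smul]; noncomm_ring
      rw [this, smul_smul]; norm_num
    refine ⟨Z, ?_, fun M' hM' => ?_, fun g g' hg => ?_⟩
    · rw [hZ2, norm_smul]
      have h1 := norm_mul_mul_le (B := Y) hh.norm_le hh.norm_le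
      have h2 := norm_add_le Y ((2 * P - 1) * Y * (2 * P - 1))
      have : ‖(1 / 2 : ℂ)‖ = 1 / 2 := by norm_num
      rw [this]
      linarith
    · rcases Finset.mem_insert.1 hM' with rfl | hM'
      · have h1 : P * Z = P * Y * P := by
          have : P * Z = (P * P) * Y * P + (P - P * P) * Y * (1 - P) := by rw [hZ]; noncomm_ring
          rw [this, hPP, sub_self, zero_mul, zero_mul, add_zero]
        have h2 : Z * P = P * Y * P := by
          have : Z * P = P * Y * (P * P) + (1 - P) * Y * (P - P * P) := by rw [hZ]; noncomm_ring
          rw [this, hPP, sub_self, mul_zero, add_zero]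
        exact h2.trans h1.symm
      · have hc := nproj_commute hN M.2 M'.2
        have hc' := (Commute.one_left (nproj M'.1)).sub_left hc
        exact ((hc.mul_left (hYs M' hM')).mul_left hc).add_left
          ((hc'.mul_left (hYs M' hM')).mul_left hc')
    · obtain ⟨a, ha, haη⟩ := hY g g' hg
      obtain ⟨b, hb, hbη⟩ := hY _ _ (hg.mul hh)
      refine ⟨(1 / 2 : ℂ) • (a + b), Subalgebra.smul_mem _ (add_mem ha hb) _, ?_⟩
      have h1 : X - g * Z * g' - (1 / 2 : ℂ) • (a + b) = (1 / 2 : ℂ) • ((X - g * Y * g' - a) +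
          (X - g * (2 * P - 1) * Y * ((2 * P - 1) * g') - b)) := by
        have h2 : g * Z * g' = (1 / 2 : ℂ) •
            (g * Y * g' + g * (2 * P - 1) * Y * ((2 * P - 1) * g')) := by
          rw [hZ2, mul_smul_comm, smul_mul_assoc]; congr 1; noncomm_ring
        have h3 : X = (1 / 2 : ℂ) • (X + X) := by rw [← two_smul ℂ X, smul_smul]; norm_num
        rw [h2]
        nth_rewrite 1 [h3]
        rw [← smul_sub, ← smul_sub]
        congr 1
        abel
      rw [h1, norm_smul]
      have h2 := norm_add_le (X - g * Y * g' - a)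
        (X - g * (2 * P - 1) * Y * ((2 * P - 1) * g') - b)
      have : ‖(1 / 2 : ℂ)‖ = 1 / 2 := by norm_num
      rw [this]
      linarith

/-- An operator whose commutators with the symmetries of the nest are close to the nest algebra is
itself close to the nest algebra. -/
theorem near_nestAlgebra_of_commutators (hN : IsNest N) {X : H →L[ℂ] H} {η : ℝ} (hη : 0 ≤ η)
    (h : ∀ g g', NestUnitary N g g' → ∃ a ∈ nestAlgebra N, ‖X * g - g * X - a‖ ≤ η) :
    ∃ a ∈ nestAlgebra N, ‖X - a‖ ≤ η := by
  classical
  choose Y hYX hYc hY using exists_average hN h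
  choose a ha haη using fun s => hY s 1 1 NestUnitary.one
  simp only [one_mul, mul_one] at haη
  have hane : ∀ s, ‖a s‖ ≤ η + (‖X‖ + ‖X‖) := fun s => by
    have h1 : a s = (X - Y s) - (X - Y s - a s) := by abel
    have h2 := norm_sub_le (X - Y s) (X - Y s - a s)
    rw [← h1] at h2
    linarith [norm_sub_le X (Y s), hYX s, haη s]
  let U : Ultrafilter (Finset N) := Ultrafilter.of atTop
  obtain ⟨Z, -, hZ⟩ := exists_weakTendsto_ultrafilter U hYX
  obtain ⟨b, -, hb⟩ := exists_weakTendsto_ultrafilter U hane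
  -- A weak limit over growing finite sets of projections commutes with every projection of the
  -- nest. So X is within η of Z plus a weak limit of nest elements.
  have hZN : Z ∈ nestAlgebra N := mem_nestAlgebra_of_commute hN fun M hM => by
    have h1 : ∀ᶠ s in (U : Filter (Finset N)), Y s * nproj M - nproj M * Y s = 0 := by
      refine Ultrafilter.of_le atTop ?_
      filter_upwards [eventually_ge_atTop ({⟨M, hM⟩} : Finset N)] with s hs
      rw [sub_eq_zero]
      exact hYc s ⟨M, hM⟩ (hs (Finset.mem_singleton_self _))
    exact sub_eq_zero.1 (((hZ.mul_right (nproj M)).sub (hZ.mul_left (nproj M))).eq_of_eventually h1)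
  refine ⟨Z + b, add_mem hZN (hb.mem_nestAlgebra hN ha), ?_⟩
  rw [← sub_sub]
  exact (((WeakTendsto.const X).sub hZ).sub hb).norm_le hη (Eventually.of_forall haη)

/-- If compressions by F − F' were within η of the nest algebra for all small F', then F' → 0
strongly would pass this to F Z F: the norm is weakly lower semicontinuous and the nest algebra
weakly closed. -/
theorem ShrinkingFamily.exists_cutoff (hN : IsNest N) {𝓕 : Set (H →L[ℂ] H)}
    (h𝓕 : ShrinkingFamily N 𝓕) {F Z : H →L[ℂ] H} (hF : F ∈ 𝓕) {η : ℝ} (hη : 0 ≤ η)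
    (h : ∀ a ∈ nestAlgebra N, η < ‖F * Z * F - a‖) :
    ∃ F' ∈ 𝓕, F * F' = F' ∧ F' * F = F' ∧
      ∀ a ∈ nestAlgebra N, η < ‖(F - F') * Z * (F - F') - a‖ := by
  by_contra! hcon
  have hsm : ∀ i : Finset H × ℕ, ∃ F' ∈ 𝓕, F * F' = F' ∧ F' * F = F' ∧
      ∀ v ∈ i.1, ‖F' v‖ ≤ 1 / ((i.2 : ℝ) + 1) := fun i =>
    h𝓕.small F hF i.1 _ (by positivity)
  choose F' hF' h1 h2 h3 using hsm
  choose a ha haη using fun i => hcon (F' i) (hF' i) (h1 i) (h2 i)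
  classical
  have hF1 := (h𝓕.isStarProjection hF).opNorm_le_one
  have hF'1 := fun i => (h𝓕.isStarProjection (hF' i)).opNorm_le_one
  have h0 : ∀ v, Tendsto (fun i => F' i v) atTop (𝓝 0) := by
    intro v
    have ht : Tendsto (fun i : Finset H × ℕ => 1 / ((i.2 : ℝ) + 1)) atTop (𝓝 0) :=
      tendsto_one_div_add_atTop_nhds_zero_nat.comp
        (by rw [← prod_atTop_atTop_eq]; exact tendsto_snd)
    refine squeeze_zero_norm' ?_ ht
    filter_upwards [eventually_ge_atTop (({v}, 0) : Finset H × ℕ)] with i hi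
    exact h3 i v (hi.1 (Finset.mem_singleton_self v))
  have hlim : ∀ y, Tendsto (fun i => ((F - F' i) * Z * (F - F' i)) y) atTop
      (𝓝 ((F * Z * F) y)) := by
    intro y
    have e1 : Tendsto (fun i => F (Z (F' i y))) atTop (𝓝 0) := by
      have := ((F * Z).continuous.tendsto 0).comp (h0 y)
      simpa [Function.comp_def] using this
    have e2 := h0 (Z (F y))
    have e3 : Tendsto (fun i => F' i (Z (F' i y))) atTop (𝓝 0) := by
      have e4 : Tendsto (fun i => Z (F' i y)) atTop (𝓝 0) := by
        have := (Z.continuous.tendsto 0).comp (h0 y)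
        simpa [Function.comp_def] using this
      refine squeeze_zero_norm (fun i => ?_) (tendsto_zero_iff_norm_tendsto_zero.1 e4)
      simpa using (F' i).le_of_opNorm_le (hF'1 i) (Z (F' i y))
    have e5 := (((tendsto_const_nhds (x := F (Z (F y)))).sub e1).sub e2).add e3
    simp only [sub_zero, add_zero] at e5
    refine e5.congr fun i => ?_
    simp only [mul_apply_eq_comp, sub_apply, map_sub]
    abel
  let U : Ultrafilter (Finset H × ℕ) := Ultrafilter.of atTop
  have hE : ∀ i, ‖(F - F' i) * Z * (F - F' i)‖ ≤ 2 * ‖Z‖ * 2 := fun i => by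
    have e1 : ‖F - F' i‖ ≤ 2 := (norm_sub_le _ _).trans (by linarith [hF'1 i])
    refine (norm_mul_le _ _).trans (mul_le_mul ((norm_mul_le _ _).trans ?_) e1 (norm_nonneg _)
      (by positivity))
    exact mul_le_mul_of_nonneg_right e1 (norm_nonneg _)
  have hane : ∀ i, ‖a i‖ ≤ 2 * ‖Z‖ * 2 + η := fun i => by
    have e1 := norm_sub_le ((F - F' i) * Z * (F - F' i)) ((F - F' i) * Z * (F - F' i) - a i)
    rw [sub_sub_cancel] at e1
    linarith [hE i, haη i]
  obtain ⟨b, -, hb⟩ := exists_weakTendsto_ultrafilter U hane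
  have hZ : WeakTendsto (fun i => (F - F' i) * Z * (F - F' i)) U (F * Z * F) :=
    weakTendsto_of_tendsto fun y => (hlim y).mono_left (Ultrafilter.of_le atTop)
  exact (h b (hb.mem_nestAlgebra hN ha)).not_ge
    ((hZ.sub hb).norm_le hη (Eventually.of_forall haη))

theorem mul_eq_of_chain {F : ℕ → H →L[ℂ] H} (hF : ∀ k, F k * F k = F k)
    (h1 : ∀ k, F k * F (k + 1) = F (k + 1)) (h2 : ∀ k, F (k + 1) * F k = F (k + 1)) {j k : ℕ}
    (hjk : j ≤ k) : F j * F k = F k ∧ F k * F j = F k := by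
  induction k, hjk using Nat.le_induction with
  | base => exact ⟨hF j, hF j⟩
  | succ k hk ih =>
    constructor
    · rw [← h1 k, ← mul_assoc, ih.1]
    · rw [← h2 k, mul_assoc, ih.2]

theorem orthoProjs_sub_of_chain {F : ℕ → H →L[ℂ] H} (hF : ∀ k, IsStarProjection (F k))
    (h1 : ∀ k, F k * F (k + 1) = F (k + 1)) (h2 : ∀ k, F (k + 1) * F k = F (k + 1)) :
    OrthoProjs fun k => F k - F (k + 1) := by
  have hm := fun {j k : ℕ} (hjk : j ≤ k) =>
    mul_eq_of_chain (fun k => (hF k).isIdempotentElem.eq) h1 h2 hjk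
  refine ⟨fun k => ⟨?_, (hF k).isSelfAdjoint.sub (hF (k + 1)).isSelfAdjoint⟩, fun j k hjk => ?_⟩
  · change (F k - F (k + 1)) * (F k - F (k + 1)) = _
    rw [sub_mul, mul_sub, mul_sub, (hm le_rfl).1, (hm le_rfl).1, h1, h2]
    abel
  · rcases hjk.lt_or_gt with h | h
    · rw [sub_mul, mul_sub, mul_sub, (hm h.le).1, (hm (h.le.trans k.le_succ)).1, (hm h).1,
        (hm (Nat.le_succ_of_le h)).1, sub_self]
    · rw [sub_mul, mul_sub, mul_sub, (hm h.le).2, (hm (h.le.trans j.le_succ)).2, (hm h).2,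
        (hm (Nat.le_succ_of_le h)).2]
      abel

/-- Let A be the sum of the E_k g_k, an element of the nest algebra. The k-th diagonal block of dA −
Ad is E_k(d g_k − g_k d)E_k. As dA − Ad is a nest element plus a compact κ and E_k κ → 0 in norm,
these blocks approach the nest algebra. -/
theorem OrthoProjs.not_forall_commutator_far (hN : IsNest N) {d : H →L[ℂ] H}
    (hd : ∀ A ∈ nestAlgebra N, d * A - A * d ∈ quasiTriangularAlgebra N) {E : ℕ → H →L[ℂ] H}
    (hE : OrthoProjs E) (hEN : ∀ k, E k ∈ nestAlgebra N) {g : ℕ → H →L[ℂ] H}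
    (hgN : ∀ k, g k ∈ nestAlgebra N) (hg1 : ∀ k, ‖g k‖ ≤ 1) (hc : ∀ k, Commute (g k) (E k))
    {η : ℝ} (hη : 0 < η) :
    ¬ ∀ k, ∀ a ∈ nestAlgebra N, η < ‖E k * (d * g k - g k * d) * E k - a‖ := by
  intro hfar
  have hEE : ∀ k, E k * E k = E k := fun k => (hE.isStarProjection k).isIdempotentElem.eq
  have hE1 : ∀ k, ‖E k‖ ≤ 1 := fun k => (hE.isStarProjection k).opNorm_le_one
  obtain ⟨A, -, hEA, hAE, hAN⟩ := hE.exists_sum hE (G := fun k => E k * g k)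
    (fun k => by rw [← mul_assoc, hEE])
    (fun k => by rw [mul_assoc, (hc k).eq, ← mul_assoc, hEE])
    (fun k => (norm_mul_le _ _).trans (mul_le_one₀ (hE1 k) (norm_nonneg _) (hg1 k)))
  obtain ⟨a, ha, κ, hκ, heq⟩ := hd A (hAN N hN fun k => mul_mem (hEN k) (hgN k))
  obtain ⟨k, hk⟩ := (hE.tendsto_mul_compact hκ hη).exists
  refine (hfar k _ (mul_mem (mul_mem (hEN k) ha) (hEN k))).not_ge (le_trans (le_of_eq ?_)
    (((norm_mul_le _ _).trans (mul_le_of_le_one_right (norm_nonneg _) (hE1 k))).trans hk))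
  congr 1
  rw [sub_eq_iff_eq_add']
  calc E k * (d * g k - g k * d) * E k
      = E k * d * (g k * E k) - (E k * g k) * d * E k := by noncomm_ring
    _ = E k * d * (A * E k) - (E k * A) * d * E k := by rw [hAE, hEA, (hc k).eq]
    _ = E k * (d * A - A * d) * E k := by noncomm_ring
    _ = _ := by rw [heq]; noncomm_ring

/-- If the commutators of `d` with the nest algebra are quasi-triangular, `d` is quasi-local. -/
theorem quasiLocal_of_commutators (hN : IsNest N) {d : H →L[ℂ] H}
    (hd : ∀ A ∈ nestAlgebra N, d * A - A * d ∈ quasiTriangularAlgebra N) : QuasiLocal N d where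
  corner P hP := by
    have h1 := (quasiLocal_of_mem hN (hd _ (nproj_mem_nestAlgebra hN hP))).corner P hP
    have h2 : (1 - nproj P) * (d * nproj P - nproj P * d) * nproj P =
        (1 - nproj P) * d * (nproj P * nproj P) - (nproj P - nproj P * nproj P) * d * nproj P := by
      noncomm_ring
    rwa [h2, nproj_mul_self, sub_self, zero_mul, zero_mul, sub_zero] at h1
  near η hη 𝓕 h𝓕 := by
    by_contra! hcon
    -- A compression FdF far from the nest algebra has a far commutator with some symmetry g, and
    -- this persists on F − F' for some smaller F'. Iterating yields orthogonal intervals E_k = F_k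
    -- − F_{k+1} with far commutators.
    have hstep : ∀ F : 𝓕, ∃ F' : 𝓕, ∃ g ∈ nestAlgebra N, ‖g‖ ≤ 1 ∧ F.1 * F'.1 = F'.1 ∧
        F'.1 * F.1 = F'.1 ∧ Commute g (F.1 - F'.1) ∧ ∀ a ∈ nestAlgebra N,
          η < ‖(F.1 - F'.1) * (d * g - g * d) * (F.1 - F'.1) - a‖ := by
      rintro ⟨F, hF⟩
      obtain ⟨g, g', hg, hgη⟩ : ∃ g g', NestUnitary N g g' ∧ ∀ a ∈ nestAlgebra N,
          η < ‖F * d * F * g - g * (F * d * F) - a‖ := by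
        by_contra! h
        exact hcon F hF (near_nestAlgebra_of_commutators hN hη.le h)
      have hcomm : ∀ E ∈ 𝓕, Commute g E := fun E hE => by
        obtain ⟨Q, hQ, P, hP, -, rfl⟩ := h𝓕.interval E hE
        exact (hg.commute P hP).sub_right (hg.commute Q hQ)
      have h1 : F * d * F * g - g * (F * d * F) = F * (d * g - g * d) * F := by
        have e := (hcomm F hF).eq
        calc F * d * F * g - g * (F * d * F) = F * d * (F * g) - (g * F) * d * F := by noncomm_ring
          _ = F * d * (g * F) - (F * g) * d * F := by rw [e]
          _ = _ := by noncomm_ring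
      rw [h1] at hgη
      obtain ⟨F', hF', h2, h3, h4⟩ := h𝓕.exists_cutoff hN hF hη.le hgη
      exact ⟨⟨F', hF'⟩, g, hg.mem hN, hg.norm_le, h2, h3,
        (hcomm F hF).sub_right (hcomm F' hF'), h4⟩
    choose f g hgN hg1 hf1 hf2 hgc hgη using hstep
    obtain ⟨F₀, hF₀⟩ := h𝓕.nonempty
    let s : ℕ → 𝓕 := fun n => Nat.rec ⟨F₀, hF₀⟩ (fun _ F => f F) n
    have hE : OrthoProjs fun k => (s k).1 - (s (k + 1)).1 :=
      orthoProjs_sub_of_chain (fun k => h𝓕.isStarProjection (s k).2)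
        (fun k => hf1 (s k)) (fun k => hf2 (s k))
    exact hE.not_forall_commutator_far hN hd
      (fun k => sub_mem (h𝓕.mem hN (s k).2) (h𝓕.mem hN (s (k + 1)).2))
      (fun k => hgN (s k)) (fun k => hg1 (s k)) (fun k => hgc (s k)) hη fun k => hgη (s k)

end Commutators

/-! ### Bounded derivations are inner -/

section Derivations

set_option linter.unusedSectionVars false

variable {H : Type*} [NormedAddCommGroup H] [InnerProductSpace ℂ H] [CompleteSpace H]

variable {N : Set (Submodule ℂ H)} {B : Subalgebra ℂ (H →L[ℂ] H)}

theorem nestAlgebra_le_quasiTriangularAlgebra :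
    nestAlgebra N ≤ quasiTriangularAlgebra N := fun T hT =>
  ⟨T, hT, 0, isCompactOperator_zero, (add_zero T).symm⟩

theorem rankOne_mem_quasiTriangularAlgebra (x e : H) :
    rankOne ℂ x e ∈ quasiTriangularAlgebra N :=
  ⟨0, zero_mem _, _, isCompactOperator_rankOne x e, (zero_add _).symm⟩

/-- A bounded derivation is implemented by a bounded operator on a subspace `L` such that all
rank one operators `x ⊗ e` with `x ∈ L` belong to the algebra. -/
theorem exists_implementer_on {δ : B →L[ℂ] (H →L[ℂ] H)}
    (hδ : ∀ a b : B, δ (a * b) = δ a * b + a * δ b) {L : Submodule ℂ H}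
    (hL : IsClosed (L : Set H)) {e : H} (he : ‖e‖ = 1) (heB : ∀ x ∈ L, rankOne ℂ x e ∈ B) :
    ∃ d : H →L[ℂ] H, ‖d‖ ≤ ‖δ‖ ∧
      ∀ (A : B), ∀ x ∈ L, A.1 x ∈ L → δ A x = d (A.1 x) - A.1 (d x) := by
  have hmem : ∀ x, nproj L x ∈ L := nproj_mem hL
  let r : H → B := fun x => ⟨rankOne ℂ (nproj L x) e, heB _ (hmem x)⟩
  have hb : ∀ x, ‖δ (r x) e‖ ≤ ‖δ‖ * ‖x‖ := fun x => by
    have h1 : ‖δ (r x)‖ ≤ ‖δ‖ * ‖x‖ := by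
      refine (δ.le_opNorm _).trans (mul_le_mul_of_nonneg_left ?_ (norm_nonneg _))
      change ‖rankOne ℂ (nproj L x) e‖ ≤ _
      rw [norm_rankOne, he, mul_one]
      exact norm_nproj_apply_le L x
    simpa [he] using (δ (r x)).le_of_opNorm_le h1 e
  -- On `L` this is dx = δ(x ⊗ e)e; the Leibniz rule for A(x ⊗ e), evaluated at e, gives the
  -- commutator formula.
  let d : H →L[ℂ] H := LinearMap.mkContinuous
    { toFun := fun x => δ (r x) e
      map_add' := fun x y => by
        have : r (x + y) = r x + r y := Subtype.ext (by simp [r])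
        rw [this, map_add, add_apply]
      map_smul' := fun c x => by
        have : r (c • x) = c • r x := Subtype.ext (by simp [r])
        rw [this, map_smul, smul_apply, RingHom.id_apply] } ‖δ‖ hb
  have hd : ∀ x, d x = δ (r x) e := fun x => rfl
  refine ⟨d, d.opNorm_le_bound δ.opNorm_nonneg hb, fun A x hx hAx => ?_⟩
  have h1 : A * r x = r (A.1 x) := Subtype.ext (by
    change A.1 * rankOne ℂ (nproj L x) e = rankOne ℂ (nproj L (A.1 x)) e
    rw [nproj_of_mem hx, nproj_of_mem hAx, mul_rankOne])
  have h2 : (r x).1 e = x := by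
    change rankOne ℂ (nproj L x) e e = x
    simp [nproj_of_mem hx, he]
  have h3 := congrArg (fun T : H →L[ℂ] H => T e) (hδ A (r x))
  simp only [h1, add_apply, mul_apply_eq_comp, h2] at h3
  rw [hd, hd, h3, add_sub_cancel_right]

theorem exists_implementer_of_rankOne {δ : B →L[ℂ] (H →L[ℂ] H)}
    (hδ : ∀ a b : B, δ (a * b) = δ a * b + a * δ b) {e : H} (he : ‖e‖ = 1)
    (heB : ∀ x, rankOne ℂ x e ∈ B) :
    ∃ d : H →L[ℂ] H, ∀ A : B, δ A = d * A - A * d := by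
  obtain ⟨d, -, hd⟩ := exists_implementer_on hδ (L := ⊤) isClosed_univ he fun x _ => heB x
  exact ⟨d, fun A => ContinuousLinearMap.ext fun x => hd A x trivial trivial⟩

/-- No single e need serve the whole space. The implementers for proper members L are bounded by
‖δ‖, so they have a weak limit along an ultrafilter of growing L, and it implements δ on every
proper member, hence on their dense union. -/
theorem exists_implementer_of_pred_eq (hN : IsNest N) (hpred : nestPred N ⊤ = ⊤)
    (htop : (⊤ : Submodule ℂ H) ≠ ⊥) {δ : nestAlgebra N →L[ℂ] (H →L[ℂ] H)}
    (hδ : ∀ a b : nestAlgebra N, δ (a * b) = δ a * b + a * δ b) :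
    ∃ d : H →L[ℂ] H, ∀ A : nestAlgebra N, δ A = d * A - A * d := by
  let I := {L : Submodule ℂ H // L ∈ N ∧ L < ⊤}
  have himp : ∀ L : I, ∃ d : H →L[ℂ] H, ‖d‖ ≤ ‖δ‖ ∧ ∀ (A : nestAlgebra N), ∀ x ∈ L.1,
      A.1 x ∈ L.1 → δ A x = d (A.1 x) - A.1 (d x) := fun L => by
    obtain ⟨e, -, he, he1⟩ := exists_unit_of_lt (hN.isClosed _ L.2.1) L.2.2
    exact exists_implementer_on hδ (hN.isClosed _ L.2.1) he1 fun x hx =>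
      rankOne_mem_nestAlgebra_of_mem hN L.2.1 hx he
  choose d hdn hd using himp
  obtain ⟨Q, hQ⟩ := hN.exists_lt_of_pred_eq htop hpred
  have : Nonempty I := ⟨⟨Q, hQ⟩⟩
  have : IsDirectedOrder I := ⟨fun L L' => by
    obtain ⟨M, hM, h1, h2⟩ := hN.exists_ge_ge L.2 L'.2
    exact ⟨⟨M, hM⟩, h1, h2⟩⟩
  let U : Ultrafilter I := Ultrafilter.of atTop
  obtain ⟨D, -, hD⟩ := exists_weakTendsto_ultrafilter U hdn
  refine ⟨D, fun A => ?_⟩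
  have h1 : ∀ L : I, (D * A.1 - A.1 * D) * nproj L.1 = δ A * nproj L.1 := fun L => by
    refine (((hD.mul_right A.1).sub (hD.mul_left A.1)).mul_right
      (nproj L.1)).eq_of_eventually (Ultrafilter.of_le atTop ?_)
    filter_upwards [eventually_ge_atTop L] with L' hL'
    ext x
    have hx : nproj L.1 x ∈ L'.1 := hL' (nproj_mem (hN.isClosed _ L.2.1) x)
    exact (hd L' A _ hx (A.2 _ L'.2.1 _ hx)).symm
  have h2 : (⊤ : Submodule ℂ H) ≤
      LinearMap.eqLocus (δ A : H →ₗ[ℂ] H) ((D * A.1 - A.1 * D : H →L[ℂ] H) : H →ₗ[ℂ] H) := by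
    rw [← hpred]
    refine Submodule.topologicalClosure_minimal _ (sSup_le fun L hL x hx => ?_)
      (isClosed_eq (δ A).continuous (D * A.1 - A.1 * D).continuous)
    have := congrArg (fun T : H →L[ℂ] H => T x) (h1 ⟨L, hL⟩)
    simp only [mul_apply_eq_comp, nproj_of_mem hx] at this
    exact this.symm
  exact ContinuousLinearMap.ext fun x => h2 (Submodule.mem_top (x := x))

/-- Bounded derivations of nest algebras and of quasi-triangular algebras are inner. -/
theorem exists_mem_derivation_eq (hN : IsNest N)
    (hB : B = nestAlgebra N ∨ B = quasiTriangularAlgebra N) {δ : B →L[ℂ] B}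
    (hδ : ∀ a b : B, δ (a * b) = δ a * b + a * δ b) :
    ∃ d : B, ∀ a : B, δ a = d * a - a * d := by
  rcases subsingleton_or_nontrivial H with hH | hH
  · have : Subsingleton B := ⟨fun a b => Subtype.ext (Subsingleton.elim _ _)⟩
    exact ⟨0, fun a => Subsingleton.elim _ _⟩
  let δ' : B →L[ℂ] (H →L[ℂ] H) := (B.toSubmodule.subtypeL).comp δ
  have hδ'v : ∀ a, δ' a = (δ a : H →L[ℂ] H) := fun a => rfl
  have hδ' : ∀ a b : B, δ' (a * b) = δ' a * b + a * δ' b := fun a b => by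
    rw [hδ'v, hδ]; rfl
  suffices ∃ d ∈ B, ∀ a : B, δ' a = d * a - a * d by
    obtain ⟨d, hd, h⟩ := this
    exact ⟨⟨d, hd⟩, fun a => Subtype.ext (h a)⟩
  rcases hB with rfl | rfl
  · have h : ∃ d : H →L[ℂ] H, ∀ A : nestAlgebra N, δ' A = d * A - A * d := by
      by_cases hpred : nestPred N ⊤ = ⊤
      · exact exists_implementer_of_pred_eq hN hpred top_ne_bot hδ'
      · obtain ⟨e, -, he, he1⟩ := exists_unit_of_lt (hN.isClosed _ (hN.pred_mem ⊤))
          (lt_top_iff_ne_top.2 hpred)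
        refine exists_implementer_of_rankOne hδ' he1 fun x => rankOne_mem_nestAlgebra fun M hM => ?_
        by_cases hMt : M = ⊤
        · exact Or.inl (hMt ▸ trivial)
        · exact Or.inr (Submodule.orthogonal_le (le_nestPred hM (lt_top_iff_ne_top.2 hMt)) he)
    obtain ⟨d, hd⟩ := h
    -- Since δ(P) lies in the nest algebra, (1 − P)(dP − Pd)P = 0, and the left side equals (1 −
    -- P)dP.
    refine ⟨d, mem_nestAlgebra_of_compl_mul hN fun P hP => ?_, hd⟩
    have hP' := nproj_mem_nestAlgebra hN hP
    have h1 := nproj_mul_mul_nproj hN (δ ⟨_, hP'⟩).2 hP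
    have h2 : ((δ ⟨_, hP'⟩ : nestAlgebra N) : H →L[ℂ] H) = d * nproj P - nproj P * d := hd ⟨_, hP'⟩
    rw [h2] at h1
    have h3 : (1 - nproj P) * d * nproj P =
        ((d * nproj P - nproj P * d) * nproj P - nproj P * ((d * nproj P - nproj P * d) * nproj P)) -
          (d * (nproj P * nproj P) - d * nproj P) + nproj P * d * (nproj P * nproj P - nproj P) -
          (nproj P * nproj P - nproj P) * d * nproj P := by
      noncomm_ring
    rw [h3, ← mul_assoc (nproj P) (d * nproj P - nproj P * d), h1, nproj_mul_self]
    simp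
  · obtain ⟨e, -, -, he1⟩ := exists_unit_of_lt (M := (⊥ : Submodule ℂ H))
      (hN.isClosed _ hN.bot_mem) bot_lt_top
    obtain ⟨d, hd⟩ := exists_implementer_of_rankOne hδ' he1 fun x =>
      rankOne_mem_quasiTriangularAlgebra x e
    refine ⟨d, (quasiLocal_of_commutators hN fun A hA => ?_).mem hN, hd⟩
    have h1 : _ = d * A - A * d := hd ⟨A, nestAlgebra_le_quasiTriangularAlgebra hA⟩
    rw [← h1]
    exact (δ ⟨A, nestAlgebra_le_quasiTriangularAlgebra hA⟩).2

end Derivations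

/-! ### Flows as operator groups and their uniform continuity -/

namespace BanachFlow

variable {A : Type*} [NormedRing A] [NormedAlgebra ℂ A]

theorem toCLM_apply (α : BanachFlow A) (t : ℝ) (a : A) : α.toCLM t a = α.aut t a := rfl

theorem toCLM_zero (α : BanachFlow A) : α.toCLM 0 = 1 :=
  ContinuousLinearMap.ext fun a => by rw [toCLM_apply, α.aut_zero]; rfl

theorem toCLM_add (α : BanachFlow A) (s t : ℝ) :
    α.toCLM (s + t) = α.toCLM s * α.toCLM t :=
  ContinuousLinearMap.ext fun a => α.aut_add s t a

theorem tendsto_toCLM_apply (α : BanachFlow A) (a : A) :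
    Tendsto (fun t => α.toCLM t a) (𝓝 0) (𝓝 a) := by
  have h := α.tendsto_aut a 0
  rw [← tendsto_iff_norm_sub_tendsto_zero, α.aut_zero] at h
  exact h

theorem isUniformlyContinuous_of_tendsto_one (α : BanachFlow A)
    (h : Tendsto (fun t => ‖α.toCLM t - 1‖) (𝓝 0) (𝓝 0)) : α.IsUniformlyContinuous := by
  intro t₀
  have h1 : Tendsto (fun t : ℝ => t - t₀) (𝓝 t₀) (𝓝 0) := by
    simpa using (tendsto_id (α := ℝ) (x := 𝓝 t₀)).sub_const t₀
  have h2 := (h.comp h1).mul_const ‖α.toCLM t₀‖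
  rw [zero_mul] at h2
  refine squeeze_zero (fun t => norm_nonneg _) (fun t => ?_) h2
  have h3 : α.toCLM t - α.toCLM t₀ = (α.toCLM (t - t₀) - 1) * α.toCLM t₀ := by
    rw [sub_mul, one_mul, ← toCLM_add, sub_add_cancel]
  rw [h3]
  exact norm_mul_le _ _

theorem IsUniformlyContinuous.continuous {α : BanachFlow A} (h : α.IsUniformlyContinuous) :
    Continuous α.toCLM :=
  continuous_iff_continuousAt.2 fun t₀ => tendsto_iff_norm_sub_tendsto_zero.2 (h t₀)

end BanachFlow

section UniformContinuity

variable {H : Type*} [NormedAddCommGroup H] [InnerProductSpace ℂ H] [CompleteSpace H]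

variable {N : Set (Submodule ℂ H)} {B : Subalgebra ℂ (H →L[ℂ] H)}

theorem isClosed_of_eq_nestAlgebra_or (hN : IsNest N)
    (hB : B = nestAlgebra N ∨ B = quasiTriangularAlgebra N) : IsClosed (B : Set (H →L[ℂ] H)) := by
  rcases hB with rfl | rfl
  exacts [isClosed_nestAlgebra hN, isClosed_quasiTriangularAlgebra hN]

theorem ApproxIdentity.unifOn [Nontrivial H] (hN : IsNest N)
    (hB : B = nestAlgebra N ∨ B = quasiTriangularAlgebra N)
    {γ : ℕ → (H →L[ℂ] H) → (H →L[ℂ] H)} {C : ℝ} (hγ : ApproxIdentity B γ C) : UnifOn γ B := by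
  rcases hB with rfl | rfl
  · exact hγ.unifOn_nestAlgebra hN
  · obtain ⟨e, -, -, he1⟩ := exists_unit_of_lt (M := (⊥ : Submodule ℂ H))
      (hN.isClosed _ hN.bot_mem) bot_lt_top
    exact hγ.unifOn_of_rankOne hN nestAlgebra_le_quasiTriangularAlgebra he1 fun x =>
      rankOne_mem_quasiTriangularAlgebra x e

/-- Convergent orbits are bounded, so Banach–Steinhaus gives a common bound. The maps are extended
by zero outside `B`, where nothing is required of them. -/
theorem BanachFlow.exists_approxIdentity [CompleteSpace B] (α : BanachFlow B) {t : ℕ → ℝ}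
    (ht : Tendsto t atTop (𝓝 0)) : ∃ γ : ℕ → (H →L[ℂ] H) → (H →L[ℂ] H), ∃ C,
      ApproxIdentity B γ C ∧ ∀ n (a : B), γ n a = (α.toCLM (t n) a : B) := by
  classical
  have hlim : ∀ a, Tendsto (fun n => α.toCLM (t n) a) atTop (𝓝 a) := fun a =>
    (α.tendsto_toCLM_apply a).comp ht
  obtain ⟨C, hC⟩ := banach_steinhaus (g := fun n => α.toCLM (t n)) fun a => by
    obtain ⟨K, hK⟩ := (hlim a).norm.bddAbove_range
    exact ⟨K, fun n => hK ⟨n, rfl⟩⟩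
  have hv : ∀ n (a : B), (if h : (a : H →L[ℂ] H) ∈ B then (α.toCLM (t n) ⟨a, h⟩ : H →L[ℂ] H)
      else 0) = (α.toCLM (t n) a : B) := fun n a => by rw [dif_pos a.2]
  refine ⟨fun n A => if h : A ∈ B then (α.toCLM (t n) ⟨A, h⟩ : H →L[ℂ] H) else 0, C,
    ⟨(norm_nonneg _).trans (hC 0), fun n A hA A' hA' => ?_, fun n A hA A' hA' => ?_,
      fun n c A hA => ?_, fun n A hA => ?_, fun A hA => ?_⟩, hv⟩
  · have h1 : (⟨A * A', mul_mem hA hA'⟩ : B) = ⟨A, hA⟩ * ⟨A', hA'⟩ := rfl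
    rw [dif_pos hA, dif_pos hA', dif_pos (mul_mem hA hA'), h1, toCLM_apply, map_mul]
    rfl
  · have h1 : (⟨A + A', add_mem hA hA'⟩ : B) = ⟨A, hA⟩ + ⟨A', hA'⟩ := rfl
    rw [dif_pos hA, dif_pos hA', dif_pos (add_mem hA hA'), h1, map_add]
    rfl
  · have h1 : (⟨c • A, B.smul_mem hA c⟩ : B) = c • ⟨A, hA⟩ := rfl
    rw [dif_pos hA, dif_pos (B.smul_mem hA c), h1, map_smul]
    rfl
  · rw [dif_pos hA]
    exact (α.toCLM (t n)).le_of_opNorm_le (hC n) ⟨A, hA⟩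
  · have h1 := (continuous_subtype_val.tendsto (⟨A, hA⟩ : B)).comp (hlim ⟨A, hA⟩)
    refine h1.congr fun n => ?_
    rw [dif_pos hA]
    rfl

/-- Flows on nest algebras and on quasi-triangular algebras are uniformly continuous. -/
theorem BanachFlow.isUniformlyContinuous (hN : IsNest N)
    (hB : B = nestAlgebra N ∨ B = quasiTriangularAlgebra N) (α : BanachFlow B) :
    α.IsUniformlyContinuous := by
  refine α.isUniformlyContinuous_of_tendsto_one (tendsto_of_seq_tendsto fun t ht => ?_)
  rcases subsingleton_or_nontrivial H with hH | hH
  · have h1 : ∀ n, α.toCLM (t n) - 1 = 0 := fun n =>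
      ContinuousLinearMap.ext fun a => Subtype.ext (Subsingleton.elim _ _)
    simp only [Function.comp_def, h1, norm_zero]
    exact tendsto_const_nhds
  have : CompleteSpace B := (isClosed_of_eq_nestAlgebra_or hN hB).completeSpace_coe
  obtain ⟨γ, C, hγ, hγα⟩ := α.exists_approxIdentity ht
  have hu := hγ.unifOn hN hB
  rw [Metric.tendsto_nhds]
  intro ε hε
  filter_upwards [hu (ε / 2) (half_pos hε)] with n hn
  have h1 : ‖α.toCLM (t n) - 1‖ ≤ ε / 2 :=
    ContinuousLinearMap.opNorm_le_bound _ (half_pos hε).le fun a => by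
      have := hn a a.2
      rw [hγα] at this
      exact this
  rw [Function.comp_apply, Real.dist_eq, sub_zero, abs_of_nonneg (norm_nonneg _)]
  linarith

end UniformContinuity

/-! ### Generators, exponentials and cocycles -/

section OneParameter

/-- A norm continuous one-parameter semigroup in a Banach algebra is differentiable. -/
theorem exists_hasDerivAt_of_continuous_hom {E : Type*} [NormedRing E] [NormedAlgebra ℝ E]
    [CompleteSpace E] {f : ℝ → E} (hf : Continuous f) (h0 : f 0 = 1)
    (hadd : ∀ s t, f (s + t) = f s * f t) : ∃ δ : E, ∀ t, HasDerivAt f (δ * f t) t := by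
  set F : ℝ → E := fun x => ∫ s in (0 : ℝ)..x, f s with hF
  have hFd : ∀ x, HasDerivAt F (f x) x := fun x =>
    intervalIntegral.integral_hasDerivAt_right (hf.intervalIntegrable _ _)
      hf.stronglyMeasurable.stronglyMeasurableAtFilter hf.continuousAt
  -- F(t)/t → f(0) = 1 and units are open, so some F(h) is invertible. As F(t + h) − F(t) =
  -- F(h)f(t), f is then a fixed multiple of a differentiable function.
  obtain ⟨h, u, hu⟩ : ∃ h : ℝ, IsUnit (F h) := by
    have h1 := (hFd 0).tendsto_slope_zero
    have h2 : F 0 = 0 := intervalIntegral.integral_same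
    simp only [zero_add, h2, sub_zero, h0] at h1
    have h3 : ∀ᶠ t : ℝ in 𝓝[≠] 0, IsUnit (t⁻¹ • F t) :=
      h1.eventually (Units.isOpen.mem_nhds (isUnit_one (M := E)))
    obtain ⟨t, ht, ht0⟩ := (h3.and self_mem_nhdsWithin).exists
    refine ⟨t, ?_⟩
    have h4 : t⁻¹ ≠ 0 := inv_ne_zero ht0
    exact (isUnit_smul_iff (Units.mk0 _ h4) (F t)).1 ht
  have hfF : ∀ t, f t = (↑u⁻¹ : E) * (F (t + h) - F t) := fun t => by
    have h1 : F (t + h) - F t = F h * f t := by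
      rw [hF]
      simp only
      rw [intervalIntegral.integral_interval_sub_left (hf.intervalIntegrable _ _)
        (hf.intervalIntegrable _ _)]
      have h2 := ((ContinuousLinearMap.mul ℝ E).flip (f t)).intervalIntegral_comp_comm
        (hf.intervalIntegrable (μ := MeasureTheory.volume) 0 h)
      simp only [ContinuousLinearMap.flip_apply, ContinuousLinearMap.mul_apply', ← hadd] at h2
      rw [← h2, intervalIntegral.integral_comp_add_right, zero_add, add_comm]
    rw [h1, ← hu, Units.inv_mul_cancel_left]
  refine ⟨(↑u⁻¹ : E) * (f h - 1), fun t => ?_⟩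
  have h1 : HasDerivAt (fun t => (↑u⁻¹ : E) * (F (t + h) - F t))
      ((↑u⁻¹ : E) * (f (t + h) - f t)) t :=
    (((hFd (t + h)).comp_add_const t h).sub (hFd t)).const_mul _
  have h2 : (↑u⁻¹ : E) * (f h - 1) * f t = (↑u⁻¹ : E) * (f (t + h) - f t) := by
    rw [mul_assoc, sub_mul, one_mul, ← hadd, add_comm]
  rw [h2, funext hfF]
  convert h1 using 1
  rw [← funext hfF]

variable {A : Type*} [NormedRing A] [NormedAlgebra ℂ A] [CompleteSpace A]

/-- The one-parameter group `t ↦ exp (t d)` of invertible elements. -/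
noncomputable def expUnit (d : A) (t : ℝ) : Aˣ where
  val := NormedSpace.exp (t • d)
  inv := NormedSpace.exp ((-t) • d)
  val_inv := by
    let _ := NormedAlgebra.restrictScalars ℚ ℂ A
    rw [← NormedSpace.exp_add_of_commute (((Commute.refl d).smul_left _).smul_right _), ← add_smul,
      add_neg_cancel, zero_smul, NormedSpace.exp_zero]
  inv_val := by
    let _ := NormedAlgebra.restrictScalars ℚ ℂ A
    rw [← NormedSpace.exp_add_of_commute (((Commute.refl d).smul_left _).smul_right _), ← add_smul,
      neg_add_cancel, zero_smul, NormedSpace.exp_zero]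

theorem expUnit_add (d : A) (s t : ℝ) : expUnit d (s + t) = expUnit d s * expUnit d t := by
  let _ := NormedAlgebra.restrictScalars ℚ ℂ A
  refine Units.ext ?_
  change NormedSpace.exp ((s + t) • d) = NormedSpace.exp (s • d) * NormedSpace.exp (t • d)
  rw [← NormedSpace.exp_add_of_commute (((Commute.refl d).smul_left _).smul_right _), ← add_smul]

theorem expUnit_zero (d : A) : expUnit d 0 = 1 := by
  have h := expUnit_add d 0 0
  rw [add_zero] at h
  exact left_eq_mul.1 h

theorem hasDerivAt_expUnit (d : A) (t : ℝ) :
    HasDerivAt (fun t => (expUnit d t : A)) (d * expUnit d t) t :=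
  hasDerivAt_exp_smul_const' d t

theorem commute_expUnit (d : A) (t : ℝ) : Commute d (expUnit d t : A) :=
  (hasDerivAt_exp_smul_const' d t).unique (hasDerivAt_exp_smul_const d t)

theorem inv_expUnit (d : A) (t : ℝ) : (expUnit d t)⁻¹ = expUnit d (-t) := by
  rw [inv_eq_iff_mul_eq_one, ← expUnit_add, add_neg_cancel, expUnit_zero]

theorem hasDerivAt_inv_expUnit (d : A) (t : ℝ) :
    HasDerivAt (fun t => (↑(expUnit d t)⁻¹ : A)) (-(d * ↑(expUnit d t)⁻¹)) t := by
  simp only [inv_expUnit]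
  simpa [Function.comp_def] using (hasDerivAt_expUnit d (-t)).scomp t (hasDerivAt_neg t)

theorem continuous_expUnit (d : A) : Continuous fun t => (expUnit d t : A) :=
  continuous_iff_continuousAt.2 fun t => (hasDerivAt_expUnit d t).continuousAt

namespace BanachFlow

/-- The generator of a uniformly continuous flow. -/
theorem IsUniformlyContinuous.exists_generator {α : BanachFlow A} (h : α.IsUniformlyContinuous) :
    ∃ δ : A →L[ℂ] A, (∀ a b, δ (a * b) = δ a * b + a * δ b) ∧
      ∀ t a, HasDerivAt (fun t => α.aut t a) (δ (α.aut t a)) t := by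
  obtain ⟨δ, hδ⟩ := exists_hasDerivAt_of_continuous_hom h.continuous α.toCLM_zero α.toCLM_add
  have h1 : ∀ t a, HasDerivAt (fun t => α.aut t a) (δ (α.aut t a)) t := fun t a =>
    (((ContinuousLinearMap.apply ℂ A a).restrictScalars ℝ).hasFDerivAt.comp_hasDerivAt t (hδ t))
  refine ⟨δ, fun a b => ?_, h1⟩
  have h2 := h1 0 (a * b)
  simp only [map_mul] at h2
  have h3 := h2.unique ((h1 0 a).mul (h1 0 b))
  simpa [α.aut_zero] using h3

/-- Undoing the conjugation by exp(td) gives a function with zero derivative. -/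
theorem aut_eq_conj {α : BanachFlow A} {δ : A →L[ℂ] A}
    (hα : ∀ t a, HasDerivAt (fun t => α.aut t a) (δ (α.aut t a)) t) {d : A}
    (hd : ∀ a, δ a = d * a - a * d) (t : ℝ) (a : A) :
    α.aut t a = expUnit d t * a * ↑(expUnit d t)⁻¹ := by
  set w : ℝ → A := fun t => ↑(expUnit d t)⁻¹ * α.aut t a * expUnit d t with hw
  have hw' : ∀ t, HasDerivAt w 0 t := fun t => by
    have h1 := ((hasDerivAt_inv_expUnit d t).mul (hα t a)).mul (hasDerivAt_expUnit d t)
    refine h1.congr_deriv ?_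
    have h2 := (commute_expUnit d t).eq
    have h3 : d * ↑(expUnit d t)⁻¹ = ↑(expUnit d t)⁻¹ * d := by
      rw [inv_expUnit]; exact (commute_expUnit d (-t)).eq
    rw [hd, h3, Pi.mul_apply]
    noncomm_ring
  have h1 : w t = w 0 := is_const_of_deriv_eq_zero (fun t => (hw' t).differentiableAt)
    (fun t => (hw' t).deriv) t 0
  have h2 : w 0 = a := by simp [hw, expUnit_zero, α.aut_zero]
  rw [h2] at h1
  nth_rewrite 2 [← h1]
  rw [hw]
  simp only [mul_assoc, Units.mul_inv, mul_one, Units.mul_inv_cancel_left]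

/-- Inner flows are cocycle perturbations of each other. -/
theorem isCocyclePerturbation_of_conj {α β : BanachFlow A} {a b : A}
    (hα : ∀ t x, α.aut t x = expUnit a t * x * ↑(expUnit a t)⁻¹)
    (hβ : ∀ t x, β.aut t x = expUnit b t * x * ↑(expUnit b t)⁻¹) : β.IsCocyclePerturbation α := by
  -- In u_s α_s(u_t) = e^{sb}e^{−sa} · e^{sa}(e^{tb}e^{−ta})e^{−sa} the inner factors cancel.
  refine ⟨fun t => expUnit b t * (expUnit a t)⁻¹, ⟨?_, fun s t => ?_⟩, fun t x => ?_⟩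
  · simp only [inv_expUnit, Units.val_mul]
    exact (continuous_expUnit b).mul ((continuous_expUnit a).comp continuous_neg)
  · simp only [hα, expUnit_add]
    simp [mul_assoc]
  · rw [hα, hβ]
    simp [mul_assoc]

end BanachFlow

end OneParameter

theorem theorem3p4 {H : Type*} [NormedAddCommGroup H] [InnerProductSpace ℂ H] [CompleteSpace H]
    (N : Set (Submodule ℂ H)) (hN : IsNest N) (B : Subalgebra ℂ (H →L[ℂ] H))
    (hB : B = nestAlgebra N ∨ B = quasiTriangularAlgebra N) :
    (∀ α : BanachFlow B, α.IsUniformlyContinuous) ∧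
      ∀ α β : BanachFlow B, α.IsCocyclePerturbation β ∧ β.IsCocyclePerturbation α := by
  have huc : ∀ α : BanachFlow B, α.IsUniformlyContinuous :=
    BanachFlow.isUniformlyContinuous hN hB
  have : CompleteSpace B := (isClosed_of_eq_nestAlgebra_or hN hB).completeSpace_coe
  have hinner : ∀ α : BanachFlow B, ∃ d : B, ∀ t x,
      α.aut t x = expUnit d t * x * ↑(expUnit d t)⁻¹ := fun α => by
    obtain ⟨δ, hδ, hα⟩ := (huc α).exists_generator
    obtain ⟨d, hd⟩ := exists_mem_derivation_eq hN hB hδ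
    exact ⟨d, BanachFlow.aut_eq_conj hα hd⟩
  refine ⟨huc, fun α β => ?_⟩
  obtain ⟨a, ha⟩ := hinner α
  obtain ⟨b, hb⟩ := hinner β
  exact ⟨BanachFlow.isCocyclePerturbation_of_conj hb ha,
    BanachFlow.isCocyclePerturbation_of_conj ha hb⟩
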